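/- **Setting.** Let $R=\mathbb Q(v)[\pi]/(\pi^2-1)$. It carries two commuting involutions that fix $\mathbb Q$ and $\pi$: the bar involution $\overline{f(v,\pi)}=f(\pi v^{-1},\pi)$ and the dagger involution $f(v,\pi)^\dagger=f(\pi v,\pi)$. Let $(I,\cdot)$ be a bar-consistent anisotropic super Cartan datum. That is, $I$ is finite, $i\cdot j=j\cdot i\in\mathbb Z$, $d_i=\frac{i\cdot i}{2}\in\mathbb Z_{>0}$, $a_{ij}=2\frac{i\cdot j}{i\cdot i}\in\mathbb Z$ with $a_{ij}\le 0$ for $i\ne j$, and $p:I\to\{0,1\}$ is a parity function, not identically $0$, with $a_{ij}$ even whenever $p(i)=1$ and $d_i\equiv p(i)$ mod $2$. Let $X,Y$ be finitely generated free abelian groups with a perfect pairing $\langle\cdot,\cdot\rangle:Y\times X\to\mathbb Z$ and embeddings $I\subset Y$ ($i\mapsto i$, with linearly independent image) and $I\subset X$ ($i\mapsto i'$) such that $\langle i,j'\rangle=a_{ij}$. Put $v_i=v^{d_i}$, $\pi_i=\pi^{d_i}$, and for $n\ge k\ge0$ let ${n\brack k}_i=\prod_{l=n-k+1}^{n}\big((\pi_iv_i)^l-v_i^{-l}\big)\big/\prod_{m=1}^{k}\big((\pi_iv_i)^m-v_i^{-m}\big)$.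 Let $\mathbf f$ be the $R$-algebra generated by $\theta_i$ ($i\in I$) subject to the Serre relations, for $i\neq j$ and $b_{ij}=1-a_{ij}$, $$\sum_{k=0}^{b_{ij}}(-1)^k\pi^{\binom k2p(i)+kp(i)p(j)}{b_{ij}\brack k}_i\theta_i^{b_{ij}-k}\theta_j\theta_i^k=0 .$$ The bar involution of $\mathbf f$ is the ring automorphism extending bar on $R$ and fixing every $\theta_i$. Let $(\cdot,\cdot)$ be the symmetric $R$-bilinear form on $\mathbf f$ with $(1,1)=1$, $(1,\theta_iy)=0$ and $(\theta_ix,y)=\frac{1}{1-\pi_iv_i^{2}}(x,{}_ir(y))$, where ${}_ir:\mathbf f\to\mathbf f$ is the $R$-linear map with ${}_ir(1)=0$ and ${}_ir(\theta_jy)=\delta_{ij}y+\pi^{p(i)p(j)}v^{-i\cdot j}\theta_j\,{}_ir(y)$. Let $\mathbf U$ be the quantum covering group: the $R$-algebra with generators $E_i,F_i$ ($i\in I$), $K_\mu,J_\mu$ ($\mu\in Y$) and relations $J_\mu J_\nu=J_{\mu+\nu}$, $K_\mu K_\nu=K_{\mu+\nu}$, $K_0=J_0=J_\nu^2=1$,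 $J_\mu K_\nu=K_\nu J_\mu$, $J_\mu E_i=\pi^{\langle\mu,i'\rangle}E_iJ_\mu$, $J_\mu F_i=\pi^{-\langle\mu,i'\rangle}F_iJ_\mu$, $K_\mu E_i=v^{\langle\mu,i'\rangle}E_iK_\mu$, $K_\mu F_i=v^{-\langle\mu,i'\rangle}F_iK_\mu$, the Serre relations for the $E_i$ and for the $F_i$, and, with $\tilde J_i=J_{d_ii}$ and $\tilde K_i=K_{d_ii}$, $$E_iF_j-\pi^{p(i)p(j)}F_jE_i=\delta_{ij}\frac{\tilde J_i\tilde K_i-\tilde K_i^{-1}}{\pi_iv_i-v_i^{-1}} .$$ For $x\in\mathbf f$ let $x^-\in\mathbf U$ be its image under $\theta_i\mapsto F_i$. The algebra $\mathbf U$ is $X$-graded with $|E_i|=i'$, $|F_i|=-i'$, $|K_\mu|=|J_\mu|=0$. On $\mathbf U$ consider: * the automorphism $\omega$: $E_i\mapsto F_i$, $F_i\mapsto\pi_i\tilde J_iE_i$, $K_\nu\mapsto K_{-\nu}$, $J_\nu\mapsto J_\nu$; * the anti-automorphism $\rho$: $E_i\mapsto\pi_i\tilde J_iE_i$, $F_i\mapsto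 F_i$, $K_\nu\mapsto K_{-\nu}$, $J_\nu\mapsto J_\nu$; * the bar involution: $E_i\mapsto E_i$, $F_i\mapsto F_i$, $K_\nu\mapsto J_\nu K_{-\nu}$, $J_\nu\mapsto J_\nu$, extending bar on $R$; * the involution $\dagger$: $E_i\mapsto\pi_i\tilde J_iE_i$, $F_i\mapsto F_i$, $K_\nu\mapsto J_\nu K_\nu$, $J_\nu\mapsto J_\nu$, extending $\dagger$ on $R$; * three $R$-linear anti-automorphisms, each fixing all $K_\nu$ and $J_\nu$: $\tau_1$ with $E_i\mapsto v_i^{-1}\tilde K_i^{-1}F_i$, $F_i\mapsto v_i^{-1}\tilde K_iE_i$; $\tau_1'$ with $E_i\mapsto v_i\tilde K_iF_i$, $F_i\mapsto v_i\tilde K_i^{-1}E_i$; and $\tau_1''$ with $E_i\mapsto\pi_iv_i\tilde J_i\tilde K_iF_i$, $F_i\mapsto\pi_iv_i\tilde J_i\tilde K_i^{-1}E_i$. Let $\dot{\mathbf U}=\bigoplus_{\lambda\in X}\mathbf U1_\lambda$ be the modified quantum covering group, where $\mathbf U1_\lambda$ is the quotient of $\mathbf U$ by the left ideal generated by all $K_\nu-v^{\langle\nu,\lambda\rangle}$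 and $J_\nu-\pi^{\langle\nu,\lambda\rangle}$, with product $(x1_\lambda)(y1_\eta)=\delta_{\lambda,\eta+|y|}(xy)1_\eta$ for homogeneous $y$. It is a left $\mathbf U$-module, and it inherits maps $\omega(x1_\lambda)=\omega(x)1_{-\lambda}$, $\rho(x1_\lambda)=1_{-\lambda}\rho(x)$, $\overline{x1_\lambda}=\bar x1_\lambda$ and $(x1_\lambda)^\dagger=x^\dagger1_\lambda$. For an anti-automorphism $\tau$ of $\mathbf U$ and a form $\beta:\mathbf f\times\mathbf f\to R$, say that an $R$-bilinear pairing $B:\dot{\mathbf U}\times\dot{\mathbf U}\to R$ is *of type $(\tau,\beta)$* if 1. $B(1_{\lambda_1}x1_{\lambda_2},1_{\lambda_1'}x'1_{\lambda_2'})=0$ unless $\lambda_1=\lambda_1'$ and $\lambda_2=\lambda_2'$; 2. $B(ux,y)=B(x,\tau(u)y)$ for all $x,y\in\dot{\mathbf U}$, $u\in\mathbf U$; 3. $B(x^-1_\lambda,x'^-1_\lambda)=\beta(x,x')$ for all $x,x'\in\mathbf f$, $\lambda\in X$; 4. $B(x,y)=B(y,x)$ for all $x,y\in\dot{\mathbf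 U}$. Put $\bar\beta(x,x')=\overline{(\bar x,\bar x')}$ for $x,x'\in\mathbf f$. **Proposition.** (a) There is exactly one $R$-bilinear pairing on $\dot{\mathbf U}$ of type $(\tau_1',\bar\beta)$. (b) There is an $R$-bilinear pairing $(\cdot,\cdot)$ on $\dot{\mathbf U}$ of type $(\tau_1,(\cdot,\cdot))$ such that the formula $(x,y)'=\overline{(\bar x^{\,\dagger},\bar y^{\,\dagger})}^{\,\dagger}$ defines an $R$-bilinear pairing $(\cdot,\cdot)'$ on $\dot{\mathbf U}$ that is of type $(\tau_1'',\bar\beta)$ and satisfies $$(\omega(x),\omega^{-1}(y))'=(\rho(x),\rho(y))'=(x,y)'\qquad\text{for all }x,y\in\dot{\mathbf U}.$$ -/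

import Mathlib

noncomputable section

namespace QuantumCovering

/-- The ring `ℚ(v)^π = ℚ(v)[π] / (π² - 1)`. -/
def Qvpi : Type := AdjoinRoot (Polynomial.X ^ 2 - 1 : Polynomial (RatFunc ℚ))

instance : CommRing Qvpi :=
  inferInstanceAs (CommRing (AdjoinRoot (Polynomial.X ^ 2 - 1 : Polynomial (RatFunc ℚ))))

/-- The inclusion `ℚ(v) → ℚ(v)^π`. -/
def ofRat : RatFunc ℚ →+* Qvpi := AdjoinRoot.of _

/-- The element `π`. -/
def piElt : Qvpi := AdjoinRoot.root (Polynomial.X ^ 2 - 1 : Polynomial (RatFunc ℚ))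

theorem piElt_mul_self : piElt * piElt = 1 := by
  have h := AdjoinRoot.eval₂_root (Polynomial.X ^ 2 - 1 : Polynomial (RatFunc ℚ))
  simp only [Polynomial.eval₂_sub, Polynomial.eval₂_pow, Polynomial.eval₂_X,
    Polynomial.eval₂_one] at h
  rw [← sq]
  exact sub_eq_zero.mp h

/-- `π` as a unit. -/
def piU : Qvpiˣ := ⟨piElt, piElt, piElt_mul_self, piElt_mul_self⟩

/-- `v` as a unit. -/
def vU : Qvpiˣ := Units.map ofRat.toMonoidHom (Units.mk0 RatFunc.X RatFunc.X_ne_zero)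

/-- The element `π ^ a * v ^ b`, for integers `a` and `b`. -/
def pv (a b : ℤ) : Qvpi := ((piU ^ a * vU ^ b : Qvpiˣ) : Qvpi)

theorem pv_mul (a b c d : ℤ) : pv a b * pv c d = pv (a + c) (b + d) := by
  rw [pv, pv, pv, ← Units.val_mul, zpow_add, zpow_add, mul_mul_mul_comm]

theorem pv_zero : pv 0 0 = 1 := by simp [pv]

theorem piU_sq : piU ^ 2 = 1 := by
  rw [sq]; ext; exact piElt_mul_self

theorem pv_congr {a a' b b' : ℤ} (ha : Even (a - a')) (hb : b = b') : pv a b = pv a' b' := by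
  subst hb
  obtain ⟨c, hc⟩ := ha
  have : a = 2 * c + a' := by omega
  rw [pv, pv, this, zpow_add, zpow_mul]
  have h2 : piU ^ (2 : ℤ) = 1 := by exact_mod_cast piU_sq
  rw [h2, one_zpow, one_mul]

theorem isUnit_of_coprime_eval (x : Polynomial (RatFunc ℚ)) (h1 : x.eval 1 ≠ 0)
    (h2 : x.eval (-1) ≠ 0) :
    IsUnit (AdjoinRoot.mk (Polynomial.X ^ 2 - 1 : Polynomial (RatFunc ℚ)) x : Qvpi) := by
  have key : ∀ c : RatFunc ℚ, x.eval c ≠ 0 → IsCoprime x (Polynomial.X - Polynomial.C c) := by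
    intro c hc
    refine IsCoprime.symm ((Polynomial.irreducible_X_sub_C c).coprime_iff_not_dvd.mpr ?_)
    rw [Polynomial.dvd_iff_isRoot]
    exact hc
  have h : IsCoprime x (Polynomial.X ^ 2 - 1) := by
    have e : (Polynomial.X ^ 2 - 1 : Polynomial (RatFunc ℚ))
        = (Polynomial.X - Polynomial.C 1) * (Polynomial.X - Polynomial.C (-1)) := by
      simp only [map_one, map_neg]; ring
    rw [e]
    exact (key 1 h1).mul_right (key (-1) h2)
  obtain ⟨a, b, hab⟩ := h
  refine IsUnit.of_mul_eq_one (AdjoinRoot.mk _ a) ?_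
  have := congrArg (AdjoinRoot.mk (Polynomial.X ^ 2 - 1 : Polynomial (RatFunc ℚ))) hab
  rw [map_add, map_mul, map_mul, AdjoinRoot.mk_self, mul_zero, add_zero, map_one, mul_comm] at this
  exact this

theorem rat_aux (p : Polynomial ℚ) (hp : p ≠ 0) (c : RatFunc ℚ) (hc : c = 1 ∨ c = -1) (e : ℤ)
    (he : e = 1 ∨ e = -1) : p.eval₂ (algebraMap ℚ (RatFunc ℚ)) (c * RatFunc.X ^ e) ≠ 0 := by
  have t : Transcendental ℚ (c * RatFunc.X ^ e : RatFunc ℚ) := by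
    have t0 : Transcendental ℚ (RatFunc.X : RatFunc ℚ) := by
      convert RatFunc.transcendental_X (K := ℚ)
      exact Subsingleton.elim _ _
    intro h
    apply t0
    have h1 : IsAlgebraic ℚ (RatFunc.X ^ e : RatFunc ℚ) := by
      rcases hc with rfl | rfl
      · simpa using h
      · simpa using h.neg
    rcases he with rfl | rfl
    · simpa using h1
    · simpa using h1.inv
  intro h
  exact t ⟨p, hp, h⟩

/-- Evaluation of polynomials at `π * v ^ e`. -/
def polyTwist (e : ℤ) : Polynomial ℚ →+* Qvpi :=
  Polynomial.eval₂RingHom (ofRat.comp (algebraMap ℚ (RatFunc ℚ))) (pv 1 e)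

theorem isUnit_polyTwist (p : Polynomial ℚ) (hp : p ≠ 0) (e : ℤ) (he : e = 1 ∨ e = -1) :
    IsUnit (polyTwist e p) := by
  have hx : polyTwist e p =
      (AdjoinRoot.mk (Polynomial.X ^ 2 - 1 : Polynomial (RatFunc ℚ))
        (Polynomial.eval₂ (Polynomial.C.comp (algebraMap ℚ (RatFunc ℚ)))
          (Polynomial.X * Polynomial.C (RatFunc.X ^ e)) p)) := by
    rw [Polynomial.hom_eval₂, polyTwist, Polynomial.coe_eval₂RingHom]
    congr 1
    have : ((vU ^ e : Qvpiˣ) : Qvpi) = ofRat (RatFunc.X ^ e) := by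
      rw [vU, ← map_zpow, Units.coe_map, Units.val_zpow_eq_zpow_val]
      rfl
    rw [map_mul, AdjoinRoot.mk_X, AdjoinRoot.mk_C, pv, Units.val_mul, this, zpow_one]
    rfl
  rw [hx]
  have ev : ∀ c : RatFunc ℚ, (Polynomial.eval₂ (Polynomial.C.comp (algebraMap ℚ (RatFunc ℚ)))
          (Polynomial.X * Polynomial.C (RatFunc.X ^ e)) p).eval c
          = p.eval₂ (algebraMap ℚ (RatFunc ℚ)) (c * RatFunc.X ^ e) := by
    intro c
    rw [← Polynomial.coe_evalRingHom, Polynomial.hom_eval₂]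
    congr 1
    · ext; simp
    · simp only [Polynomial.coe_evalRingHom, Polynomial.eval_mul, Polynomial.eval_X,
        Polynomial.eval_C]
  apply isUnit_of_coprime_eval
  · rw [ev]; exact rat_aux p hp 1 (Or.inl rfl) e he
  · rw [ev]; exact rat_aux p hp (-1) (Or.inr rfl) e he

/-- The ring homomorphism `ℚ(v) → ℚ(v)^π` with `v ↦ π * v ^ e`, for `e = 1` or `e = -1`. -/
def ratTwist (e : ℤ) (he : e = 1 ∨ e = -1) : RatFunc ℚ →+* Qvpi :=
  IsLocalization.lift (M := nonZeroDivisors (Polynomial ℚ)) (g := polyTwist e)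
    (fun y => isUnit_polyTwist _ (nonZeroDivisors.ne_zero y.2) e he)

theorem ratTwist_X (e : ℤ) (he : e = 1 ∨ e = -1) : ratTwist e he RatFunc.X = pv 1 e := by
  rw [← RatFunc.algebraMap_X, ratTwist, IsLocalization.lift_eq]
  simp [polyTwist]

/-- The endomorphism `f(v, π) ↦ f(π v ^ e, π)` of `ℚ(v)^π`, for `e = 1` or `e = -1`. -/
def scalarTwist (e : ℤ) (he : e = 1 ∨ e = -1) : Qvpi →+* Qvpi :=
  AdjoinRoot.lift (ratTwist e he) piElt (by
    simp [sq, piElt_mul_self])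

theorem scalarTwist_pi (e : ℤ) (he : e = 1 ∨ e = -1) : scalarTwist e he piElt = piElt :=
  AdjoinRoot.lift_root _

theorem scalarTwist_pv (e : ℤ) (he : e = 1 ∨ e = -1) (a b : ℤ) :
    scalarTwist e he (pv a b) = pv (a + b) (e * b) := by
  have h1 : Units.map (scalarTwist e he).toMonoidHom piU = piU := by
    ext; exact scalarTwist_pi e he
  have h2 : Units.map (scalarTwist e he).toMonoidHom vU = piU * vU ^ e := by
    ext
    have : scalarTwist e he (ofRat RatFunc.X) = pv 1 e :=
      (AdjoinRoot.lift_of _).trans (ratTwist_X e he)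
    rw [pv, zpow_one] at this
    exact this
  have : Units.map (scalarTwist e he).toMonoidHom (piU ^ a * vU ^ b)
      = piU ^ (a + b) * vU ^ (e * b) := by
    rw [map_mul, map_zpow, map_zpow, h1, h2, mul_zpow, ← mul_assoc, zpow_add, zpow_mul]
  exact congrArg Units.val this

/-- The bar involution `f(v, π) ↦ f(π v⁻¹, π)` of `ℚ(v)^π`. -/
def barR : Qvpi →+* Qvpi := scalarTwist (-1) (Or.inr rfl)

/-- The dagger involution `f(v, π) ↦ f(π v, π)` of `ℚ(v)^π`. -/
def dagR : Qvpi →+* Qvpi := scalarTwist 1 (Or.inl rfl)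

theorem barR_pv (a b : ℤ) : barR (pv a b) = pv (a + b) (-b) := by
  rw [barR, scalarTwist_pv]; simp

theorem dagR_pv (a b : ℤ) : dagR (pv a b) = pv (a + b) b := by
  rw [dagR, scalarTwist_pv]; simp

/-- `(π v) ^ m - v ^ (-m)`. -/
def qd (m : ℤ) : Qvpi := pv m m - pv 0 (-m)

theorem qd_zero : qd 0 = 0 := by simp [qd]

theorem isUnit_qd {m : ℤ} (hm : m ≠ 0) : IsUnit (qd m) := by
  have h : qd m * (pv m m + pv 0 (-m)) = ofRat (RatFunc.X ^ (2 * m) - RatFunc.X ^ (-(2 * m))) := by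
    have e : ∀ n : ℤ, ofRat (RatFunc.X ^ n) = pv 0 n := by
      intro n
      rw [pv, vU, ← map_zpow, zpow_zero, one_mul, Units.coe_map, Units.val_zpow_eq_zpow_val]
      rfl
    rw [map_sub, e, e, qd]
    have e1 : pv m m * pv m m = pv 0 (2 * m) := by
      rw [pv_mul]; exact pv_congr ⟨m, by ring⟩ (by ring)
    have e2 : pv 0 (-m) * pv 0 (-m) = pv 0 (-(2 * m)) := by
      rw [pv_mul]; exact pv_congr ⟨0, by ring⟩ (by ring)
    linear_combination e1 - e2
  have hne : (RatFunc.X ^ (2 * m) - RatFunc.X ^ (-(2 * m)) : RatFunc ℚ) ≠ 0 := by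
    intro h0
    have h1 : (RatFunc.X ^ (2 * m) : RatFunc ℚ) = RatFunc.X ^ (-(2 * m)) := sub_eq_zero.mp h0
    have hx : (RatFunc.X : RatFunc ℚ) ≠ 0 := RatFunc.X_ne_zero
    have h2 : (RatFunc.X ^ (4 * m) : RatFunc ℚ) = 1 := by
      have e : 4 * m = 2 * m + 2 * m := by ring
      rw [e, zpow_add₀ hx]
      nth_rewrite 2 [h1]
      rw [← zpow_add₀ hx]; simp
    have h3 : (RatFunc.X ^ ((4 * m).natAbs) : RatFunc ℚ) = 1 := by
      rcases Int.natAbs_eq (4 * m) with h | h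
      · rw [h, zpow_natCast] at h2; exact h2
      · rw [h, zpow_neg, zpow_natCast, inv_eq_one] at h2; exact h2
    have hn : (4 * m).natAbs ≠ 0 := by omega
    refine RatFunc.transcendental_X (K := ℚ) ⟨Polynomial.X ^ ((4 * m).natAbs) - 1, ?_, ?_⟩
    · exact (Polynomial.monic_X_pow_sub_C (1 : ℚ) hn).ne_zero
    · simp [h3]
  have hu : IsUnit (qd m * (pv m m + pv 0 (-m))) := by
    rw [h]; exact (IsUnit.mk0 _ hne).map ofRat
  exact isUnit_of_mul_isUnit_left hu

theorem barR_qd (m : ℤ) : barR (qd m) = - qd m := by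
  rw [qd, map_sub, barR_pv, barR_pv, neg_sub]
  congr 1
  · exact pv_congr ⟨m, by ring⟩ rfl
  · exact pv_congr ⟨-m, by ring⟩ (by ring)

theorem dagR_qd (m : ℤ) : dagR (qd m) = pv m 0 * qd m := by
  rw [qd, map_sub, dagR_pv, dagR_pv, mul_sub, pv_mul, pv_mul]
  congr 1
  · exact pv_congr ⟨0, by ring⟩ (by ring)
  · exact pv_congr ⟨-m, by ring⟩ (by ring)

/-- The `(v, π)`-binomial coefficient `[n choose k]` at `(v ^ d, π ^ d)`. -/
def qbinom (d : ℤ) (n k : ℕ) : Qvpi :=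
  (∏ s ∈ Finset.range k, qd (d * ((n : ℤ) - s))) *
    Ring.inverse (∏ s ∈ Finset.range k, qd (d * ((s : ℤ) + 1)))

theorem map_inverse_of_isUnit (σ : Qvpi →+* Qvpi) {x : Qvpi} (hx : IsUnit x) :
    σ (Ring.inverse x) = Ring.inverse (σ x) := by
  obtain ⟨u, rfl⟩ := hx
  rw [Ring.inverse_unit]
  have : σ (u : Qvpi) = ((Units.map σ.toMonoidHom u : Qvpiˣ) : Qvpi) := rfl
  rw [this, Ring.inverse_unit]
  rfl

/-- The denominator of the binomial coefficient. -/
def qden (d : ℤ) (k : ℕ) : Qvpi := ∏ s ∈ Finset.range k, qd (d * ((s : ℤ) + 1))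

/-- The numerator of the binomial coefficient. -/
def qnum (d : ℤ) (n k : ℕ) : Qvpi := ∏ s ∈ Finset.range k, qd (d * ((n : ℤ) - s))

theorem isUnit_qden {d : ℤ} (hd : d ≠ 0) (k : ℕ) : IsUnit (qden d k) := by
  rw [qden, IsUnit.prod_iff]
  intro s _
  exact isUnit_qd (mul_ne_zero hd (by omega))

theorem qbinom_mul_qden {d : ℤ} (hd : d ≠ 0) (n k : ℕ) : qbinom d n k * qden d k = qnum d n k := by
  change qnum d n k * Ring.inverse (qden d k) * qden d k = _
  rw [mul_assoc, Ring.inverse_mul_cancel _ (isUnit_qden hd k), mul_one]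

theorem barR_qbinom {d : ℤ} (hd : d ≠ 0) (n k : ℕ) : barR (qbinom d n k) = qbinom d n k := by
  refine (isUnit_qden hd k).mul_right_cancel ?_
  have h1 : barR (qden d k) = (-1) ^ k * qden d k := by
    rw [qden, map_prod]; simp only [barR_qd]; rw [Finset.prod_neg, Finset.card_range]
  have h2 : barR (qnum d n k) = (-1) ^ k * qnum d n k := by
    rw [qnum, map_prod]; simp only [barR_qd]; rw [Finset.prod_neg, Finset.card_range]
  have h := congrArg barR (qbinom_mul_qden hd n k)
  rw [map_mul, h1, h2, ← qbinom_mul_qden hd n k] at h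
  have h3 : ((-1 : Qvpi) ^ k) * (-1) ^ k = 1 := by rw [← mul_pow]; simp
  linear_combination (-1) ^ k * h + (qbinom d n k * qden d k - barR (qbinom d n k) * qden d k) * h3

theorem dagR_qbinom {d : ℤ} (hd : d ≠ 0) (n k : ℕ) (h : Even (d * (n - 1))) :
    dagR (qbinom d n k) = qbinom d n k := by
  refine (isUnit_qden hd k).mul_right_cancel ?_
  have key : ∀ k : ℕ, ∃ e : ℤ, dagR (qden d k) = pv e 0 * qden d k ∧
      dagR (qnum d n k) = pv e 0 * qnum d n k := by
    intro k
    induction k with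
    | zero => exact ⟨0, by simp [qden, pv_zero], by simp [qnum, pv_zero]⟩
    | succ k ih =>
      obtain ⟨e, h1, h2⟩ := ih
      refine ⟨e + d * (k + 1), ?_, ?_⟩
      · rw [qden, Finset.prod_range_succ, map_mul, dagR_qd, ← qden, h1]
        have : pv (e + d * (k + 1)) 0 = pv e 0 * pv (d * (k + 1)) 0 := by rw [pv_mul, add_zero]
        rw [this]; ring
      · rw [qnum, Finset.prod_range_succ, map_mul, dagR_qd, ← qnum, h2]
        have : pv (e + d * (k + 1)) 0 = pv e 0 * pv (d * (n - k)) 0 := by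
          rw [pv_mul]
          refine pv_congr ?_ (by ring)
          obtain ⟨c, hc⟩ := h
          exact ⟨d * (k + 1) - c - d, by linear_combination -hc⟩
        rw [this]; ring
  obtain ⟨e, h1, h2⟩ := key k
  have h := congrArg dagR (qbinom_mul_qden hd n k)
  rw [map_mul, h1, h2, ← qbinom_mul_qden hd n k] at h
  have h3 : pv e 0 * pv e 0 = 1 := by
    rw [pv_mul, ← pv_zero]; exact pv_congr ⟨e, by ring⟩ (by ring)
  linear_combination pv e 0 * h + (qbinom d n k * qden d k - dagR (qbinom d n k) * qden d k) * h3

theorem qbinom_succ {d : ℤ} (hd : d ≠ 0) (n k : ℕ) :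
    qbinom d n (k + 1) * qd (d * ((k : ℤ) + 1)) = qbinom d n k * qd (d * ((n : ℤ) - k)) := by
  refine (isUnit_qden hd k).mul_right_cancel ?_
  have h1 := qbinom_mul_qden hd n k
  have h2 := qbinom_mul_qden hd n (k + 1)
  rw [qden, Finset.prod_range_succ, ← qden, qnum, Finset.prod_range_succ, ← qnum] at h2
  linear_combination h2 - qd (d * ((n : ℤ) - k)) * h1

theorem qnum_mul_qden (d : ℤ) {n k : ℕ} (hk : k ≤ n) : qnum d n k * qden d (n - k) = qden d n := by
  obtain ⟨m, rfl⟩ := Nat.exists_eq_add_of_le hk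
  rw [Nat.add_sub_cancel_left]
  rw [add_comm k m]
  have : qden d (m + k) = qden d m * ∏ s ∈ Finset.range k, qd (d * (((m + s : ℕ) : ℤ) + 1)) := by
    rw [qden, Finset.prod_range_add, ← qden]
  rw [this, mul_comm, qnum, ← Finset.prod_range_reflect]
  congr 1
  refine Finset.prod_congr rfl fun s hs => ?_
  have := Finset.mem_range.mp hs
  congr 2
  push_cast [Nat.cast_sub (show 1 ≤ k by omega), Nat.cast_sub (show s ≤ k - 1 by omega)]
  ring

theorem qbinom_symm {d : ℤ} (hd : d ≠ 0) {n k : ℕ} (hk : k ≤ n) :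
    qbinom d n (n - k) = qbinom d n k := by
  have h1 := qbinom_mul_qden hd n k
  have h2 := qbinom_mul_qden hd n (n - k)
  have h3 := qnum_mul_qden d hk
  have h4 := qnum_mul_qden d (Nat.sub_le n k)
  rw [Nat.sub_sub_self hk] at h4
  refine ((isUnit_qden hd k).mul (isUnit_qden hd (n - k))).mul_right_cancel ?_
  linear_combination qden d k * h2 - qden d (n - k) * h1 - h3 + h4

theorem choose_two_succ (k : ℕ) : (((k + 1).choose 2 : ℕ) : ℤ) = (k.choose 2 : ℕ) + k := by
  have : (k + 1).choose 2 = k + k.choose 2 := by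
    rw [Nat.choose_succ_succ' k 1, Nat.choose_one_right]
  rw [this]; push_cast; ring

theorem qbinom_alt_sum_aux {d : ℤ} (hd : d ≠ 0) (n : ℕ) (h : Even (d * (n - 1))) (m : ℕ) :
    (∑ k ∈ Finset.range (m + 1), (-1) ^ k *
      pv (d * (k.choose 2 : ℕ)) (d * k * (1 - n)) * qbinom d n k) * qden d m =
    (-1) ^ m * pv (d * (m.choose 2 : ℕ)) (-(d * n * m)) *
      ∏ s ∈ Finset.range m, qd (d * ((n : ℤ) - (s + 1))) := by
  induction m with
  | zero => simp [qden, pv_zero, qbinom]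
  | succ m ih =>
    rw [Finset.sum_range_succ, add_mul]
    have h2 := qbinom_mul_qden hd n (m + 1)
    have h3 : qden d (m + 1) = qden d m * qd (d * ((m : ℤ) + 1)) := by
      rw [qden, Finset.prod_range_succ, ← qden]
    have h4 : qnum d n (m + 1) = (∏ s ∈ Finset.range m, qd (d * ((n : ℤ) - (s + 1)))) *
        qd (d * n) := by
      rw [qnum, Finset.prod_range_succ']; simp
    rw [h4] at h2
    rw [Finset.prod_range_succ]
    set P := ∏ s ∈ Finset.range m, qd (d * ((n : ℤ) - (s + 1)))
    set S := ∑ k ∈ Finset.range (m + 1), (-1) ^ k *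
      pv (d * (k.choose 2 : ℕ)) (d * k * (1 - n)) * qbinom d n k
    rw [choose_two_succ]
    set c : ℤ := ((m.choose 2 : ℕ) : ℤ)
    obtain ⟨z, hz⟩ := h
    have key : pv (d * c) (-(d * n * m)) * qd (d * ((m : ℤ) + 1))
        - pv (d * (c + m)) (d * ((m + 1 : ℕ) : ℤ) * (1 - n)) * qd (d * n)
        = - (pv (d * (c + m)) (-(d * n * ((m + 1 : ℕ) : ℤ))) * qd (d * ((n : ℤ) - (m + 1)))) := by
      simp only [qd, mul_sub, pv_mul]
      have e1 : pv (d * c + d * ((m : ℤ) + 1)) (-(d * n * m) + d * ((m : ℤ) + 1)) =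
          pv (d * (c + m) + d * n) (d * ((m + 1 : ℕ) : ℤ) * (1 - n) + d * n) :=
        pv_congr ⟨-z, by linear_combination -hz⟩ (by push_cast; ring)
      have e2 : pv (d * c + 0) (-(d * n * m) + -(d * ((m : ℤ) + 1))) =
          pv (d * (c + m) + d * ((n : ℤ) - (m + 1)))
            (-(d * n * ((m + 1 : ℕ) : ℤ)) + d * ((n : ℤ) - (m + 1))) :=
        pv_congr ⟨-z, by linear_combination -hz⟩ (by push_cast; ring)
      have e3 : pv (d * (c + m) + 0) (d * ((m + 1 : ℕ) : ℤ) * (1 - n) + -(d * n)) =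
          pv (d * (c + m) + 0) (-(d * n * ((m + 1 : ℕ) : ℤ)) + -(d * ((n : ℤ) - (m + 1)))) :=
        pv_congr ⟨0, by ring⟩ (by push_cast; ring)
      simp only [mul_sub] at e1 e2 e3 ⊢
      linear_combination e1 - e2 + e3
    rw [show (-1 : Qvpi) ^ (m + 1) = -(-1) ^ m by rw [pow_succ]; ring, h3]
    rw [h3] at h2
    linear_combination qd (d * ((m : ℤ) + 1)) * ih + (-1) ^ m * P * key
      - (-1) ^ m * pv (d * (c + m)) (d * ((m + 1 : ℕ) : ℤ) * (1 - n)) * h2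

theorem qbinom_alt_sum {d : ℤ} (hd : d ≠ 0) (n : ℕ) (hn : n ≠ 0) (h : Even (d * (n - 1))) :
    ∑ k ∈ Finset.range (n + 1), (-1) ^ k *
      pv (d * (k.choose 2 : ℕ)) (d * k * (1 - n)) * qbinom d n k = 0 := by
  refine (isUnit_qden hd n).mul_right_cancel ?_
  rw [qbinom_alt_sum_aux hd n h n, zero_mul]
  have : ∏ s ∈ Finset.range n, qd (d * ((n : ℤ) - (s + 1))) = 0 := by
    refine Finset.prod_eq_zero (Finset.mem_range.mpr (Nat.sub_lt (Nat.pos_of_ne_zero hn) one_pos)) ?_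
    have : d * ((n : ℤ) - (((n - 1 : ℕ) : ℤ) + 1)) = 0 := by
      rw [Nat.cast_sub (Nat.one_le_iff_ne_zero.mpr hn)]; push_cast; ring
    rw [this, qd_zero]
  rw [this, mul_zero]

/-- A bar-consistent anisotropic super Cartan datum `(I, ·)` with `I₁ ≠ ∅`, together with a
`Y`-regular root datum `(Y, X, ⟨·,·⟩)` for it.  The bilinear form on `ℤ[I]` is given by its values
`dot i j = i · j` on the basis `I`; the numbers `d i = (i · i) / 2`, `a i j = 2 (i · j) / (i · i)`
are recorded by the equations that determine them; `p` is the parity. -/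
structure Datum (I X Y : Type*) [AddCommGroup X] [AddCommGroup Y] where
  dot : I → I → ℤ
  d : I → ℤ
  a : I → I → ℤ
  p : I → ℤ
  dot_symm : ∀ i j, dot i j = dot j i
  dot_self : ∀ i, dot i i = 2 * d i
  d_pos : ∀ i, 0 < d i
  dot_eq : ∀ i j, 2 * dot i j = a i j * dot i i
  a_nonpos : ∀ i j, i ≠ j → a i j ≤ 0
  p_values : ∀ i, p i = 0 ∨ p i = 1
  anisotropic : ∀ i j, p i = 1 → Even (a i j)
  bar_consistent : ∀ i, Even (d i - p i)
  exists_odd : ∃ i, p i = 1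
  pairing : Y →ₗ[ℤ] X →ₗ[ℤ] ℤ
  perfect : pairing.IsPerfPair
  /-- The embedding `i ↦ i'` of `I` into `X`. -/
  rootX : I → X
  /-- The embedding `i ↦ i` of `I` into `Y`. -/
  rootY : I → Y
  rootX_injective : Function.Injective rootX
  rootY_linearIndependent : LinearIndependent ℤ rootY
  pairing_root : ∀ i j, pairing (rootY i) (rootX j) = a i j

variable {I X Y : Type*} [AddCommGroup X] [AddCommGroup Y] (D : Datum I X Y)

namespace Datum

/-- `b i j = 1 - a i j` (used for `i ≠ j` only). -/
def b (i j : I) : ℕ := (1 - D.a i j).toNat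

theorem d_ne (i : I) : D.d i ≠ 0 := (D.d_pos i).ne'

theorem dot_eq_d_mul_a (i j : I) : D.dot i j = D.d i * D.a i j := by
  have h1 := D.dot_eq i j
  rw [D.dot_self] at h1
  linarith

theorem even_d_mul_a (i j : I) : Even (D.d i * D.a i j) := by
  rcases D.p_values i with h | h
  · have := D.bar_consistent i
    rw [h, sub_zero] at this
    exact this.mul_right _
  · exact (D.anisotropic i j h).mul_left _

theorem even_dot (i j : I) : Even (D.dot i j) := by
  rw [D.dot_eq_d_mul_a]; exact D.even_d_mul_a i j

theorem cast_b {i j : I} (h : i ≠ j) : (D.b i j : ℤ) = 1 - D.a i j := by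
  have := D.a_nonpos i j h
  rw [b, Int.toNat_of_nonneg (by omega)]

theorem b_ne_zero {i j : I} (h : i ≠ j) : D.b i j ≠ 0 := by
  have h1 := D.cast_b h
  have := D.a_nonpos i j h
  omega

theorem even_d_mul_b {i j : I} (h : i ≠ j) : Even (D.d i * ((D.b i j : ℤ) - 1)) := by
  rw [D.cast_b h]
  obtain ⟨c, hc⟩ := D.even_d_mul_a i j
  exact ⟨-c, by linear_combination -hc⟩

/-- The coefficient of `x ^ (b - k) * y * x ^ k` in the quantum Serre relation. -/
def serreCoeff (i j : I) (k : ℕ) : Qvpi :=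
  (-1) ^ k * pv ((k.choose 2 : ℕ) * D.p i + k * D.p i * D.p j) 0 * qbinom (D.d i) (D.b i j) k

/-- The left-hand side of the quantum Serre relation for `i ≠ j`, evaluated at `x` and `y`. -/
def serre {A : Type*} [Ring A] [Algebra Qvpi A] (i j : I) (x y : A) : A :=
  ∑ k ∈ Finset.range (D.b i j + 1), D.serreCoeff i j k • (x ^ (D.b i j - k) * y * x ^ k)

theorem map_serre {A B : Type*} [Ring A] [Algebra Qvpi A] [Ring B] [Algebra Qvpi B]
    (φ : A →ₐ[Qvpi] B) (i j : I) (x y : A) : φ (D.serre i j x y) = D.serre i j (φ x) (φ y) := by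
  simp [serre]

theorem serre_zero {A : Type*} [Ring A] [Algebra Qvpi A] (i j : I) :
    D.serre i j (0 : A) (0 : A) = 0 := by
  simp [serre]

end Datum

/-- The defining relations of `𝐟`. -/
inductive HalfRel : FreeAlgebra Qvpi I → FreeAlgebra Qvpi I → Prop
  | serre (i j : I) (h : i ≠ j) :
      HalfRel (D.serre i j (FreeAlgebra.ι Qvpi i) (FreeAlgebra.ι Qvpi j)) 0

/-- The half quantum covering group `𝐟`. -/
def Half : Type _ := RingQuot (HalfRel D)

instance : Ring (Half D) := inferInstanceAs (Ring (RingQuot (HalfRel D)))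
instance : Algebra Qvpi (Half D) := inferInstanceAs (Algebra Qvpi (RingQuot (HalfRel D)))

namespace Half

/-- The quotient map from the free algebra. -/
def mk : FreeAlgebra Qvpi I →ₐ[Qvpi] Half D := RingQuot.mkAlgHom Qvpi (HalfRel D)

theorem mk_surjective : Function.Surjective (mk D) := RingQuot.mkAlgHom_surjective _ _

/-- The generator `θ_i`. -/
def θ (i : I) : Half D := mk D (FreeAlgebra.ι Qvpi i)

theorem serre_θ {i j : I} (h : i ≠ j) : D.serre i j (θ D i) (θ D j) = 0 := by
  rw [θ, θ, ← D.map_serre]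
  exact (RingQuot.mkAlgHom_rel Qvpi (HalfRel.serre (D := D) i j h)).trans
    (map_zero (RingQuot.mkAlgHom Qvpi (HalfRel D)))

/-- The universal property of `𝐟`. -/
def lift {A : Type*} [Ring A] [Algebra Qvpi A] (f : I → A)
    (h : ∀ i j, i ≠ j → D.serre i j (f i) (f j) = 0) : Half D →ₐ[Qvpi] A :=
  RingQuot.liftAlgHom Qvpi ⟨FreeAlgebra.lift Qvpi f, by
    intro x y hxy
    obtain ⟨i, j, hij⟩ := hxy
    rw [D.map_serre, FreeAlgebra.lift_ι_apply, FreeAlgebra.lift_ι_apply, h i j hij, map_zero]⟩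

theorem lift_mk {A : Type*} [Ring A] [Algebra Qvpi A] (f : I → A)
    (h : ∀ i j, i ≠ j → D.serre i j (f i) (f j) = 0) (x : FreeAlgebra Qvpi I) :
    lift D f h (mk D x) = FreeAlgebra.lift Qvpi f x := by
  rw [lift, mk]
  exact RingQuot.liftAlgHom_mkAlgHom_apply _ _ _ _

theorem lift_θ {A : Type*} [Ring A] [Algebra Qvpi A] (f : I → A)
    (h : ∀ i j, i ≠ j → D.serre i j (f i) (f j) = 0) (i : I) : lift D f h (θ D i) = f i := by
  rw [θ, lift_mk, FreeAlgebra.lift_ι_apply]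

end Half

/-- The scalar `π ^ (p(i) p(j)) v ^ (- i · j)`. -/
def twistScalar (i j : I) : Qvpi := pv (D.p i * D.p j) (-D.dot i j)

open Classical in
/-- The matrix with rows `(g(θ_j), δ_ij)` and `(0, θ_j)`, where `g(θ_j)` is
`π ^ (p(i) p(j)) v ^ (- i · j) θ_j`. -/
def derivMatrix {A : Type*} [Ring A] [Algebra Qvpi A] (t : I → A) (i j : I) :
    Matrix (Fin 2) (Fin 2) A :=
  !![twistScalar D i j • t j, if i = j then 1 else 0; 0, t j]

theorem mat_mul {A : Type*} [Ring A] (a b c a' b' c' : A) :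
    !![a, b; 0, c] * !![a', b'; 0, c'] = !![a * a', a * b' + b * c'; 0, c * c'] := by
  rw [Matrix.mul_fin_two]; simp

theorem mat_pow {A : Type*} [Ring A] [Algebra Qvpi A] (α e : Qvpi) (x : A) (n : ℕ) :
    (!![α • x, algebraMap Qvpi A e; 0, x] : Matrix (Fin 2) (Fin 2) A) ^ n =
      !![α ^ n • x ^ n, ((∑ s ∈ Finset.range n, α ^ s) * e) • x ^ (n - 1); 0, x ^ n] := by
  induction n with
  | zero =>
    ext i j; fin_cases i <;> fin_cases j <;> simp
  | succ n ih =>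
    rw [pow_succ, ih, mat_mul]
    congr 1
    rcases n with _ | n
    · simp [Algebra.algebraMap_eq_smul_one]
    · ext i j
      fin_cases i <;> fin_cases j
      · simp [pow_succ, smul_smul, mul_comm]
      · rw [Finset.sum_range_succ _ (n + 1)]
        simp [Algebra.algebraMap_eq_smul_one, pow_succ, smul_smul, add_mul, add_smul]
        module
      · simp
      · simp [pow_succ]

theorem mat_word {A : Type*} [Ring A] [Algebra Qvpi A] (α β e f : Qvpi) (x y : A) (m n : ℕ) :
    (!![α • x, algebraMap Qvpi A e; 0, x] : Matrix (Fin 2) (Fin 2) A) ^ m *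
      !![β • y, algebraMap Qvpi A f; 0, y] * !![α • x, algebraMap Qvpi A e; 0, x] ^ n =
      !![(α ^ (m + n) * β) • (x ^ m * y * x ^ n),
        ((α ^ m * β * ∑ s ∈ Finset.range n, α ^ s) * e) • (x ^ m * y * x ^ (n - 1)) +
        ((∑ s ∈ Finset.range m, α ^ s) * e) • (x ^ (m - 1) * y * x ^ n) +
        (α ^ m * f) • x ^ (m + n);
        0, x ^ m * y * x ^ n] := by
  rw [mat_pow, mat_pow, mat_mul, mat_mul]
  ext i j
  fin_cases i <;> fin_cases j
  · simp only [smul_mul_smul_comm, Matrix.of_apply, Matrix.cons_val', Matrix.cons_val_zero,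
      Fin.zero_eta]
    congr 1
    ring
  · simp only [Algebra.algebraMap_eq_smul_one, Matrix.of_apply, Matrix.cons_val', Fin.zero_eta,
      Matrix.cons_val_zero, Fin.mk_one, Matrix.cons_val_one, smul_mul_assoc,
      mul_smul_comm, mul_one, add_mul, smul_smul, mul_assoc, pow_add]
    module
  · simp
  · simp

/-- `(1 + α + ⋯ + α ^ (n - 1)) (π ^ d v ^ d - v ^ (-d)) = (π v) ^ (d - d n) [..]`. -/
theorem geom_qd (d : ℤ) (n : ℕ) :
    (∑ s ∈ Finset.range n, pv d (-(2 * d)) ^ s) * qd d * pv (d * n) (d * n) =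
      pv d d * qd (d * n) := by
  have hpow : ∀ n : ℕ, pv d (-(2 * d)) ^ n = pv (d * n) (-(2 * d * n)) := by
    intro n
    induction n with
    | zero => simp [pv_zero]
    | succ n ih => rw [pow_succ, ih, pv_mul]; congr 1 <;> (push_cast; ring)
  have h1 := geom_sum_mul (pv d (-(2 * d))) n
  have h2 : qd d = pv d d * (1 - pv d (-(2 * d))) := by
    rw [qd, mul_sub, mul_one, pv_mul]
    congr 1
    exact pv_congr ⟨-d, by ring⟩ (by ring)
  have h3 : qd (d * n) = pv (d * n) (d * n) * (1 - pv d (-(2 * d)) ^ n) := by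
    rw [hpow, qd, mul_sub, mul_one, pv_mul]
    congr 1
    exact pv_congr ⟨-(d * n), by ring⟩ (by ring)
  rw [h2, h3]
  linear_combination -pv d d * pv (d * n) (d * n) * h1

theorem pv_pow (a b : ℤ) (n : ℕ) : pv a b ^ n = pv (n * a) (n * b) := by
  induction n with
  | zero => simp [pv_zero]
  | succ n ih => rw [pow_succ, ih, pv_mul]; congr 1 <;> (push_cast; ring)

theorem serreCoeff_alt {i j : I} (h : i ≠ j) :
    ∑ k ∈ Finset.range (D.b i j + 1), D.serreCoeff i j k * twistScalar D j i ^ (D.b i j - k) = 0 := by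
  have h1 := qbinom_alt_sum (D.d_ne i) (D.b i j) (D.b_ne_zero h) (D.even_d_mul_b h)
  have h2 := congrArg (fun z => pv (D.b i j * (D.p j * D.p i)) (-(D.b i j * D.dot i j)) * z) h1
  simp only [mul_zero, Finset.mul_sum] at h2
  rw [← h2]
  refine Finset.sum_congr rfl fun k hk => ?_
  have hk' : k ≤ D.b i j := Nat.lt_succ_iff.mp (Finset.mem_range.mp hk)
  obtain ⟨c, hc⟩ := D.bar_consistent i
  have e : pv ((k.choose 2 : ℕ) * D.p i + k * D.p i * D.p j) 0 *
      twistScalar D j i ^ (D.b i j - k) =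
      pv (D.b i j * (D.p j * D.p i)) (-(D.b i j * D.dot i j)) *
      pv (D.d i * (k.choose 2 : ℕ)) (D.d i * k * (1 - D.b i j)) := by
    rw [twistScalar, pv_pow, pv_mul, pv_mul, D.dot_symm j i, D.dot_eq_d_mul_a]
    refine pv_congr ⟨-(c * (k.choose 2 : ℕ)), ?_⟩ ?_
    · rw [Nat.cast_sub hk']
      linear_combination -((k.choose 2 : ℕ) : ℤ) * hc
    · rw [Nat.cast_sub hk', D.cast_b h]
      ring
  rw [Datum.serreCoeff]
  linear_combination (-1) ^ k * qbinom (D.d i) (D.b i j) k * e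

theorem serreCoeff_step {i j : I} (h : i ≠ j) {k : ℕ} (hk : k < D.b i j) :
    D.serreCoeff i j (k + 1) * (twistScalar D i i ^ (D.b i j - (k + 1)) * twistScalar D i j *
        ∑ s ∈ Finset.range (k + 1), twistScalar D i i ^ s) +
      D.serreCoeff i j k * ∑ s ∈ Finset.range (D.b i j - k), twistScalar D i i ^ s = 0 := by
  obtain ⟨c, hc⟩ := D.bar_consistent i
  have hpp : D.p i * D.p i = D.p i := by rcases D.p_values i with h | h <;> rw [h] <;> rfl
  have hα : twistScalar D i i = pv (D.d i) (-(2 * D.d i)) := by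
    rw [twistScalar, hpp, D.dot_self]; exact pv_congr ⟨-c, by linear_combination -hc⟩ rfl
  have hne := D.d_ne i
  have hb := D.cast_b h
  have hdot := D.dot_eq_d_mul_a i j
  have hev := D.even_d_mul_b h
  set d := D.d i
  set n := D.b i j
  rw [hα]
  have g1 := geom_qd d (k + 1)
  have g2 := geom_qd d (n - k)
  set G1 := ∑ s ∈ Finset.range (k + 1), pv d (-(2 * d)) ^ s
  set G2 := ∑ s ∈ Finset.range (n - k), pv d (-(2 * d)) ^ s
  have q := qbinom_succ hne n k
  rw [pv_pow, twistScalar, pv_mul, Datum.serreCoeff, Datum.serreCoeff, choose_two_succ]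
  rw [Nat.cast_sub hk.le] at g2
  push_cast [Nat.cast_sub (show k + 1 ≤ n from hk)] at g1 g2 ⊢
  set C : ℤ := ((k.choose 2 : ℕ) : ℤ)
  have u : ∀ a b : ℤ, pv a b * pv (-a) (-b) = 1 := by
    intro a b; rw [pv_mul, ← pv_zero]; congr 1 <;> ring
  have g1' : G1 * qd d = pv d d * qd (d * (k + 1)) * pv (-(d * (k + 1))) (-(d * (k + 1))) := by
    linear_combination pv (-(d * (k + 1))) (-(d * (k + 1))) * g1
      - G1 * qd d * u (d * (k + 1)) (d * (k + 1))
  have g2' : G2 * qd d = pv d d * qd (d * (n - k)) * pv (-(d * (n - k))) (-(d * (n - k))) := by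
    linear_combination pv (-(d * (n - k))) (-(d * (n - k))) * g2
      - G2 * qd d * u (d * (n - k)) (d * (n - k))
  have key : pv ((C + k) * D.p i + (k + 1) * D.p i * D.p j) 0 *
      pv ((n - (k + 1)) * d + D.p i * D.p j) ((n - (k + 1)) * (-(2 * d)) + -D.dot i j) *
      pv (-(d * (k + 1))) (-(d * (k + 1))) =
      pv (C * D.p i + k * D.p i * D.p j) 0 * pv (-(d * (n - k))) (-(d * (n - k))) := by
    rw [pv_mul, pv_mul, pv_mul]
    obtain ⟨z, hz⟩ := hev
    refine pv_congr ⟨-(c * k) - d + D.p i * D.p j + (d * n - d * k) - d * k + d * k, ?_⟩ ?_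
    · linear_combination (-(k : ℤ)) * hc
    · rw [hdot]
      have : D.a i j = 1 - n := by linarith
      rw [this]; ring
  refine (isUnit_qd hne).mul_right_cancel ?_
  rw [zero_mul]
  set P1 := pv ((C + k) * D.p i + (k + 1) * D.p i * D.p j) 0
  set P2 := pv ((n - (k + 1)) * d + D.p i * D.p j) ((n - (k + 1)) * (-(2 * d)) + -D.dot i j)
  set P3 := pv (-(d * (k + 1))) (-(d * (k + 1)))
  set P4 := pv (C * D.p i + k * D.p i * D.p j) 0
  set P5 := pv (-(d * (n - k))) (-(d * (n - k)))
  rw [show (-1 : Qvpi) ^ (k + 1) = -(-1) ^ k by rw [pow_succ]; ring]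
  linear_combination (-(-1) ^ k * P1 * qbinom d n (k + 1) * P2) * g1'
    + ((-1) ^ k * P4 * qbinom d n k) * g2'
    - (-1) ^ k * pv d d * P1 * P2 * P3 * q
    - (-1) ^ k * pv d d * qbinom d n k * qd (d * (n - k)) * key

theorem serre_derivMatrix {A : Type*} [Ring A] [Algebra Qvpi A] (t : I → A) (m : I) {i j : I}
    (h : i ≠ j) (hs : D.serre i j (t i) (t j) = 0) :
    D.serre i j (derivMatrix D t m i) (derivMatrix D t m j) = 0 := by
  classical
  obtain ⟨e, he⟩ : ∃ e : Qvpi, e = if m = i then 1 else 0 := ⟨_, rfl⟩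
  obtain ⟨f, hf⟩ : ∃ f : Qvpi, f = if m = j then 1 else 0 := ⟨_, rfl⟩
  have hi : derivMatrix D t m i = !![twistScalar D m i • t i, algebraMap Qvpi A e; 0, t i] := by
    rw [derivMatrix, he]; split_ifs <;> simp
  have hj : derivMatrix D t m j = !![twistScalar D m j • t j, algebraMap Qvpi A f; 0, t j] := by
    rw [derivMatrix, hf]; split_ifs <;> simp
  rw [hi, hj, Datum.serre]
  simp only [mat_word]
  unfold Datum.serre at hs
  set α := twistScalar D m i
  set β := twistScalar D m j
  ext r c
  fin_cases r <;> fin_cases c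
  · simp only [Matrix.sum_apply, Matrix.smul_apply, Matrix.of_apply, Matrix.cons_val',
      Matrix.cons_val_zero, Fin.zero_eta, Matrix.zero_apply]
    rw [← smul_zero (α ^ D.b i j * β), ← hs, Finset.smul_sum]
    refine Finset.sum_congr rfl fun k hk => ?_
    rw [Nat.sub_add_cancel (Nat.lt_succ_iff.mp (Finset.mem_range.mp hk)), smul_comm]
  · simp only [Matrix.sum_apply, Matrix.smul_apply, Matrix.of_apply, Matrix.cons_val',
      Matrix.cons_val_zero, Fin.zero_eta, Fin.mk_one, Matrix.cons_val_one, Matrix.zero_apply,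
      smul_add, Finset.sum_add_distrib, smul_smul]
    have h3 : ∑ k ∈ Finset.range (D.b i j + 1),
        (D.serreCoeff i j k * (α ^ (D.b i j - k) * f)) • t i ^ (D.b i j - k + k) = 0 := by
      by_cases hm : m = j
      · subst hm
        have := serreCoeff_alt D h
        rw [← zero_smul Qvpi (t i ^ D.b i m), ← this, Finset.sum_smul]
        refine Finset.sum_congr rfl fun k hk => ?_
        rw [Nat.sub_add_cancel (Nat.lt_succ_iff.mp (Finset.mem_range.mp hk)), hf, if_pos rfl,
          mul_one]
      · rw [hf, if_neg hm]; simp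
    rw [h3, add_zero]
    by_cases hm : m = i
    · subst hm
      rw [Finset.sum_range_succ', Finset.sum_range_succ _ (D.b m j)]
      simp only [Finset.range_zero, Finset.sum_empty, mul_zero, zero_mul, zero_smul, add_zero,
        Nat.sub_self]
      rw [← Finset.sum_add_distrib]
      refine Finset.sum_eq_zero fun k hk => ?_
      have hk' := Finset.mem_range.mp hk
      rw [Nat.add_sub_cancel, Nat.sub_sub, ← add_smul, he, if_pos rfl, mul_one, mul_one]
      rw [serreCoeff_step D h hk', zero_smul]
    · rw [he, if_neg hm]; simp
  · simp [Matrix.sum_apply]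
  · simp only [Matrix.sum_apply, Matrix.smul_apply, Matrix.of_apply, Matrix.cons_val',
      Fin.mk_one, Matrix.cons_val_one, Matrix.zero_apply]
    exact hs

/-- The value at a noncommutative polynomial of the skew derivation determined by
`derivMatrix`. -/
def genDeriv {A : Type*} [Ring A] [Algebra Qvpi A] (t : I → A) (m : I) :
    FreeAlgebra Qvpi I →ₗ[Qvpi] A where
  toFun x := FreeAlgebra.lift Qvpi (derivMatrix D t m) x 0 1
  map_add' x y := by simp
  map_smul' c x := by simp

theorem lift_derivMatrix_snd {A : Type*} [Ring A] [Algebra Qvpi A] (t : I → A) (m : I)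
    (x : FreeAlgebra Qvpi I) : FreeAlgebra.lift Qvpi (derivMatrix D t m) x 1 0 = 0 ∧
      FreeAlgebra.lift Qvpi (derivMatrix D t m) x 1 1 = FreeAlgebra.lift Qvpi t x := by
  induction x using FreeAlgebra.induction with
  | grade0 r => simp [Matrix.algebraMap_matrix_apply]
  | grade1 i => simp [derivMatrix]
  | mul a b ha hb => simp [Matrix.mul_apply, Fin.sum_univ_two, ha, hb]
  | add a b ha hb => simp [ha, hb]

open Classical in
theorem genDeriv_ι_mul {A : Type*} [Ring A] [Algebra Qvpi A] (t : I → A) (m j : I)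
    (x : FreeAlgebra Qvpi I) : genDeriv D t m (FreeAlgebra.ι Qvpi j * x) =
      twistScalar D m j • (t j * genDeriv D t m x) +
        (if m = j then 1 else 0 : Qvpi) • FreeAlgebra.lift Qvpi t x := by
  change FreeAlgebra.lift Qvpi (derivMatrix D t m) (FreeAlgebra.ι Qvpi j * x) 0 1 = _
  rw [map_mul, Matrix.mul_apply, Fin.sum_univ_two, FreeAlgebra.lift_ι_apply,
    (lift_derivMatrix_snd D t m x).2]
  simp [derivMatrix, genDeriv]

theorem genDeriv_one {A : Type*} [Ring A] [Algebra Qvpi A] (t : I → A) (m : I) :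
    genDeriv D t m 1 = 0 := by
  change FreeAlgebra.lift Qvpi (derivMatrix D t m) 1 0 1 = _
  simp

theorem free_left_induction {P : FreeAlgebra Qvpi I → Prop} (one : P 1)
    (smul : ∀ (c : Qvpi) (x), P x → P (c • x)) (add : ∀ x y, P x → P y → P (x + y))
    (ι_mul : ∀ i x, P x → P (FreeAlgebra.ι Qvpi i * x)) (x : FreeAlgebra Qvpi I) : P x := by
  have key : ∀ a x, P x → P (a * x) := by
    intro a
    induction a using FreeAlgebra.induction with
    | grade0 r => intro x hx; rw [← Algebra.smul_def]; exact smul r x hx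
    | grade1 i => exact ι_mul i
    | mul a b ha hb => intro x hx; rw [mul_assoc]; exact ha _ (hb _ hx)
    | add a b ha hb => intro x hx; rw [add_mul]; exact add _ _ (ha _ hx) (hb _ hx)
  simpa using key x 1 one

namespace Half

/-- The matrix-valued homomorphism whose upper right entry is the skew derivation `_i r`. -/
def derivHom (m : I) : Half D →ₐ[Qvpi] Matrix (Fin 2) (Fin 2) (Half D) :=
  lift D (derivMatrix D (θ D) m) fun _ _ h => serre_derivMatrix D (θ D) m h (serre_θ D h)

/-- The skew derivation `_i r` of `𝐟`: it is `ℚ(v)^π`-linear, `_i r (θ_j) = δ_ij`, and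
`_i r (x y) = _i r (x) y + π ^ (p(x) p(i)) v ^ (- i · |x|) x _i r (y)` for homogeneous `x`. -/
def deriv (m : I) : Half D →ₗ[Qvpi] Half D where
  toFun x := derivHom D m x 0 1
  map_add' x y := by simp
  map_smul' c x := by simp

theorem deriv_mk (m : I) (x : FreeAlgebra Qvpi I) :
    deriv D m (mk D x) = genDeriv D (θ D) m x := by
  change lift D (derivMatrix D (θ D) m) _ (mk D x) 0 1 = _
  rw [lift_mk]; rfl

theorem freeLift_θ (x : FreeAlgebra Qvpi I) : FreeAlgebra.lift Qvpi (θ D) x = mk D x := by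
  have : FreeAlgebra.lift Qvpi (θ D) = mk D := by ext i; simp [θ]
  rw [this]

theorem mk_genDeriv (m : I) (x : FreeAlgebra Qvpi I) :
    mk D (genDeriv D (FreeAlgebra.ι Qvpi) m x) = deriv D m (mk D x) := by
  rw [deriv_mk]
  induction x using free_left_induction with
  | one => rw [genDeriv_one, genDeriv_one, map_zero]
  | smul c x h => rw [map_smul, map_smul, map_smul, h]
  | add x y hx hy => rw [map_add, map_add, map_add, hx, hy]
  | ι_mul j x h =>
    rw [genDeriv_ι_mul, genDeriv_ι_mul, map_add, map_smul, map_mul, map_smul, h, freeLift_θ]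
    have : FreeAlgebra.lift Qvpi (FreeAlgebra.ι Qvpi) x = x := by
      have : FreeAlgebra.lift Qvpi (FreeAlgebra.ι Qvpi (X := I)) = AlgHom.id _ _ := by ext; simp
      rw [this]; rfl
    rw [this]; rfl

open Classical in
theorem deriv_θ_mul (m j : I) (x : Half D) : deriv D m (θ D j * x) =
    twistScalar D m j • (θ D j * deriv D m x) + (if m = j then 1 else 0 : Qvpi) • x := by
  obtain ⟨x, rfl⟩ := mk_surjective D x
  rw [θ, ← map_mul, deriv_mk, genDeriv_ι_mul, deriv_mk, freeLift_θ]; rfl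

theorem deriv_one (m : I) : deriv D m 1 = 0 := by
  rw [← map_one (mk D), deriv_mk, genDeriv_one]

/-- The projection of `𝐟` to its component of degree zero, `θ_i ↦ 0`. -/
def counit : Half D →ₐ[Qvpi] Qvpi :=
  lift D (fun _ => 0) fun i j _ => D.serre_zero i j

theorem counit_θ_mul (i : I) (x : Half D) : counit D (θ D i * x) = 0 := by
  rw [map_mul, counit, lift_θ, zero_mul]

/-- The number `(θ_i, θ_i) = 1 / (1 - π_i v_i ^ 2)`. -/
def formScalar (i : I) : Qvpi := Ring.inverse (1 - pv (D.d i) (2 * D.d i))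

/-- Right multiplication by `θ_i` in the dual: `φ ↦ (θ_i, θ_i) φ ∘ _i r`. -/
def dualStep (i : I) : Module.End Qvpi (Half D →ₗ[Qvpi] Qvpi) where
  toFun φ := formScalar D i • φ.comp (deriv D i)
  map_add' φ ψ := by rw [LinearMap.add_comp, smul_add]
  map_smul' c φ := by rw [LinearMap.smul_comp, smul_comm, RingHom.id_apply]

/-- The form on the free algebra in the first variable. -/
def preForm : FreeAlgebra Qvpi I →ₗ[Qvpi] Half D →ₗ[Qvpi] Qvpi where
  toFun x := FreeAlgebra.lift Qvpi (dualStep D) x (counit D).toLinearMap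
  map_add' x y := by simp
  map_smul' c x := by simp

theorem preForm_one (y : Half D) : preForm D 1 y = counit D y := by
  change FreeAlgebra.lift Qvpi (dualStep D) 1 (counit D).toLinearMap y = _
  simp

theorem preForm_ι_mul (i : I) (x : FreeAlgebra Qvpi I) (y : Half D) :
    preForm D (FreeAlgebra.ι Qvpi i * x) y = formScalar D i * preForm D x (deriv D i y) := by
  change FreeAlgebra.lift Qvpi (dualStep D) (FreeAlgebra.ι Qvpi i * x) (counit D).toLinearMap y = _
  rw [map_mul, FreeAlgebra.lift_ι_apply]
  rfl

theorem twistScalar_symm (i j : I) : twistScalar D i j = twistScalar D j i := by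
  rw [twistScalar, twistScalar, mul_comm, D.dot_symm]

theorem preForm_θ_mul (i : I) (x : FreeAlgebra Qvpi I) : ∀ y : Half D,
    preForm D x (θ D i * y) =
      formScalar D i * preForm D (genDeriv D (FreeAlgebra.ι Qvpi) i x) y := by
  induction x using free_left_induction with
  | one =>
    intro y
    rw [preForm_one, counit_θ_mul, genDeriv_one, map_zero, LinearMap.zero_apply, mul_zero]
  | smul c x h =>
    intro y
    rw [map_smul, map_smul, map_smul, LinearMap.smul_apply, LinearMap.smul_apply, h, smul_eq_mul,
      smul_eq_mul]
    ring
  | add x y hx hy =>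
    intro z
    rw [map_add, map_add, map_add, LinearMap.add_apply, LinearMap.add_apply, hx, hy]
    ring
  | ι_mul j x h =>
    intro y
    have e : FreeAlgebra.lift Qvpi (FreeAlgebra.ι Qvpi) x = x := by
      have : FreeAlgebra.lift Qvpi (FreeAlgebra.ι Qvpi (X := I)) = AlgHom.id _ _ := by ext; simp
      rw [this]; rfl
    rw [preForm_ι_mul, deriv_θ_mul, genDeriv_ι_mul, e]
    simp only [map_add, map_smul, LinearMap.add_apply, LinearMap.smul_apply, smul_eq_mul,
      preForm_ι_mul, h]
    rw [twistScalar_symm D j i]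
    by_cases hij : i = j
    · subst hij; simp
    · rw [if_neg hij, if_neg (Ne.symm hij)]; ring

theorem preForm_symm (x y : FreeAlgebra Qvpi I) : preForm D x (mk D y) = preForm D y (mk D x) := by
  have h1 : ∀ x, preForm D x 1 = counit D (mk D x) := by
    intro x
    induction x using free_left_induction with
    | one => rw [preForm_one, map_one, map_one, map_one]
    | smul c x h => rw [map_smul, map_smul, map_smul, LinearMap.smul_apply, h]
    | add x y hx hy => rw [map_add, map_add, map_add, LinearMap.add_apply, hx, hy]
    | ι_mul j x h =>
      rw [preForm_ι_mul, deriv_one, map_zero, mul_zero, map_mul]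
      exact (counit_θ_mul D j _).symm
  induction y using free_left_induction generalizing x with
  | one => rw [map_one, h1, preForm_one]
  | smul c y h => rw [map_smul, map_smul, map_smul, LinearMap.smul_apply, h]
  | add y z hy hz => rw [map_add, map_add, map_add, LinearMap.add_apply, hy, hz]
  | ι_mul i y h =>
    rw [map_mul, preForm_ι_mul, ← mk_genDeriv, ← h]
    exact preForm_θ_mul D i x _

theorem preForm_congr {x x' : FreeAlgebra Qvpi I} (h : mk D x = mk D x') :
    preForm D x = preForm D x' := by
  ext y
  obtain ⟨y, rfl⟩ := mk_surjective D y
  rw [preForm_symm, h, preForm_symm]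

/-- The symmetric bilinear form `(·,·)` on `𝐟`.  It satisfies `(1, y) = counit y` and
`(θ_i x, y) = (θ_i, θ_i) (x, _i r (y))`. -/
def form : Half D →ₗ[Qvpi] Half D →ₗ[Qvpi] Qvpi where
  toFun x := preForm D (Function.surjInv (mk_surjective D) x)
  map_add' x y := by
    rw [← map_add]
    exact preForm_congr D (by simp [Function.surjInv_eq])
  map_smul' c x := by
    rw [RingHom.id_apply, ← map_smul]
    exact preForm_congr D (by simp [Function.surjInv_eq])

theorem form_mk (x : FreeAlgebra Qvpi I) (y : Half D) : form D (mk D x) y = preForm D x y := by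
  change preForm D _ y = _
  rw [preForm_congr D (Function.surjInv_eq (mk_surjective D) (mk D x))]

theorem form_one_left (y : Half D) : form D 1 y = counit D y := by
  rw [← map_one (mk D), form_mk, preForm_one]

theorem form_θ_mul (i : I) (x y : Half D) :
    form D (θ D i * x) y = formScalar D i * form D x (deriv D i y) := by
  obtain ⟨x, rfl⟩ := mk_surjective D x
  rw [θ, ← map_mul, form_mk, preForm_ι_mul, form_mk]

theorem form_symm (x y : Half D) : form D x y = form D y x := by
  obtain ⟨x, rfl⟩ := mk_surjective D x
  obtain ⟨y, rfl⟩ := mk_surjective D y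
  rw [form_mk, form_mk, preForm_symm]

end Half

/-- The algebra `A` with scalars acting through `σ`; a homomorphism of algebras into it is a
`σ`-semilinear ring homomorphism into `A`. -/
def Twist (_σ : Qvpi →+* Qvpi) (A : Type*) : Type _ := A

instance (σ : Qvpi →+* Qvpi) (A : Type*) [Ring A] : Ring (Twist σ A) := inferInstanceAs (Ring A)

instance (σ : Qvpi →+* Qvpi) (A : Type*) [Ring A] [Algebra Qvpi A] : Algebra Qvpi (Twist σ A) where
  smul c x := (σ c • (show A from x) : A)
  algebraMap := (algebraMap Qvpi A).comp σ
  commutes' c x := Algebra.commutes (A := A) (σ c) x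
  smul_def' c x := Algebra.smul_def (A := A) (σ c) x

theorem Twist.smul_def (σ : Qvpi →+* Qvpi) {A : Type*} [Ring A] [Algebra Qvpi A] (c : Qvpi)
    (x : Twist σ A) : c • x = (σ c • (show A from x) : A) := rfl

theorem Datum.serre_twist (σ : Qvpi →+* Qvpi) {A : Type*} [Ring A] [Algebra Qvpi A] {i j : I}
    (h : ∀ k, σ (D.serreCoeff i j k) = D.serreCoeff i j k) (x y : A) :
    D.serre i j (A := Twist σ A) x y = D.serre i j (A := A) x y := by
  unfold Datum.serre
  refine Finset.sum_congr rfl fun k _ => ?_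
  rw [Twist.smul_def, h]
  rfl

theorem barR_serreCoeff (i j : I) (k : ℕ) : barR (D.serreCoeff i j k) = D.serreCoeff i j k := by
  rw [Datum.serreCoeff, map_mul, map_mul, barR_qbinom (D.d_ne i), barR_pv]
  simp

theorem dagR_serreCoeff {i j : I} (h : i ≠ j) (k : ℕ) :
    dagR (D.serreCoeff i j k) = D.serreCoeff i j k := by
  rw [Datum.serreCoeff, map_mul, map_mul, dagR_qbinom (D.d_ne i) _ _ (D.even_d_mul_b h), dagR_pv]
  simp

/-- The bar involution of `𝐟` as a homomorphism of algebras into a twist. -/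
def Half.barHom : Half D →ₐ[Qvpi] Twist barR (Half D) :=
  Half.lift D (A := Twist barR (Half D)) (Half.θ D) (fun i j h => by
    rw [D.serre_twist barR (barR_serreCoeff D i j), Half.serre_θ D h]; rfl)

/-- The bar involution of `𝐟`, with `θ_i ↦ θ_i` and `v ↦ π v⁻¹`. -/
def Half.bar : Half D →+* Half D := (Half.barHom D).toRingHom

theorem Half.bar_θ (i : I) : Half.bar D (Half.θ D i) = Half.θ D i :=
  Half.lift_θ D (A := Twist barR (Half D)) _ _ i

theorem Half.bar_smul (c : Qvpi) (x : Half D) : Half.bar D (c • x) = barR c • Half.bar D x :=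
  map_smul (Half.barHom D) c x

/-- The symbols for the generators `E_i`, `F_i`, `K_μ`, `J_μ` of the quantum covering group. -/
inductive Gen (I Y : Type*)
  | E (i : I)
  | F (i : I)
  | K (μ : Y)
  | J (μ : Y)

/-- The relations of the quantum covering group, for given elements `e i`, `f i`, `k μ`, `j μ` of
an algebra. -/
structure IsRep {A : Type*} [Ring A] [Algebra Qvpi A] (e f : I → A) (k j : Y → A) : Prop where
  j_mul : ∀ μ ν, j μ * j ν = j (μ + ν)
  k_mul : ∀ μ ν, k μ * k ν = k (μ + ν)
  k_zero : k 0 = 1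
  j_zero : j 0 = 1
  j_sq : ∀ ν, j ν * j ν = 1
  j_k : ∀ μ ν, j μ * k ν = k ν * j μ
  j_e : ∀ μ i, j μ * e i = pv (D.pairing μ (D.rootX i)) 0 • (e i * j μ)
  j_f : ∀ μ i, j μ * f i = pv (-D.pairing μ (D.rootX i)) 0 • (f i * j μ)
  k_e : ∀ μ i, k μ * e i = pv 0 (D.pairing μ (D.rootX i)) • (e i * k μ)
  k_f : ∀ μ i, k μ * f i = pv 0 (-D.pairing μ (D.rootX i)) • (f i * k μ)
  comm_self : ∀ i, e i * f i - pv (D.p i * D.p i) 0 • (f i * e i) =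
    Ring.inverse (qd (D.d i)) •
      (j (D.d i • D.rootY i) * k (D.d i • D.rootY i) - k (-(D.d i • D.rootY i)))
  comm_ne : ∀ i i', i ≠ i' → e i * f i' - pv (D.p i * D.p i') 0 • (f i' * e i) = 0
  serre_e : ∀ i i', i ≠ i' → D.serre i i' (e i) (e i') = 0
  serre_f : ∀ i i', i ≠ i' → D.serre i i' (f i) (f i') = 0

/-- A generator in the free algebra. -/
abbrev gen (g : Gen I Y) : FreeAlgebra Qvpi (Gen I Y) := FreeAlgebra.ι Qvpi g

open Gen in
/-- The defining relations of the quantum covering group. -/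
inductive Rel : FreeAlgebra Qvpi (Gen I Y) → FreeAlgebra Qvpi (Gen I Y) → Prop
  | j_mul (μ ν) : Rel (gen (J μ) * gen (J ν)) (gen (J (μ + ν)))
  | k_mul (μ ν) : Rel (gen (K μ) * gen (K ν)) (gen (K (μ + ν)))
  | k_zero : Rel (gen (K 0)) 1
  | j_zero : Rel (gen (J 0)) 1
  | j_sq (ν) : Rel (gen (J ν) * gen (J ν)) 1
  | j_k (μ ν) : Rel (gen (J μ) * gen (K ν)) (gen (K ν) * gen (J μ))
  | j_e (μ i) : Rel (gen (J μ) * gen (E i))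
      (pv (D.pairing μ (D.rootX i)) 0 • (gen (E i) * gen (J μ)))
  | j_f (μ i) : Rel (gen (J μ) * gen (F i))
      (pv (-D.pairing μ (D.rootX i)) 0 • (gen (F i) * gen (J μ)))
  | k_e (μ i) : Rel (gen (K μ) * gen (E i))
      (pv 0 (D.pairing μ (D.rootX i)) • (gen (E i) * gen (K μ)))
  | k_f (μ i) : Rel (gen (K μ) * gen (F i))
      (pv 0 (-D.pairing μ (D.rootX i)) • (gen (F i) * gen (K μ)))
  | comm_self (i) : Rel
      (gen (E i) * gen (F i) - pv (D.p i * D.p i) 0 • (gen (F i) * gen (E i)))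
      (Ring.inverse (qd (D.d i)) • (gen (J (D.d i • D.rootY i)) * gen (K (D.d i • D.rootY i)) -
        gen (K (-(D.d i • D.rootY i)))))
  | comm_ne (i j) (h : i ≠ j) : Rel
      (gen (E i) * gen (F j) - pv (D.p i * D.p j) 0 • (gen (F j) * gen (E i))) 0
  | serre_e (i j) (h : i ≠ j) : Rel (D.serre i j (gen (E i)) (gen (E j))) 0
  | serre_f (i j) (h : i ≠ j) : Rel (D.serre i j (gen (F i)) (gen (F j))) 0

/-- The quantum covering group `𝐔`. -/
def QCG : Type _ := RingQuot (Rel D)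

instance : Ring (QCG D) := inferInstanceAs (Ring (RingQuot (Rel D)))
instance : Algebra Qvpi (QCG D) := inferInstanceAs (Algebra Qvpi (RingQuot (Rel D)))

namespace QCG

/-- The quotient map from the free algebra. -/
def mk : FreeAlgebra Qvpi (Gen I Y) →ₐ[Qvpi] QCG D := RingQuot.mkAlgHom Qvpi (Rel D)

theorem mk_surjective : Function.Surjective (mk D) := RingQuot.mkAlgHom_surjective _ _

theorem mk_rel {x y : FreeAlgebra Qvpi (Gen I Y)} (h : Rel D x y) : mk D x = mk D y :=
  RingQuot.mkAlgHom_rel Qvpi h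

/-- The generator `E_i`. -/
def E (i : I) : QCG D := mk D (gen (Gen.E i))
/-- The generator `F_i`. -/
def F (i : I) : QCG D := mk D (gen (Gen.F i))
/-- The generator `K_μ`. -/
def K (μ : Y) : QCG D := mk D (gen (Gen.K μ))
/-- The generator `J_μ`. -/
def J (μ : Y) : QCG D := mk D (gen (Gen.J μ))

theorem isRep : IsRep D (E D) (F D) (K D) (J D) where
  j_mul μ ν := by simpa [E, F, K, J] using mk_rel D (Rel.j_mul (D := D) μ ν)
  k_mul μ ν := by simpa [E, F, K, J] using mk_rel D (Rel.k_mul (D := D) μ ν)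
  k_zero := by simpa [E, F, K, J] using mk_rel D (Rel.k_zero (D := D))
  j_zero := by simpa [E, F, K, J] using mk_rel D (Rel.j_zero (D := D))
  j_sq ν := by simpa [E, F, K, J] using mk_rel D (Rel.j_sq (D := D) ν)
  j_k μ ν := by simpa [E, F, K, J] using mk_rel D (Rel.j_k (D := D) μ ν)
  j_e μ i := by simpa [E, F, K, J] using mk_rel D (Rel.j_e (D := D) μ i)
  j_f μ i := by simpa only [E, F, K, J, map_mul, map_smul] using mk_rel D (Rel.j_f (D := D) μ i)
  k_e μ i := by simpa [E, F, K, J] using mk_rel D (Rel.k_e (D := D) μ i)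
  k_f μ i := by simpa only [E, F, K, J, map_mul, map_smul] using mk_rel D (Rel.k_f (D := D) μ i)
  comm_self i := by
    simpa only [E, F, K, J, map_sub, map_mul, map_smul] using mk_rel D (Rel.comm_self (D := D) i)
  comm_ne i j h := by
    simpa only [E, F, K, J, map_sub, map_mul, map_smul, map_zero] using
      mk_rel D (Rel.comm_ne (D := D) i j h)
  serre_e i j h := by
    simpa only [E, D.map_serre, map_zero] using mk_rel D (Rel.serre_e (D := D) i j h)
  serre_f i j h := by
    simpa only [F, D.map_serre, map_zero] using mk_rel D (Rel.serre_f (D := D) i j h)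

/-- The images of the generators. -/
def genImage {A : Type*} (e f : I → A) (k j : Y → A) : Gen I Y → A
  | Gen.E i => e i
  | Gen.F i => f i
  | Gen.K μ => k μ
  | Gen.J μ => j μ

/-- The universal property of `𝐔`. -/
def lift {A : Type*} [Ring A] [Algebra Qvpi A] {e f : I → A} {k j : Y → A}
    (h : IsRep D e f k j) : QCG D →ₐ[Qvpi] A :=
  RingQuot.liftAlgHom Qvpi ⟨FreeAlgebra.lift Qvpi (genImage e f k j), by
    intro x y hxy
    cases hxy <;>
      simp only [map_mul, map_one, map_smul, map_sub, map_zero, D.map_serre,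
        FreeAlgebra.lift_ι_apply, genImage]
    · exact h.j_mul _ _
    · exact h.k_mul _ _
    · exact h.k_zero
    · exact h.j_zero
    · exact h.j_sq _
    · exact h.j_k _ _
    · exact h.j_e _ _
    · exact h.j_f _ _
    · exact h.k_e _ _
    · exact h.k_f _ _
    · exact h.comm_self _
    · exact h.comm_ne _ _ ‹_›
    · exact h.serre_e _ _ ‹_›
    · exact h.serre_f _ _ ‹_›⟩

section
variable {A : Type*} [Ring A] [Algebra Qvpi A] {e f : I → A} {k j : Y → A} (h : IsRep D e f k j)

theorem lift_mk (x : FreeAlgebra Qvpi (Gen I Y)) :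
    lift D h (mk D x) = FreeAlgebra.lift Qvpi (genImage e f k j) x :=
  RingQuot.liftAlgHom_mkAlgHom_apply _ _ _ _

theorem lift_E (i : I) : lift D h (E D i) = e i := by
  rw [E, lift_mk, FreeAlgebra.lift_ι_apply]; rfl
theorem lift_F (i : I) : lift D h (F D i) = f i := by
  rw [F, lift_mk, FreeAlgebra.lift_ι_apply]; rfl
theorem lift_K (μ : Y) : lift D h (K D μ) = k μ := by
  rw [K, lift_mk, FreeAlgebra.lift_ι_apply]; rfl
theorem lift_J (μ : Y) : lift D h (J D μ) = j μ := by
  rw [J, lift_mk, FreeAlgebra.lift_ι_apply]; rfl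

end

/-- Induction on the generators of `𝐔`. -/
theorem induction {P : QCG D → Prop} (scalar : ∀ c : Qvpi, P (algebraMap Qvpi _ c))
    (hE : ∀ i, P (E D i)) (hF : ∀ i, P (F D i)) (hK : ∀ μ, P (K D μ)) (hJ : ∀ μ, P (J D μ))
    (mul : ∀ x y, P x → P y → P (x * y)) (add : ∀ x y, P x → P y → P (x + y)) (x : QCG D) :
    P x := by
  obtain ⟨x, rfl⟩ := mk_surjective D x
  induction x using FreeAlgebra.induction with
  | grade0 r => rw [AlgHom.commutes]; exact scalar r
  | grade1 g => rcases g with i | i | μ | μ; exacts [hE i, hF i, hK μ, hJ μ]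
  | mul a b ha hb => rw [map_mul]; exact mul _ _ ha hb
  | add a b ha hb => rw [map_add]; exact add _ _ ha hb

/-- `J̃_i = J_{d_i i}`. -/
def Jt (i : I) : QCG D := J D (D.d i • D.rootY i)
/-- `K̃_i = K_{d_i i}`. -/
def Kt (i : I) : QCG D := K D (D.d i • D.rootY i)
/-- `K̃_{-i} = K_{- d_i i}`, the inverse of `K̃_i`. -/
def Ktinv (i : I) : QCG D := K D (-(D.d i • D.rootY i))
/-- `π_i J̃_i`. -/
def piJt (i : I) : QCG D := pv (D.d i) 0 • Jt D i

theorem J_mul (μ ν : Y) : J D μ * J D ν = J D (μ + ν) := (isRep D).j_mul μ ν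
theorem K_mul (μ ν : Y) : K D μ * K D ν = K D (μ + ν) := (isRep D).k_mul μ ν
theorem J_sq (μ : Y) : J D μ * J D μ = 1 := (isRep D).j_sq μ
theorem J_neg (μ : Y) : J D (-μ) = J D μ := by
  have h1 : J D (-μ) * J D μ = 1 := by rw [J_mul, neg_add_cancel]; exact (isRep D).j_zero
  calc J D (-μ) = J D (-μ) * (J D μ * J D μ) := by rw [J_sq, mul_one]
    _ = J D μ := by rw [← mul_assoc, h1, one_mul]
theorem J_comm_K (μ ν : Y) : J D μ * K D ν = K D ν * J D μ := (isRep D).j_k μ ν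
theorem J_comm_J (μ ν : Y) : J D μ * J D ν = J D ν * J D μ := by rw [J_mul, J_mul, add_comm]
theorem K_comm_K (μ ν : Y) : K D μ * K D ν = K D ν * K D μ := by rw [K_mul, K_mul, add_comm]

theorem pv_even {a : ℤ} (h : Even a) : pv a 0 = 1 := by
  rw [← pv_zero]; exact pv_congr (by simpa using h) rfl

theorem pairing_tilde (i j : I) : D.pairing (D.d i • D.rootY i) (D.rootX j) = D.dot i j := by
  rw [map_zsmul, LinearMap.smul_apply, D.pairing_root, D.dot_eq_d_mul_a, smul_eq_mul]

theorem Jt_comm_E (i j : I) : Jt D i * E D j = E D j * Jt D i := by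
  rw [Jt, (isRep D).j_e, pairing_tilde, pv_even (D.even_dot i j), one_smul]
theorem Jt_comm_F (i j : I) : Jt D i * F D j = F D j * Jt D i := by
  rw [Jt, (isRep D).j_f, pairing_tilde, pv_even (D.even_dot i j).neg, one_smul]

theorem piJt_comm (i : I) (x : QCG D) : piJt D i * x = x * piJt D i := by
  rw [piJt, smul_mul_assoc, mul_smul_comm]
  congr 1
  induction x using induction with
  | scalar c => exact (Algebra.commutes c _).symm
  | hE j => exact Jt_comm_E D i j
  | hF j => exact Jt_comm_F D i j
  | hK μ => exact J_comm_K D _ μ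
  | hJ μ => exact J_comm_J D _ μ
  | mul x y hx hy => rw [← mul_assoc, hx, mul_assoc, hy, mul_assoc]
  | add x y hx hy => rw [mul_add, add_mul, hx, hy]

theorem piJt_sq (i : I) : piJt D i * piJt D i = 1 := by
  rw [piJt, smul_mul_smul_comm, pv_mul, add_zero, pv_even ⟨_, rfl⟩, one_smul, Jt, J_sq]

theorem pv_p (i : I) : pv (D.p i * D.p i) 0 = pv (D.d i) 0 := by
  have hpp : D.p i * D.p i = D.p i := by rcases D.p_values i with h | h <;> rw [h] <;> rfl
  obtain ⟨c, hc⟩ := D.bar_consistent i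
  rw [hpp]; exact pv_congr ⟨-c, by linear_combination -hc⟩ rfl

end QCG

theorem Datum.qcomm_pow {A : Type*} [Ring A] [Algebra Qvpi A] {x k : A} {α : Qvpi}
    (h : x * k = α • (k * x)) (n : ℕ) : x ^ n * k = α ^ n • (k * x ^ n) := by
  induction n with
  | zero => simp
  | succ n ih =>
    rw [pow_succ, mul_assoc, h, mul_smul_comm, ← mul_assoc, ih, smul_mul_assoc, smul_smul,
      mul_assoc, pow_succ, mul_comm]

theorem Datum.qcomm_pow' {A : Type*} [Ring A] [Algebra Qvpi A] {x k : A} {α : Qvpi}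
    (h : x * k = α • (k * x)) (n : ℕ) : x * k ^ n = α ^ n • (k ^ n * x) := by
  induction n with
  | zero => simp
  | succ n ih =>
    rw [pow_succ, ← mul_assoc, ih, smul_mul_assoc, mul_assoc, h, mul_smul_comm, smul_smul,
      ← mul_assoc, pow_succ]

theorem Datum.qcomm_mul_pow {A : Type*} [Ring A] [Algebra Qvpi A] {x k : A} {α : Qvpi}
    (h : x * k = α • (k * x)) (n : ℕ) : (k * x) ^ n = α ^ (n.choose 2) • (k ^ n * x ^ n) := by
  induction n with
  | zero => simp
  | succ n ih =>
    have : (n + 1).choose 2 = n.choose 2 + n := by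
      rw [Nat.choose_succ_succ' n 1, Nat.choose_one_right, add_comm]
    rw [pow_succ, ih, smul_mul_assoc, mul_assoc, ← mul_assoc (x ^ n), qcomm_pow h, smul_mul_assoc,
      mul_smul_comm, smul_smul, this, pow_add α]
    congr 1
    rw [pow_succ, pow_succ]
    simp only [mul_assoc]

theorem Datum.serre_qcomm {A : Type*} [Ring A] [Algebra Qvpi A] (i j : I) {x y k l : A}
    {α β : Qvpi} (h1 : x * k = α • (k * x)) (h2 : x * l = β • (l * x))
    (h3 : y * k = β • (k * y)) (hs : D.serre i j x y = 0) (hkl : k * l = l * k) :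
    D.serre i j (k * x) (l * y) = 0 := by
  have key : ∀ m n : ℕ, (k * x) ^ m * (l * y) * (k * x) ^ n =
      (α ^ ((m + n).choose 2) * β ^ (m + n)) • (k ^ (m + n) * l * (x ^ m * y * x ^ n)) := by
    intro m n
    have hc : (m + n).choose 2 = m.choose 2 + n.choose 2 + m * n := by
      induction n with
      | zero => simp
      | succ n ih =>
        rw [← add_assoc, Nat.choose_succ_succ' (m + n) 1, Nat.choose_one_right, ih,
          Nat.choose_succ_succ' n 1, Nat.choose_one_right]
        ring
    have hxk : x ^ m * k ^ n = (α ^ (m * n)) • (k ^ n * x ^ m) := by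
      rw [pow_mul]; exact qcomm_pow' (qcomm_pow h1 m) n
    have hkl' : l * k ^ n = k ^ n * l := by
      have : Commute k l := hkl
      exact (this.pow_left n).symm.eq
    calc (k * x) ^ m * (l * y) * (k * x) ^ n
        = (α ^ m.choose 2 * α ^ n.choose 2) • (k ^ m * ((x ^ m * l) * ((y * k ^ n) * x ^ n))) := by
          rw [qcomm_mul_pow h1, qcomm_mul_pow h1, smul_mul_assoc, smul_mul_smul_comm]
          simp only [mul_assoc]
      _ = (α ^ m.choose 2 * α ^ n.choose 2 * β ^ m * β ^ n) •
            (k ^ m * (l * ((x ^ m * k ^ n) * (y * x ^ n)))) := by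
          rw [qcomm_pow h2, qcomm_pow' h3]
          simp only [smul_mul_assoc, mul_smul_comm, smul_smul, mul_assoc]
          congr 1
          ring
      _ = (α ^ m.choose 2 * α ^ n.choose 2 * β ^ m * β ^ n * α ^ (m * n)) •
            (k ^ m * ((l * k ^ n) * (x ^ m * (y * x ^ n)))) := by
          rw [hxk]
          simp only [smul_mul_assoc, mul_smul_comm, smul_smul, mul_assoc]
      _ = _ := by
          rw [hkl', hc]
          simp only [mul_assoc, pow_add]
          congr 1
          ring
  unfold Datum.serre at hs ⊢
  have : ∀ c ∈ Finset.range (D.b i j + 1),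
      D.serreCoeff i j c • ((k * x) ^ (D.b i j - c) * (l * y) * (k * x) ^ c) =
      (α ^ ((D.b i j).choose 2) * β ^ (D.b i j)) • (k ^ (D.b i j) * l *
        (D.serreCoeff i j c • (x ^ (D.b i j - c) * y * x ^ c))) := by
    intro c hc
    rw [key, Nat.sub_add_cancel (Nat.lt_succ_iff.mp (Finset.mem_range.mp hc)), smul_comm,
      mul_smul_comm]
  rw [Finset.sum_congr rfl this, ← Finset.smul_sum, ← Finset.mul_sum, hs, mul_zero, smul_zero]

theorem Datum.serre_op {A : Type*} [Ring A] [Algebra Qvpi A] {i j : I} (h : i ≠ j) {x y : A}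
    (hs : D.serre i j x y = 0) : D.serre i j (MulOpposite.op x) (MulOpposite.op y) = 0 := by
  set n := D.b i j with hn
  have key : ∀ k ≤ n, D.serreCoeff i j (n - k) =
      ((-1) ^ n * pv ((n.choose 2 : ℕ) * D.p i + n * D.p i * D.p j) 0) * D.serreCoeff i j k := by
    intro k hk
    rw [Datum.serreCoeff, Datum.serreCoeff, ← hn, qbinom_symm (D.d_ne i) hk]
    have e1 : (-1 : Qvpi) ^ (n - k) = (-1) ^ n * (-1) ^ k := by
      obtain ⟨m, hm⟩ : ∃ m, n = k + m := Nat.exists_eq_add_of_le hk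
      rw [hm, Nat.add_sub_cancel_left, pow_add]
      have : ((-1 : Qvpi) ^ k) * (-1) ^ k = 1 := by rw [← mul_pow]; simp
      linear_combination -(-1) ^ m * this
    have hc : ((n.choose 2 : ℕ) : ℤ) = ((n - k).choose 2 : ℕ) + (k.choose 2 : ℕ) + (n - k) * k := by
      obtain ⟨m, hm⟩ : ∃ m, n = k + m := Nat.exists_eq_add_of_le hk
      rw [hm, Nat.add_sub_cancel_left]
      have : ∀ m : ℕ, (((k + m).choose 2 : ℕ) : ℤ) = (m.choose 2 : ℕ) + (k.choose 2 : ℕ) + m * k := by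
        intro m
        induction m with
        | zero => simp
        | succ m ih => rw [← add_assoc, choose_two_succ, ih, choose_two_succ]; push_cast; ring
      rw [this]; push_cast; ring
    have e2 : pv (((n - k).choose 2 : ℕ) * D.p i + (n - k : ℕ) * D.p i * D.p j) 0 =
        pv ((n.choose 2 : ℕ) * D.p i + n * D.p i * D.p j) 0 *
        pv ((k.choose 2 : ℕ) * D.p i + k * D.p i * D.p j) 0 := by
      rw [pv_mul, add_zero]
      refine pv_congr ?_ rfl
      rw [hc, Nat.cast_sub hk]
      have hev : Even (D.p i * (((n : ℤ) - k) * k)) := by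
        rcases D.p_values i with hp | hp
        · rw [hp, zero_mul]; exact Even.zero
        · have h1 := D.anisotropic i j hp
          have h2 := D.cast_b h
          rw [← hn] at h2
          have h3 : Odd (n : ℤ) := by
            rw [h2]; exact odd_one.sub_even h1
          rw [hp, one_mul]
          rcases Int.even_or_odd (k : ℤ) with hk | hk
          · exact hk.mul_left _
          · exact (h3.sub_odd hk).mul_right _
      obtain ⟨z, hz⟩ := hev
      exact ⟨-z - ((k.choose 2 : ℕ) : ℤ) * D.p i - k * D.p i * D.p j, by linear_combination -hz⟩
    rw [e1, e2]; ring
  have hs' := congrArg MulOpposite.op hs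
  unfold Datum.serre at hs' ⊢
  rw [← hn] at hs' ⊢
  rw [MulOpposite.op_zero, Finset.op_sum] at hs'
  rw [← Finset.sum_range_reflect]
  rw [← smul_zero ((-1) ^ n * pv ((n.choose 2 : ℕ) * D.p i + n * D.p i * D.p j) 0), ← hs',
    Finset.smul_sum]
  refine Finset.sum_congr rfl fun k hk => ?_
  have hk' : k ≤ n := Nat.lt_succ_iff.mp (Finset.mem_range.mp hk)
  rw [Nat.add_sub_cancel, key k hk', Nat.sub_sub_self hk', mul_smul]
  simp [mul_assoc]

namespace QCG

theorem E_mul_K (μ : Y) (i : I) :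
    E D i * K D μ = pv 0 (-D.pairing μ (D.rootX i)) • (K D μ * E D i) := by
  rw [(isRep D).k_e, smul_smul, pv_mul]; simp [pv_zero]

theorem F_mul_K (μ : Y) (i : I) :
    F D i * K D μ = pv 0 (D.pairing μ (D.rootX i)) • (K D μ * F D i) := by
  rw [(isRep D).k_f, smul_smul, pv_mul]; simp [pv_zero]

theorem comm_self (i : I) : E D i * F D i - pv (D.d i) 0 • (F D i * E D i) =
    Ring.inverse (qd (D.d i)) • (Jt D i * Kt D i - Ktinv D i) := by
  rw [← pv_p]; exact (isRep D).comm_self i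

theorem comm_ne {i j : I} (h : i ≠ j) :
    E D i * F D j - pv (D.p i * D.p j) 0 • (F D j * E D i) = 0 := (isRep D).comm_ne i j h

theorem Jt_sq (i : I) : Jt D i * Jt D i = 1 := J_sq D _

theorem piJt_mul_Jt (i : I) (x : QCG D) : piJt D i * (Jt D i * x) = pv (D.d i) 0 • x := by
  rw [piJt, smul_mul_assoc, ← mul_assoc, Jt_sq, one_mul]

theorem pv_mul_self (a : ℤ) : pv a 0 * pv a 0 = 1 := by
  rw [pv_mul, add_zero]; exact pv_even ⟨_, rfl⟩

theorem serre_piJt_E {i j : I} (h : i ≠ j) :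
    D.serre i j (piJt D i * E D i) (piJt D j * E D j) = 0 :=
  Datum.serre_qcomm D i j (α := 1) (β := 1) (by rw [one_smul, piJt_comm])
    (by rw [one_smul, piJt_comm]) (by rw [one_smul, piJt_comm]) ((isRep D).serre_e i j h)
    (piJt_comm D i _)

theorem serre_piJt_F {i j : I} (h : i ≠ j) :
    D.serre i j (piJt D i * F D i) (piJt D j * F D j) = 0 :=
  Datum.serre_qcomm D i j (α := 1) (β := 1) (by rw [one_smul, piJt_comm])
    (by rw [one_smul, piJt_comm]) (by rw [one_smul, piJt_comm]) ((isRep D).serre_f i j h)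
    (piJt_comm D i _)

theorem omega_isRep : IsRep D (F D) (fun i => piJt D i * E D i) (fun μ => K D (-μ)) (J D) where
  j_mul := (isRep D).j_mul
  k_mul μ ν := by rw [K_mul, neg_add]
  k_zero := by rw [neg_zero]; exact (isRep D).k_zero
  j_zero := (isRep D).j_zero
  j_sq := (isRep D).j_sq
  j_k μ ν := J_comm_K D _ _
  j_e μ i := by
    rw [(isRep D).j_f]; congr 1; exact pv_congr ⟨-D.pairing μ (D.rootX i), by ring⟩ rfl
  j_f μ i := by
    rw [← mul_assoc, ← piJt_comm, mul_assoc, (isRep D).j_e, mul_smul_comm, mul_assoc]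
    congr 1; exact pv_congr ⟨D.pairing μ (D.rootX i), by ring⟩ rfl
  k_e μ i := by rw [(isRep D).k_f]; simp
  k_f μ i := by
    rw [← mul_assoc, ← piJt_comm, mul_assoc, (isRep D).k_e, mul_smul_comm, mul_assoc]; simp
  comm_self i := by
    rw [pv_p, ← mul_assoc, ← piJt_comm, mul_assoc, mul_assoc, ← mul_smul_comm, ← mul_sub]
    have h := comm_self D i
    have h2 : F D i * E D i - pv (D.d i) 0 • (E D i * F D i) =
        -(pv (D.d i) 0 • (E D i * F D i - pv (D.d i) 0 • (F D i * E D i))) := by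
      rw [smul_sub, smul_smul, pv_mul_self, one_smul]; abel
    rw [h2, h, smul_comm, ← smul_neg, mul_smul_comm, ← smul_neg, mul_smul_comm, mul_neg, mul_sub,
      piJt_mul_Jt, neg_neg]
    congr 1
    rw [smul_neg, smul_sub, smul_smul, pv_mul_self, one_smul, piJt, smul_mul_assoc, smul_smul,
      pv_mul_self, one_smul, neg_sub]
    rfl
  comm_ne i j h := by
    rw [← mul_assoc, ← piJt_comm, mul_assoc, mul_assoc, ← mul_smul_comm, ← mul_sub]
    have h2 : F D i * E D j - pv (D.p i * D.p j) 0 • (E D j * F D i) =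
        -(pv (D.p i * D.p j) 0 • (E D j * F D i - pv (D.p j * D.p i) 0 • (F D i * E D j))) := by
      rw [mul_comm (D.p j), smul_sub, smul_smul, pv_mul_self, one_smul]; abel
    rw [h2, comm_ne D h.symm]; simp
  serre_e := (isRep D).serre_f
  serre_f _ _ h := serre_piJt_E D h

/-- The automorphism `ω` of `𝐔`, as an endomorphism: `E_i ↦ F_i`, `F_i ↦ π_i J̃_i E_i`,
`K_ν ↦ K_{-ν}`, `J_ν ↦ J_ν`. -/
def omegaHom : QCG D →ₐ[Qvpi] QCG D := lift D (omega_isRep D)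

theorem omegaInv_isRep : IsRep D (fun i => piJt D i * F D i) (E D) (fun μ => K D (-μ)) (J D) where
  j_mul := (isRep D).j_mul
  k_mul μ ν := by rw [K_mul, neg_add]
  k_zero := by rw [neg_zero]; exact (isRep D).k_zero
  j_zero := (isRep D).j_zero
  j_sq := (isRep D).j_sq
  j_k μ ν := J_comm_K D _ _
  j_e μ i := by
    rw [← mul_assoc, ← piJt_comm, mul_assoc, (isRep D).j_f, mul_smul_comm, mul_assoc]
    congr 1; exact pv_congr ⟨-D.pairing μ (D.rootX i), by ring⟩ rfl
  j_f μ i := by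
    rw [(isRep D).j_e]; congr 1; exact pv_congr ⟨D.pairing μ (D.rootX i), by ring⟩ rfl
  k_e μ i := by
    rw [← mul_assoc, ← piJt_comm, mul_assoc, (isRep D).k_f, mul_smul_comm, mul_assoc]; simp
  k_f μ i := by rw [(isRep D).k_e]; simp
  comm_self i := by
    rw [pv_p, ← mul_assoc (E D i), ← piJt_comm, mul_assoc, mul_assoc, ← mul_smul_comm, ← mul_sub]
    have h := comm_self D i
    have h2 : F D i * E D i - pv (D.d i) 0 • (E D i * F D i) =
        -(pv (D.d i) 0 • (E D i * F D i - pv (D.d i) 0 • (F D i * E D i))) := by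
      rw [smul_sub, smul_smul, pv_mul_self, one_smul]; abel
    rw [h2, h, smul_comm, ← smul_neg, mul_smul_comm, ← smul_neg, mul_smul_comm, mul_neg, mul_sub,
      piJt_mul_Jt, neg_neg]
    congr 1
    rw [smul_neg, smul_sub, smul_smul, pv_mul_self, one_smul, piJt, smul_mul_assoc, smul_smul,
      pv_mul_self, one_smul, neg_sub]
    rfl
  comm_ne i j h := by
    rw [← mul_assoc (E D j), ← piJt_comm, mul_assoc, mul_assoc, ← mul_smul_comm, ← mul_sub]
    have h2 : F D i * E D j - pv (D.p i * D.p j) 0 • (E D j * F D i) =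
        -(pv (D.p i * D.p j) 0 • (E D j * F D i - pv (D.p j * D.p i) 0 • (F D i * E D j))) := by
      rw [mul_comm (D.p j), smul_sub, smul_smul, pv_mul_self, one_smul]; abel
    rw [h2, comm_ne D h.symm]; simp
  serre_e _ _ h := serre_piJt_F D h
  serre_f := (isRep D).serre_e

/-- The inverse of `ω`: `E_i ↦ π_i J̃_i F_i`, `F_i ↦ E_i`, `K_ν ↦ K_{-ν}`, `J_ν ↦ J_ν`. -/
def omegaInvHom : QCG D →ₐ[Qvpi] QCG D := lift D (omegaInv_isRep D)

theorem hom_ext {A : Type*} [Ring A] [Algebra Qvpi A] {φ ψ : QCG D →ₐ[Qvpi] A}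
    (hE : ∀ i, φ (E D i) = ψ (E D i)) (hF : ∀ i, φ (F D i) = ψ (F D i))
    (hK : ∀ μ, φ (K D μ) = ψ (K D μ)) (hJ : ∀ μ, φ (J D μ) = ψ (J D μ)) : φ = ψ := by
  ext x
  induction x using induction with
  | scalar c => rw [AlgHom.commutes, AlgHom.commutes]
  | hE i => exact hE i
  | hF i => exact hF i
  | hK μ => exact hK μ
  | hJ μ => exact hJ μ
  | mul x y hx hy => rw [map_mul, map_mul, hx, hy]
  | add x y hx hy => rw [map_add, map_add, hx, hy]

theorem map_piJt {A : Type*} [Ring A] [Algebra Qvpi A] (φ : QCG D →ₐ[Qvpi] A) (i : I) :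
    φ (piJt D i) = pv (D.d i) 0 • φ (J D (D.d i • D.rootY i)) := by
  rw [piJt, map_smul, Jt]

theorem omega_omegaInv : (omegaHom D).comp (omegaInvHom D) = AlgHom.id _ _ := by
  apply hom_ext <;> intro i <;>
    simp only [AlgHom.comp_apply, AlgHom.id_apply, omegaHom, omegaInvHom, lift_E, lift_F, lift_K,
      lift_J, map_mul, map_piJt, neg_neg]
  rw [← Jt, ← piJt, ← mul_assoc, piJt_sq, one_mul]

theorem omegaInv_omega : (omegaInvHom D).comp (omegaHom D) = AlgHom.id _ _ := by
  apply hom_ext <;> intro i <;>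
    simp only [AlgHom.comp_apply, AlgHom.id_apply, omegaHom, omegaInvHom, lift_E, lift_F, lift_K,
      lift_J, map_mul, map_piJt, neg_neg]
  rw [← Jt, ← piJt, ← mul_assoc, piJt_sq, one_mul]

/-- The automorphism `ω` of `𝐔`: `E_i ↦ F_i`, `F_i ↦ π_i J̃_i E_i`, `K_ν ↦ K_{-ν}`,
`J_ν ↦ J_ν`. -/
def omega : QCG D ≃ₐ[Qvpi] QCG D :=
  AlgEquiv.ofAlgHom (omegaHom D) (omegaInvHom D) (omega_omegaInv D) (omegaInv_omega D)

open MulOpposite in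
theorem rho_isRep : IsRep D (fun i => op (piJt D i * E D i)) (fun i => op (F D i))
    (fun μ => op (K D (-μ))) (fun μ => op (J D μ)) where
  j_mul μ ν := by rw [← op_mul, J_mul, add_comm]
  k_mul μ ν := by rw [← op_mul, K_mul, neg_add, add_comm]
  k_zero := by rw [neg_zero, (isRep D).k_zero, op_one]
  j_zero := by rw [(isRep D).j_zero, op_one]
  j_sq ν := by rw [← op_mul, J_sq, op_one]
  j_k μ ν := by rw [← op_mul, ← op_mul, J_comm_K]
  j_e μ i := by
    rw [← op_mul, ← op_mul, ← op_smul, ← mul_assoc, ← piJt_comm, mul_assoc (piJt D i) (J D μ),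
      (isRep D).j_e, mul_smul_comm, smul_smul, pv_mul_self, one_smul, mul_assoc]
  j_f μ i := by
    rw [← op_mul, ← op_mul, ← op_smul, (isRep D).j_f, smul_smul, pv_mul_self, one_smul]
  k_e μ i := by
    rw [← op_mul, ← op_mul, ← op_smul, mul_assoc, E_mul_K, ← mul_assoc (K D (-μ)), ← piJt_comm]
    simp [mul_assoc]
  k_f μ i := by
    rw [← op_mul, ← op_mul, ← op_smul, F_mul_K]; simp
  comm_self i := by
    simp only [← op_mul, ← op_smul, ← op_sub]
    rw [pv_p, ← mul_assoc, ← piJt_comm, mul_assoc, mul_assoc, ← mul_smul_comm, ← mul_sub]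
    have h := comm_self D i
    have h2 : F D i * E D i - pv (D.d i) 0 • (E D i * F D i) =
        -(pv (D.d i) 0 • (E D i * F D i - pv (D.d i) 0 • (F D i * E D i))) := by
      rw [smul_sub, smul_smul, pv_mul_self, one_smul]; abel
    rw [h2, h, smul_comm, ← smul_neg, mul_smul_comm, ← smul_neg, mul_smul_comm, mul_neg, mul_sub,
      piJt_mul_Jt, neg_neg, ← J_comm_K]
    congr 2
    rw [smul_neg, smul_sub, smul_smul, pv_mul_self, one_smul, piJt, smul_mul_assoc, smul_smul,
      pv_mul_self, one_smul, neg_sub]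
    rfl
  comm_ne i j h := by
    simp only [← op_mul, ← op_smul, ← op_sub]
    rw [← mul_assoc, ← piJt_comm, mul_assoc, mul_assoc, ← mul_smul_comm, ← mul_sub]
    have h2 : F D j * E D i - pv (D.p i * D.p j) 0 • (E D i * F D j) =
        -(pv (D.p i * D.p j) 0 • (E D i * F D j - pv (D.p i * D.p j) 0 • (F D j * E D i))) := by
      rw [smul_sub, smul_smul, pv_mul_self, one_smul]; abel
    rw [h2, comm_ne D h]; simp
  serre_e _ _ h := Datum.serre_op D h (serre_piJt_E D h)
  serre_f _ _ h := Datum.serre_op D h ((isRep D).serre_f _ _ h)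

/-- The anti-automorphism `ρ` of `𝐔`, as a homomorphism to the opposite algebra:
`E_i ↦ π_i J̃_i E_i`, `F_i ↦ F_i`, `K_ν ↦ K_{-ν}`, `J_ν ↦ J_ν`. -/
def rho : QCG D →ₐ[Qvpi] (QCG D)ᵐᵒᵖ := lift D (rho_isRep D)

theorem q_mul_mul {A : Type*} [Ring A] [Algebra Qvpi A] {x y k l : A} {α : Qvpi}
    (h : x * l = α • (l * x)) : (k * x) * (l * y) = α • (k * l * (x * y)) := by
  rw [mul_assoc, ← mul_assoc x, h, smul_mul_assoc, mul_smul_comm]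
  simp only [mul_assoc]

/-- Conditions under which `E_i ↦ κ_i F_i`, `F_i ↦ κ'_i E_i` defines an anti-automorphism
of `𝐔` fixing `K_ν` and `J_ν`. -/
structure TauData (ε : ℤ) (κ κ' : I → QCG D) : Prop where
  hK : ∀ i μ, κ i * K D μ = K D μ * κ i
  hJ : ∀ i μ, κ i * J D μ = J D μ * κ i
  hK' : ∀ i μ, κ' i * K D μ = K D μ * κ' i
  hJ' : ∀ i μ, κ' i * J D μ = J D μ * κ' i
  hκ : ∀ i j, κ i * κ j = κ j * κ i
  hκ' : ∀ i j, κ' i * κ' j = κ' j * κ' i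
  hκκ : ∀ i j, κ i * κ' j = κ' j * κ i
  hone : ∀ i, κ i * κ' i = pv 0 (2 * ε * D.d i) • 1
  hF : ∀ i j, F D i * κ j = pv 0 (ε * D.dot i j) • (κ j * F D i)
  hE : ∀ i j, E D i * κ j = pv 0 (-(ε * D.dot i j)) • (κ j * E D i)
  hF' : ∀ i j, F D i * κ' j = pv 0 (-(ε * D.dot i j)) • (κ' j * F D i)
  hE' : ∀ i j, E D i * κ' j = pv 0 (ε * D.dot i j) • (κ' j * E D i)

theorem TauData.mul_central {ε : ℤ} {κ κ' : I → QCG D} (h : TauData D ε κ κ') (c : I → QCG D)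
    (hc : ∀ i x, c i * x = x * c i) (hcc : ∀ i, c i * c i = 1) :
    TauData D ε (fun i => c i * κ i) (fun i => c i * κ' i) := by
  have key : ∀ i (k x : QCG D) (α : Qvpi), x * k = α • (k * x) →
      x * (c i * k) = α • (c i * k * x) := by
    intro i k x α hx
    rw [← mul_assoc, ← hc, mul_assoc, hx, mul_smul_comm, mul_assoc]
  have key1 : ∀ i (k x : QCG D), k * x = x * k → c i * k * x = x * (c i * k) := by
    intro i k x hx
    rw [mul_assoc, hx, ← mul_assoc, hc, mul_assoc]
  exact
  { hK := fun i μ => key1 _ _ _ (h.hK i μ)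
    hJ := fun i μ => key1 _ _ _ (h.hJ i μ)
    hK' := fun i μ => key1 _ _ _ (h.hK' i μ)
    hJ' := fun i μ => key1 _ _ _ (h.hJ' i μ)
    hκ := fun i j => key1 _ _ _ (key1 _ _ _ (h.hκ j i)).symm
    hκ' := fun i j => key1 _ _ _ (key1 _ _ _ (h.hκ' j i)).symm
    hκκ := fun i j => key1 _ _ _ (key1 _ _ _ (h.hκκ i j).symm).symm
    hone := fun i => by
      rw [mul_assoc, ← mul_assoc (κ i), ← hc, mul_assoc, ← mul_assoc, hcc, one_mul, h.hone]
    hF := fun i j => key _ _ _ _ (h.hF i j)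
    hE := fun i j => key _ _ _ _ (h.hE i j)
    hF' := fun i j => key _ _ _ _ (h.hF' i j)
    hE' := fun i j => key _ _ _ _ (h.hE' i j) }

open MulOpposite in
theorem tau_isRep {ε : ℤ} {κ κ' : I → QCG D} (h : TauData D ε κ κ') :
    IsRep D (fun i => op (κ i * F D i)) (fun i => op (κ' i * E D i))
      (fun μ => op (K D μ)) (fun μ => op (J D μ)) where
  j_mul μ ν := by rw [← op_mul, J_mul, add_comm]
  k_mul μ ν := by rw [← op_mul, K_mul, add_comm]
  k_zero := by rw [(isRep D).k_zero, op_one]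
  j_zero := by rw [(isRep D).j_zero, op_one]
  j_sq ν := by rw [← op_mul, J_sq, op_one]
  j_k μ ν := by rw [← op_mul, ← op_mul, J_comm_K]
  j_e μ i := by
    rw [← op_mul, ← op_mul, ← op_smul, ← mul_assoc, ← h.hJ, mul_assoc (κ i) (J D μ), (isRep D).j_f, mul_smul_comm,
      smul_smul, pv_mul]
    simp [pv_zero, mul_assoc]
  j_f μ i := by
    rw [← op_mul, ← op_mul, ← op_smul, ← mul_assoc, ← h.hJ', mul_assoc (κ' i) (J D μ), (isRep D).j_e, mul_smul_comm,
      smul_smul, pv_mul]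
    simp [pv_zero, mul_assoc]
  k_e μ i := by
    rw [← op_mul, ← op_mul, ← op_smul, ← mul_assoc, ← h.hK, mul_assoc (κ i) (K D μ), (isRep D).k_f, mul_smul_comm,
      smul_smul, pv_mul]
    simp [pv_zero, mul_assoc]
  k_f μ i := by
    rw [← op_mul, ← op_mul, ← op_smul, ← mul_assoc, ← h.hK', mul_assoc (κ' i) (K D μ), (isRep D).k_e, mul_smul_comm,
      smul_smul, pv_mul]
    simp [pv_zero, mul_assoc]
  comm_self i := by
    simp only [← op_mul, ← op_smul, ← op_sub]
    have e0 : pv 0 (-(ε * D.dot i i)) * pv 0 (2 * ε * D.d i) = 1 := by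
      rw [pv_mul, D.dot_self, ← pv_zero]; congr 1; ring
    have e1 : (κ' i * E D i) * (κ i * F D i) = E D i * F D i := by
      rw [q_mul_mul (h.hE i i), ← h.hκκ, h.hone, smul_mul_assoc, one_mul, smul_smul, e0, one_smul]
    have e2 : (κ i * F D i) * (κ' i * E D i) = F D i * E D i := by
      rw [q_mul_mul (h.hF' i i), h.hone, smul_mul_assoc, one_mul, smul_smul, e0, one_smul]
    rw [e1, e2, pv_p, comm_self, ← J_comm_K]
    rfl
  comm_ne i j hij := by
    simp only [← op_mul, ← op_smul, ← op_sub]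
    rw [q_mul_mul (h.hE j i), q_mul_mul (h.hF' i j), ← h.hκκ, D.dot_symm j i,
      smul_comm (pv (D.p i * D.p j) 0), ← smul_sub, ← mul_smul_comm, ← mul_sub, mul_comm (D.p i),
      comm_ne D hij.symm]
    simp
  serre_e i j hij := by
    refine Datum.serre_op D hij (Datum.serre_qcomm D i j (h.hF i i) (h.hF i j) ?_
      ((isRep D).serre_f i j hij) (h.hκ i j))
    rw [h.hF j i, D.dot_symm]
  serre_f i j hij := by
    refine Datum.serre_op D hij (Datum.serre_qcomm D i j (h.hE' i i) (h.hE' i j) ?_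
      ((isRep D).serre_e i j hij) (h.hκ' i j))
    rw [h.hE' j i, D.dot_symm]

theorem tauData_tau1 : TauData D (-1) (fun i => pv 0 (-D.d i) • Ktinv D i)
    (fun i => pv 0 (-D.d i) • Kt D i) := by
  constructor <;> intro i <;> try intro j
  all_goals simp only [Kt, Ktinv, smul_mul_assoc, mul_smul_comm, E_mul_K, F_mul_K, map_neg,
    LinearMap.neg_apply, pairing_tilde, neg_neg, ← J_comm_K, K_mul, smul_smul, pv_mul, zero_add,
    neg_add_cancel, (isRep D).k_zero]
  all_goals congr 1
  all_goals try first | (congr 1; rw [D.dot_symm]; ring) | (congr 1; ring) | (rw [K_comm_K])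
  all_goals try rw [add_comm]

theorem tauData_tau1Prime : TauData D (1) (fun i => pv 0 (D.d i) • Kt D i)
    (fun i => pv 0 (D.d i) • Ktinv D i) := by
  constructor <;> intro i <;> try intro j
  all_goals simp only [Kt, Ktinv, smul_mul_assoc, mul_smul_comm, E_mul_K, F_mul_K, map_neg,
    LinearMap.neg_apply, pairing_tilde, neg_neg, ← J_comm_K, K_mul, smul_smul, pv_mul, zero_add,
    add_neg_cancel, (isRep D).k_zero]
  all_goals congr 1
  all_goals try first | (congr 1; rw [D.dot_symm]; ring) | (congr 1; ring) | (rw [K_comm_K])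
  all_goals try rw [add_comm]

/-- The anti-automorphism `τ₁` of `𝐔`, as a homomorphism to the opposite algebra:
`E_i ↦ v_i⁻¹ K̃_{-i} F_i`, `F_i ↦ v_i⁻¹ K̃_i E_i`, `K_ν ↦ K_ν`, `J_ν ↦ J_ν`. -/
def tau1 : QCG D →ₐ[Qvpi] (QCG D)ᵐᵒᵖ := lift D (tau_isRep D (tauData_tau1 D))

/-- The anti-automorphism of `𝐔` with `E_i ↦ v_i K̃_i F_i`, `F_i ↦ v_i K̃_i⁻¹ E_i`,
`K_ν ↦ K_ν`, `J_ν ↦ J_ν`. -/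
def tau1Prime : QCG D →ₐ[Qvpi] (QCG D)ᵐᵒᵖ := lift D (tau_isRep D (tauData_tau1Prime D))

/-- The anti-automorphism of `𝐔` with `E_i ↦ π_i J̃_i v_i K̃_i F_i`,
`F_i ↦ π_i J̃_i v_i K̃_i⁻¹ E_i`, `K_ν ↦ K_ν`, `J_ν ↦ J_ν`. -/
def tau1Second : QCG D →ₐ[Qvpi] (QCG D)ᵐᵒᵖ :=
  lift D (tau_isRep D ((tauData_tau1Prime D).mul_central D (piJt D) (piJt_comm D) (piJt_sq D)))

end QCG

theorem dagR_inverse_qd (i : I) :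
    dagR (Ring.inverse (qd (D.d i))) * pv (D.d i) 0 = Ring.inverse (qd (D.d i)) := by
  have hu := isUnit_qd (D.d_ne i)
  rw [map_inverse_of_isUnit _ hu, dagR_qd, Ring.mul_inverse_rev, mul_assoc]
  have : Ring.inverse (pv (D.d i) 0) * pv (D.d i) 0 = 1 :=
    Ring.inverse_mul_cancel _ (Units.isUnit _)
  rw [this, mul_one]

theorem barR_inverse_qd (i : I) :
    barR (Ring.inverse (qd (D.d i))) = -Ring.inverse (qd (D.d i)) := by
  have hu := isUnit_qd (D.d_ne i)
  rw [map_inverse_of_isUnit _ hu, barR_qd]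
  refine hu.mul_right_cancel ?_
  have h := Ring.inverse_mul_cancel _ hu.neg
  rw [mul_neg] at h
  rw [neg_mul, Ring.inverse_mul_cancel _ hu, ← h, neg_neg]

namespace QCG

theorem bar_isRep : IsRep D (A := Twist barR (QCG D)) (E D) (F D) (fun μ => J D μ * K D (-μ))
    (J D) where
  j_mul := J_mul D
  k_mul μ ν := by
    change J D μ * K D (-μ) * (J D ν * K D (-ν)) = J D (μ + ν) * K D (-(μ + ν))
    rw [mul_assoc, ← mul_assoc (K D (-μ)), ← J_comm_K, ← J_mul, neg_add, ← K_mul]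
    simp only [mul_assoc]
  k_zero := by
    change J D 0 * K D (-0) = 1
    rw [neg_zero, (isRep D).j_zero, (isRep D).k_zero, one_mul]
  j_zero := (isRep D).j_zero
  j_sq := J_sq D
  j_k μ ν := by
    change J D μ * (J D ν * K D (-ν)) = J D ν * K D (-ν) * J D μ
    rw [mul_assoc, ← J_comm_K, ← mul_assoc, J_comm_J, mul_assoc]
  j_e μ i := by
    change J D μ * E D i = barR _ • (E D i * J D μ)
    rw [barR_pv, add_zero, neg_zero, (isRep D).j_e]
  j_f μ i := by
    change J D μ * F D i = barR _ • (F D i * J D μ)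
    rw [barR_pv, add_zero, neg_zero, (isRep D).j_f]
  k_e μ i := by
    change J D μ * K D (-μ) * E D i = barR _ • (E D i * (J D μ * K D (-μ)))
    rw [barR_pv, zero_add, mul_assoc, (isRep D).k_e, mul_smul_comm, ← mul_assoc, (isRep D).j_e,
      smul_mul_assoc, smul_smul, pv_mul, mul_assoc]
    simp
  k_f μ i := by
    change J D μ * K D (-μ) * F D i = barR _ • (F D i * (J D μ * K D (-μ)))
    rw [barR_pv, zero_add, mul_assoc, (isRep D).k_f, mul_smul_comm, ← mul_assoc, (isRep D).j_f,
      smul_mul_assoc, smul_smul, pv_mul, mul_assoc]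
    simp
  comm_self i := by
    change E D i * F D i - barR _ • (F D i * E D i) = barR _ •
      (J D (D.d i • D.rootY i) * (J D (D.d i • D.rootY i) * K D (-(D.d i • D.rootY i))) -
        J D (-(D.d i • D.rootY i)) * K D (- -(D.d i • D.rootY i)))
    rw [barR_pv, add_zero, neg_zero, (isRep D).comm_self, barR_inverse_qd, ← mul_assoc, J_sq,
      one_mul, J_neg, neg_neg, neg_smul, smul_sub, smul_sub, neg_sub]
  comm_ne i j h := by
    change E D i * F D j - barR _ • (F D j * E D i) = 0
    rw [barR_pv, add_zero, neg_zero, (isRep D).comm_ne i j h]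
  serre_e i j h :=
    (D.serre_twist barR (barR_serreCoeff D i j) (E D i) (E D j)).trans ((isRep D).serre_e i j h)
  serre_f i j h :=
    (D.serre_twist barR (barR_serreCoeff D i j) (F D i) (F D j)).trans ((isRep D).serre_f i j h)

/-- The bar involution of `𝐔` as a homomorphism of algebras into a twist. -/
def barHom : QCG D →ₐ[Qvpi] Twist barR (QCG D) := lift D (bar_isRep D)

/-- The bar involution of `𝐔`: `E_i ↦ E_i`, `F_i ↦ F_i`, `K_μ ↦ J_μ K_{-μ}`, `J_μ ↦ J_μ`,
`v ↦ π v⁻¹`. -/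
def bar : QCG D →+* QCG D := (barHom D).toRingHom

theorem dag_isRep : IsRep D (A := Twist dagR (QCG D)) (fun i => piJt D i * E D i) (F D)
    (fun μ => J D μ * K D μ) (J D) where
  j_mul := J_mul D
  k_mul μ ν := by
    change J D μ * K D μ * (J D ν * K D ν) = J D (μ + ν) * K D (μ + ν)
    rw [mul_assoc, ← mul_assoc (K D μ), ← J_comm_K, ← J_mul, ← K_mul]
    simp only [mul_assoc]
  k_zero := by
    change J D 0 * K D 0 = 1
    rw [(isRep D).j_zero, (isRep D).k_zero, one_mul]
  j_zero := (isRep D).j_zero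
  j_sq := J_sq D
  j_k μ ν := by
    change J D μ * (J D ν * K D ν) = J D ν * K D ν * J D μ
    rw [mul_assoc, ← J_comm_K, ← mul_assoc, J_comm_J, mul_assoc]
  j_e μ i := by
    change J D μ * (piJt D i * E D i) = dagR _ • (piJt D i * E D i * J D μ)
    rw [dagR_pv, add_zero, ← mul_assoc, ← piJt_comm, mul_assoc, (isRep D).j_e, mul_smul_comm,
      mul_assoc]
  j_f μ i := by
    change J D μ * F D i = dagR _ • (F D i * J D μ)
    rw [dagR_pv, add_zero, (isRep D).j_f]
  k_e μ i := by
    change J D μ * K D μ * (piJt D i * E D i) = dagR _ • (piJt D i * E D i * (J D μ * K D μ))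
    rw [dagR_pv, zero_add, ← mul_assoc, ← piJt_comm, mul_assoc, mul_assoc, (isRep D).k_e,
      mul_smul_comm, ← mul_assoc (J D μ), (isRep D).j_e,
      smul_mul_assoc, smul_smul, pv_mul, mul_smul_comm]
    simp only [mul_assoc, add_zero, zero_add]
  k_f μ i := by
    change J D μ * K D μ * F D i = dagR _ • (F D i * (J D μ * K D μ))
    rw [dagR_pv, zero_add, mul_assoc, (isRep D).k_f, mul_smul_comm, ← mul_assoc, (isRep D).j_f,
      smul_mul_assoc, smul_smul, pv_mul, mul_assoc]
    simp
  comm_self i := by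
    change piJt D i * E D i * F D i - dagR _ • (F D i * (piJt D i * E D i)) = dagR _ •
      (J D (D.d i • D.rootY i) * (J D (D.d i • D.rootY i) * K D (D.d i • D.rootY i)) -
        J D (-(D.d i • D.rootY i)) * K D (-(D.d i • D.rootY i)))
    rw [dagR_pv, add_zero, ← mul_assoc (F D i), ← piJt_comm, mul_assoc, mul_assoc,
      ← mul_smul_comm, ← mul_sub, (isRep D).comm_self, J_neg, ← mul_sub, ← Jt]
    nth_rewrite 1 [← dagR_inverse_qd]
    rw [piJt, smul_mul_assoc, mul_smul_comm, smul_smul, mul_comm (pv _ _),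
      mul_assoc, pv_mul_self, mul_one]
  comm_ne i j h := by
    change piJt D i * E D i * F D j - dagR _ • (F D j * (piJt D i * E D i)) = 0
    rw [dagR_pv, add_zero, ← mul_assoc (F D j), ← piJt_comm, mul_assoc, mul_assoc,
      ← mul_smul_comm, ← mul_sub, (isRep D).comm_ne i j h, mul_zero]
  serre_e i j h :=
    (D.serre_twist dagR (dagR_serreCoeff D h) (piJt D i * E D i) (piJt D j * E D j)).trans
      (serre_piJt_E D h)
  serre_f i j h :=
    (D.serre_twist dagR (dagR_serreCoeff D h) (F D i) (F D j)).trans ((isRep D).serre_f i j h)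

/-- The involution `†` of `𝐔` as a homomorphism of algebras into a twist. -/
def daggerHom : QCG D →ₐ[Qvpi] Twist dagR (QCG D) := lift D (dag_isRep D)

/-- The involution `†` of `𝐔`: `E_i ↦ π_i J̃_i E_i`, `F_i ↦ F_i`, `K_μ ↦ J_μ K_μ`, `J_μ ↦ J_μ`,
`v ↦ π v`. -/
def dagger : QCG D →+* QCG D := (daggerHom D).toRingHom

theorem bar_smul (c : Qvpi) (x : QCG D) : bar D (c • x) = barR c • bar D x :=
  map_smul (barHom D) c x

theorem dagger_smul (c : Qvpi) (x : QCG D) : dagger D (c • x) = dagR c • dagger D x :=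
  map_smul (daggerHom D) c x

theorem bar_E (i : I) : bar D (E D i) = E D i := lift_E D (bar_isRep D) i
theorem bar_F (i : I) : bar D (F D i) = F D i := lift_F D (bar_isRep D) i
theorem bar_K (μ : Y) : bar D (K D μ) = J D μ * K D (-μ) := lift_K D (bar_isRep D) μ
theorem bar_J (μ : Y) : bar D (J D μ) = J D μ := lift_J D (bar_isRep D) μ
theorem dagger_E (i : I) : dagger D (E D i) = piJt D i * E D i := lift_E D (dag_isRep D) i
theorem dagger_F (i : I) : dagger D (F D i) = F D i := lift_F D (dag_isRep D) i
theorem dagger_K (μ : Y) : dagger D (K D μ) = J D μ * K D μ := lift_K D (dag_isRep D) μ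
theorem dagger_J (μ : Y) : dagger D (J D μ) = J D μ := lift_J D (dag_isRep D) μ

/-- The homomorphism `𝐟 → 𝐔`, `x ↦ x⁻`, with `θ_i ↦ F_i`. -/
def minus : Half D →ₐ[Qvpi] QCG D := Half.lift D (F D) fun i j h => (isRep D).serre_f i j h

end QCG

theorem serre_single {A : Type*} [Ring A] [Algebra Qvpi A] (i j : I) (g h : X) (x y : A)
    (hs : D.serre i j x y = 0) :
    D.serre i j (AddMonoidAlgebra.single g x) (AddMonoidAlgebra.single h y) = 0 := by
  unfold Datum.serre at hs ⊢
  have : ∀ k ∈ Finset.range (D.b i j + 1), D.serreCoeff i j k •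
      (AddMonoidAlgebra.single g x ^ (D.b i j - k) * AddMonoidAlgebra.single h y *
        AddMonoidAlgebra.single g x ^ k) =
      AddMonoidAlgebra.singleAddHom (D.b i j • g + h)
        (D.serreCoeff i j k • (x ^ (D.b i j - k) * y * x ^ k)) := by
    intro k hk
    rw [AddMonoidAlgebra.single_pow, AddMonoidAlgebra.single_pow,
      AddMonoidAlgebra.single_mul_single, AddMonoidAlgebra.single_mul_single,
      AddMonoidAlgebra.smul_single]
    have e : (D.b i j - k) • g + h + k • g = D.b i j • g + h := by
      rw [add_right_comm, ← add_smul,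
        Nat.sub_add_cancel (Nat.lt_succ_iff.mp (Finset.mem_range.mp hk))]
    rw [e]; rfl
  rw [Finset.sum_congr rfl this, ← map_sum, hs, map_zero]

namespace QCG

open AddMonoidAlgebra in
theorem grade_isRep : IsRep D (A := AddMonoidAlgebra (QCG D) X)
    (fun i => single (D.rootX i) (E D i)) (fun i => single (-D.rootX i) (F D i))
    (fun μ => single 0 (K D μ)) (fun μ => single 0 (J D μ)) where
  j_mul μ ν := by rw [single_mul_single, add_zero, J_mul]
  k_mul μ ν := by rw [single_mul_single, add_zero, K_mul]
  k_zero := by rw [(isRep D).k_zero]; rfl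
  j_zero := by rw [(isRep D).j_zero]; rfl
  j_sq ν := by rw [single_mul_single, add_zero, J_sq]; rfl
  j_k μ ν := by rw [single_mul_single, single_mul_single, J_comm_K]
  j_e μ i := by
    rw [single_mul_single, single_mul_single, smul_single, (isRep D).j_e, add_zero, zero_add]
  j_f μ i := by
    rw [single_mul_single, single_mul_single, smul_single, (isRep D).j_f, add_zero, zero_add]
  k_e μ i := by
    rw [single_mul_single, single_mul_single, smul_single, (isRep D).k_e, add_zero, zero_add]
  k_f μ i := by
    rw [single_mul_single, single_mul_single, smul_single, (isRep D).k_f, add_zero, zero_add]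
  comm_self i := by
    simp only [single_mul_single, smul_single, add_zero, add_neg_cancel, neg_add_cancel]
    rw [← single_sub, ← single_sub, smul_single, (isRep D).comm_self]
  comm_ne i j h := by
    simp only [single_mul_single, smul_single]
    rw [add_comm (-D.rootX j), ← single_sub, (isRep D).comm_ne i j h, single_zero]
  serre_e i j h := serre_single D i j _ _ _ _ ((isRep D).serre_e i j h)
  serre_f i j h := serre_single D i j _ _ _ _ ((isRep D).serre_f i j h)

/-- The `X`-grading of `𝐔`, with `E_i` in degree `i'`, `F_i` in degree `-i'` and `K_μ`, `J_μ` in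
degree `0`, as the homomorphism `x ↦ ∑ γ, x_γ ⊗ γ`. -/
def grade : QCG D →ₐ[Qvpi] AddMonoidAlgebra (QCG D) X := lift D (grade_isRep D)

/-- The component `x_γ` of degree `γ` of `x`. -/
def comp (γ : X) : QCG D →ₗ[Qvpi] QCG D where
  toFun x := (grade D x).coeff γ
  map_add' x y := by simp
  map_smul' c x := by simp

theorem left_induction {P : QCG D → Prop} (one : P 1)
    (smul : ∀ (c : Qvpi) (x), P x → P (c • x)) (add : ∀ x y, P x → P y → P (x + y))
    (hE : ∀ i x, P x → P (E D i * x)) (hF : ∀ i x, P x → P (F D i * x))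
    (hK : ∀ μ x, P x → P (K D μ * x)) (hJ : ∀ μ x, P x → P (J D μ * x)) (x : QCG D) : P x := by
  have key : ∀ a x, P x → P (a * x) := by
    intro a
    induction a using induction with
    | scalar c => intro x hx; rw [← Algebra.smul_def]; exact smul c x hx
    | hE i => exact hE i
    | hF i => exact hF i
    | hK μ => exact hK μ
    | hJ μ => exact hJ μ
    | mul x y hx hy => intro z hz; rw [mul_assoc]; exact hx _ (hy _ hz)
    | add x y hx hy => intro z hz; rw [add_mul]; exact add _ _ (hx _ hz) (hy _ hz)
  simpa using key x 1 one

theorem comp_E_mul (i : I) (γ : X) (x : QCG D) :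
    comp D γ (E D i * x) = E D i * comp D (-D.rootX i + γ) x := by
  change (grade D (E D i * x)).coeff γ = _
  rw [map_mul, grade, lift_E, AddMonoidAlgebra.coeff_single_mul_apply]; rfl

theorem comp_F_mul (i : I) (γ : X) (x : QCG D) :
    comp D γ (F D i * x) = F D i * comp D (D.rootX i + γ) x := by
  change (grade D (F D i * x)).coeff γ = _
  rw [map_mul, grade, lift_F, AddMonoidAlgebra.coeff_single_mul_apply, neg_neg]; rfl

theorem comp_K_mul (μ : Y) (γ : X) (x : QCG D) :
    comp D γ (K D μ * x) = K D μ * comp D γ x := by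
  change (grade D (K D μ * x)).coeff γ = _
  rw [map_mul, grade, lift_K, AddMonoidAlgebra.coeff_single_mul_apply, neg_zero, zero_add]; rfl

theorem comp_J_mul (μ : Y) (γ : X) (x : QCG D) :
    comp D γ (J D μ * x) = J D μ * comp D γ x := by
  change (grade D (J D μ * x)).coeff γ = _
  rw [map_mul, grade, lift_J, AddMonoidAlgebra.coeff_single_mul_apply, neg_zero, zero_add]; rfl

theorem comp_mul_K (μ : Y) (γ : X) (x : QCG D) :
    comp D γ (x * K D μ) = comp D γ x * K D μ := by
  change (grade D (x * K D μ)).coeff γ = _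
  rw [map_mul, grade, lift_K, AddMonoidAlgebra.coeff_mul_single_apply, neg_zero, add_zero]; rfl

theorem comp_mul_J (μ : Y) (γ : X) (x : QCG D) :
    comp D γ (x * J D μ) = comp D γ x * J D μ := by
  change (grade D (x * J D μ)).coeff γ = _
  rw [map_mul, grade, lift_J, AddMonoidAlgebra.coeff_mul_single_apply, neg_zero, add_zero]; rfl

theorem comp_one_of_ne {γ : X} (h : γ ≠ 0) : comp D γ 1 = 0 := by
  change (grade D 1).coeff γ = _
  rw [map_one, AddMonoidAlgebra.one_def, AddMonoidAlgebra.coeff_single,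
    Finsupp.single_eq_of_ne h]

theorem K_mul_comp (μ : Y) (x : QCG D) : ∀ γ : X,
    K D μ * comp D γ x = pv 0 (D.pairing μ γ) • (comp D γ x * K D μ) := by
  induction x using left_induction with
  | one =>
    intro γ
    by_cases h : γ = 0
    · subst h
      have : comp D (0 : X) 1 = 1 := by
        change (grade D 1).coeff 0 = 1
        rw [map_one, AddMonoidAlgebra.coeff_one_zero]
      rw [this, map_zero, pv_zero, one_smul, mul_one, one_mul]
    · rw [comp_one_of_ne D h, mul_zero, zero_mul, smul_zero]
  | smul c x h => intro γ; rw [map_smul, mul_smul_comm, h, smul_mul_assoc, smul_comm]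
  | add x y hx hy => intro γ; rw [map_add, mul_add, hx, hy, add_mul, smul_add]
  | hE i x h =>
    intro γ
    rw [comp_E_mul, ← mul_assoc, (isRep D).k_e, smul_mul_assoc, mul_assoc, h, mul_smul_comm,
      smul_smul, pv_mul, mul_assoc, map_add, map_neg]
    congr 2; ring
  | hF i x h =>
    intro γ
    rw [comp_F_mul, ← mul_assoc, (isRep D).k_f, smul_mul_assoc, mul_assoc, h, mul_smul_comm,
      smul_smul, pv_mul, mul_assoc, map_add]
    congr 2; ring
  | hK ν x h =>
    intro γ
    rw [comp_K_mul, ← mul_assoc, K_comm_K, mul_assoc, h, mul_smul_comm, mul_assoc]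
  | hJ ν x h =>
    intro γ
    rw [comp_J_mul, ← mul_assoc, ← J_comm_K, mul_assoc, h, mul_smul_comm, mul_assoc]

theorem J_mul_comp (μ : Y) (x : QCG D) : ∀ γ : X,
    J D μ * comp D γ x = pv (D.pairing μ γ) 0 • (comp D γ x * J D μ) := by
  induction x using left_induction with
  | one =>
    intro γ
    by_cases h : γ = 0
    · subst h
      have : comp D (0 : X) 1 = 1 := by
        change (grade D 1).coeff 0 = 1
        rw [map_one, AddMonoidAlgebra.coeff_one_zero]
      rw [this, map_zero, pv_zero, one_smul, mul_one, one_mul]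
    · rw [comp_one_of_ne D h, mul_zero, zero_mul, smul_zero]
  | smul c x h => intro γ; rw [map_smul, mul_smul_comm, h, smul_mul_assoc, smul_comm]
  | add x y hx hy => intro γ; rw [map_add, mul_add, hx, hy, add_mul, smul_add]
  | hE i x h =>
    intro γ
    rw [comp_E_mul, ← mul_assoc, (isRep D).j_e, smul_mul_assoc, mul_assoc, h, mul_smul_comm,
      smul_smul, pv_mul, mul_assoc, map_add, map_neg]
    congr 2; ring
  | hF i x h =>
    intro γ
    rw [comp_F_mul, ← mul_assoc, (isRep D).j_f, smul_mul_assoc, mul_assoc, h, mul_smul_comm,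
      smul_smul, pv_mul, mul_assoc, map_add]
    congr 2; ring
  | hK ν x h =>
    intro γ
    rw [comp_K_mul, ← mul_assoc, J_comm_K, mul_assoc, h, mul_smul_comm, mul_assoc]
  | hJ ν x h =>
    intro γ
    rw [comp_J_mul, ← mul_assoc, J_comm_J, mul_assoc, h, mul_smul_comm, mul_assoc]

end QCG

/-- The relations `x (K_ν - v ^ ⟨ν, λ⟩) 1_λ = 0` and `x (J_ν - π ^ ⟨ν, λ⟩) 1_λ = 0`, where
`Finsupp.single λ x` stands for `x 1_λ`. -/
def dotRel : Submodule (QCG D) (X →₀ QCG D) :=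
  Submodule.span (QCG D)
    ({w | ∃ (l : X) (ν : Y), w = Finsupp.single l
        (QCG.K D ν - algebraMap Qvpi _ (pv 0 (D.pairing ν l)))} ∪
      {w | ∃ (l : X) (ν : Y), w = Finsupp.single l
        (QCG.J D ν - algebraMap Qvpi _ (pv (D.pairing ν l) 0))})

/-- The modified quantum covering group `𝐔̇ = ⊕_λ 𝐔 1_λ`, where `𝐔 1_λ` is the quotient of `𝐔`
by the left ideal generated by all `K_ν - v ^ ⟨ν, λ⟩` and `J_ν - π ^ ⟨ν, λ⟩`. -/
def Udot : Type _ := (X →₀ QCG D) ⧸ dotRel D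

instance : AddCommGroup (Udot D) := inferInstanceAs (AddCommGroup ((X →₀ QCG D) ⧸ dotRel D))
instance : Module (QCG D) (Udot D) :=
  inferInstanceAs (Module (QCG D) ((X →₀ QCG D) ⧸ dotRel D))
instance : Module Qvpi (Udot D) := inferInstanceAs (Module Qvpi ((X →₀ QCG D) ⧸ dotRel D))
instance : IsScalarTower Qvpi (QCG D) (Udot D) :=
  inferInstanceAs (IsScalarTower Qvpi (QCG D) ((X →₀ QCG D) ⧸ dotRel D))

namespace Udot

/-- The element `x 1_λ`. -/
def of (l : X) : QCG D →ₗ[Qvpi] Udot D where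
  toFun x := (dotRel D).mkQ (Finsupp.single l x)
  map_add' x y := by rw [Finsupp.single_add, map_add]; rfl
  map_smul' c x := by rw [← Finsupp.smul_single]; rfl

/-- The idempotent `1_λ`. -/
def one (l : X) : Udot D := of D l 1

theorem smul_of (u x : QCG D) (l : X) : u • of D l x = of D l (u * x) := by
  change u • (dotRel D).mkQ (Finsupp.single l x) = (dotRel D).mkQ (Finsupp.single l (u * x))
  rw [← map_smul, Finsupp.smul_single, smul_eq_mul]

theorem of_mul_K (x : QCG D) (ν : Y) (l : X) :
    of D l (x * QCG.K D ν) = pv 0 (D.pairing ν l) • of D l x := by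
  have h : (dotRel D).mkQ (Finsupp.single l
      (QCG.K D ν - algebraMap Qvpi _ (pv 0 (D.pairing ν l)))) = 0 :=
    (Submodule.Quotient.mk_eq_zero _).mpr (Submodule.subset_span (Or.inl ⟨l, ν, rfl⟩))
  have h2 : of D l (QCG.K D ν - algebraMap Qvpi _ (pv 0 (D.pairing ν l))) = 0 := h
  rw [map_sub, sub_eq_zero] at h2
  rw [← smul_of, h2, smul_of, ← Algebra.commutes, ← Algebra.smul_def, map_smul]

theorem of_mul_J (x : QCG D) (ν : Y) (l : X) :
    of D l (x * QCG.J D ν) = pv (D.pairing ν l) 0 • of D l x := by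
  have h : (dotRel D).mkQ (Finsupp.single l
      (QCG.J D ν - algebraMap Qvpi _ (pv (D.pairing ν l) 0))) = 0 :=
    (Submodule.Quotient.mk_eq_zero _).mpr (Submodule.subset_span (Or.inr ⟨l, ν, rfl⟩))
  have h2 : of D l (QCG.J D ν - algebraMap Qvpi _ (pv (D.pairing ν l) 0)) = 0 := h
  rw [map_sub, sub_eq_zero] at h2
  rw [← smul_of, h2, smul_of, ← Algebra.commutes, ← Algebra.smul_def, map_smul]

theorem induction {P : Udot D → Prop} (of : ∀ l x, P (of D l x)) (add : ∀ x y, P x → P y → P (x + y))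
    (x : Udot D) : P x := by
  obtain ⟨x, rfl⟩ := Submodule.mkQ_surjective (dotRel D) x
  induction x using Finsupp.induction_linear with
  | zero =>
    have h := of 0 0
    rw [map_zero] at h
    exact h
  | add x y hx hy => rw [map_add]; exact add _ _ hx hy
  | single l x => exact of l x

/-- The linear map on `𝐔̇` with `x 1_λ ↦ f λ x`. -/
def lift {M : Type*} [AddCommGroup M] [Module Qvpi M] (f : X → QCG D →ₗ[Qvpi] M)
    (hK : ∀ l x ν, f l (x * QCG.K D ν) = pv 0 (D.pairing ν l) • f l x)
    (hJ : ∀ l x ν, f l (x * QCG.J D ν) = pv (D.pairing ν l) 0 • f l x) : Udot D →ₗ[Qvpi] M :=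
  have key : ∀ w ∈ dotRel D, Finsupp.lsum Qvpi f w = 0 := by
    intro w hw
    induction hw using Submodule.closure_induction with
    | zero => rw [map_zero]
    | add x y _ _ hx hy => rw [map_add, hx, hy, add_zero]
    | smul_mem u x hx =>
      rcases hx with ⟨l, ν, rfl⟩ | ⟨l, ν, rfl⟩
      · rw [Finsupp.smul_single, Finsupp.lsum_single, smul_eq_mul, mul_sub, map_sub, hK,
          ← Algebra.commutes, ← Algebra.smul_def, map_smul, sub_self]
      · rw [Finsupp.smul_single, Finsupp.lsum_single, smul_eq_mul, mul_sub, map_sub, hJ,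
          ← Algebra.commutes, ← Algebra.smul_def, map_smul, sub_self]
  { toFun := QuotientAddGroup.lift (dotRel D).toAddSubgroup
      (Finsupp.lsum Qvpi f).toAddMonoidHom key
    map_add' := map_add _
    map_smul' := fun c x => by
      obtain ⟨x, rfl⟩ := Submodule.mkQ_surjective (dotRel D) x
      exact map_smul (Finsupp.lsum Qvpi f) c x }

theorem lift_of {M : Type*} [AddCommGroup M] [Module Qvpi M] (f : X → QCG D →ₗ[Qvpi] M)
    (hK : ∀ l x ν, f l (x * QCG.K D ν) = pv 0 (D.pairing ν l) • f l x)
    (hJ : ∀ l x ν, f l (x * QCG.J D ν) = pv (D.pairing ν l) 0 • f l x) (l : X) (x : QCG D) :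
    lift D f hK hJ (of D l x) = f l x :=
  Finsupp.lsum_single Qvpi f l x

/-- Left multiplication by `1_λ`: `1_λ y 1_η = y_γ 1_η`, with `γ = λ - η`. -/
def proj (l : X) : Udot D →ₗ[Qvpi] Udot D :=
  lift D (fun η => of D η ∘ₗ QCG.comp D (l - η))
    (fun η x ν => by
      rw [LinearMap.comp_apply, QCG.comp_mul_K, of_mul_K]; rfl)
    (fun η x ν => by
      rw [LinearMap.comp_apply, QCG.comp_mul_J, of_mul_J]; rfl)

theorem proj_of (l η : X) (y : QCG D) : proj D l (of D η y) = of D η (QCG.comp D (l - η) y) :=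
  lift_of D _ _ _ η y

theorem K_smul_proj (ν : Y) (l : X) (w : Udot D) :
    QCG.K D ν • proj D l w = pv 0 (D.pairing ν l) • proj D l w := by
  induction w using induction with
  | of η y =>
    rw [proj_of, smul_of, QCG.K_mul_comp, map_smul, of_mul_K, smul_smul, pv_mul, ← map_add,
      sub_add_cancel, add_zero]
  | add x y hx hy => rw [map_add, smul_add, hx, hy, smul_add]

theorem J_smul_proj (ν : Y) (l : X) (w : Udot D) :
    QCG.J D ν • proj D l w = pv (D.pairing ν l) 0 • proj D l w := by
  induction w using induction with
  | of η y =>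
    rw [proj_of, smul_of, QCG.J_mul_comp, map_smul, of_mul_J, smul_smul, pv_mul, ← map_add,
      sub_add_cancel, add_zero]
  | add x y hx hy => rw [map_add, smul_add, hx, hy, smul_add]

/-- The multiplication of `𝐔̇` as a bilinear map: `(x 1_λ) w = x (1_λ w)`. -/
def mulHom : Udot D →ₗ[Qvpi] Udot D →ₗ[Qvpi] Udot D :=
  lift D
    (fun l =>
      { toFun := fun x =>
          { toFun := fun w => x • proj D l w
            map_add' := fun w z => by rw [map_add, smul_add]
            map_smul' := fun c w => by
              rw [map_smul, RingHom.id_apply, ← algebraMap_smul (QCG D) c,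
                ← algebraMap_smul (QCG D) c, smul_smul, smul_smul, Algebra.commutes] }
        map_add' := fun x y => by ext w; exact add_smul x y _
        map_smul' := fun c x => by ext w; exact smul_assoc c x _ })
    (fun l x ν => by
      ext w
      change (x * QCG.K D ν) • proj D l w = pv 0 (D.pairing ν l) • (x • proj D l w)
      rw [mul_smul, K_smul_proj, ← algebraMap_smul (QCG D), ← algebraMap_smul (QCG D), smul_smul,
        smul_smul, Algebra.commutes])
    (fun l x ν => by
      ext w
      change (x * QCG.J D ν) • proj D l w = pv (D.pairing ν l) 0 • (x • proj D l w)
      rw [mul_smul, J_smul_proj, ← algebraMap_smul (QCG D), ← algebraMap_smul (QCG D), smul_smul,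
        smul_smul, Algebra.commutes])

instance : Mul (Udot D) := ⟨fun w z => mulHom D w z⟩

theorem of_mul_of (l η : X) (x y : QCG D) :
    of D l x * of D η y = of D η (x * QCG.comp D (l - η) y) := by
  change mulHom D (of D l x) (of D η y) = _
  rw [mulHom, lift_of]
  change x • proj D l (of D η y) = _
  rw [proj_of, smul_of]

/-- The map of `𝐔̇` induced by a ring endomorphism `σ` of `𝐔` and a map `t` of `X`:
`x 1_λ ↦ σ(x) 1_{t λ}`. -/
def map (σ : QCG D →+* QCG D) (t : X → X)
    (hK : ∀ l ν, of D (t l) (σ (QCG.K D ν - algebraMap Qvpi _ (pv 0 (D.pairing ν l)))) = 0)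
    (hJ : ∀ l ν, of D (t l) (σ (QCG.J D ν - algebraMap Qvpi _ (pv (D.pairing ν l) 0))) = 0) :
    Udot D →+ Udot D :=
  QuotientAddGroup.lift (dotRel D).toAddSubgroup
    (Finsupp.liftAddHom fun l => (of D (t l)).toAddMonoidHom.comp σ.toAddMonoidHom) (by
      intro w hw
      induction hw using Submodule.closure_induction with
      | zero => exact map_zero _
      | add x y _ _ hx hy => exact (map_add _ x y).trans (by
          rw [show _ = _ from hx, show _ = _ from hy]; exact add_zero _)
      | smul_mem u x hx =>
        rcases hx with ⟨l, ν, rfl⟩ | ⟨l, ν, rfl⟩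
        · rw [Finsupp.smul_single]
          refine (Finsupp.liftAddHom_apply_single _ _ _).trans ?_
          change of D (t l) (σ (u * _)) = 0
          rw [map_mul, ← smul_of, hK, smul_zero]
        · rw [Finsupp.smul_single]
          refine (Finsupp.liftAddHom_apply_single _ _ _).trans ?_
          change of D (t l) (σ (u * _)) = 0
          rw [map_mul, ← smul_of, hJ, smul_zero])

theorem map_of (σ : QCG D →+* QCG D) (t : X → X) (hK hJ) (l : X) (x : QCG D) :
    map D σ t hK hJ (of D l x) = of D (t l) (σ x) :=
  Finsupp.liftAddHom_apply_single _ _ _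

theorem of_K (l : X) (ν : Y) : of D l (QCG.K D ν) = pv 0 (D.pairing ν l) • one D l := by
  rw [one, ← of_mul_K, one_mul]
theorem of_J (l : X) (ν : Y) : of D l (QCG.J D ν) = pv (D.pairing ν l) 0 • one D l := by
  rw [one, ← of_mul_J, one_mul]
theorem of_JK (l : X) (μ ν : Y) : of D l (QCG.J D μ * QCG.K D ν) =
    pv (D.pairing μ l) (D.pairing ν l) • one D l := by
  rw [of_mul_K, of_J, smul_smul, pv_mul, zero_add, add_zero]
theorem of_algebraMap (l : X) (c : Qvpi) : of D l (algebraMap Qvpi _ c) = c • one D l := by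
  rw [Algebra.algebraMap_eq_smul_one, map_smul]; rfl

/-- The bar involution of `𝐔̇`: `x 1_λ ↦ x̄ 1_λ`. -/
def bar : Udot D →+ Udot D := map D (QCG.bar D) id
  (fun l ν => by
    rw [map_sub, map_sub, QCG.bar_K, of_JK, Algebra.algebraMap_eq_smul_one, QCG.bar_smul, map_one,
      barR_pv, ← Algebra.algebraMap_eq_smul_one, of_algebraMap]
    simp)
  (fun l ν => by
    rw [map_sub, map_sub, QCG.bar_J, of_J, Algebra.algebraMap_eq_smul_one, QCG.bar_smul, map_one,
      barR_pv, ← Algebra.algebraMap_eq_smul_one, of_algebraMap]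
    simp)

/-- The involution `†` of `𝐔̇`: `x 1_λ ↦ x† 1_λ`. -/
def dagger : Udot D →+ Udot D := map D (QCG.dagger D) id
  (fun l ν => by
    rw [map_sub, map_sub, QCG.dagger_K, of_JK, Algebra.algebraMap_eq_smul_one, QCG.dagger_smul,
      map_one, dagR_pv, ← Algebra.algebraMap_eq_smul_one, of_algebraMap]
    simp)
  (fun l ν => by
    rw [map_sub, map_sub, QCG.dagger_J, of_J, Algebra.algebraMap_eq_smul_one, QCG.dagger_smul,
      map_one, dagR_pv, ← Algebra.algebraMap_eq_smul_one, of_algebraMap]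
    simp)

/-- The automorphism `ω` of `𝐔̇`: `x 1_λ ↦ ω(x) 1_{-λ}`. -/
def omega : Udot D →ₗ[Qvpi] Udot D := lift D (fun l => of D (-l) ∘ₗ (QCG.omega D).toLinearMap)
  (fun l x ν => by
    change of D (-l) (QCG.omega D (x * QCG.K D ν)) = _ • of D (-l) (QCG.omega D x)
    rw [map_mul, show QCG.omega D (QCG.K D ν) = QCG.K D (-ν) from QCG.lift_K D _ ν, of_mul_K]
    simp)
  (fun l x ν => by
    change of D (-l) (QCG.omega D (x * QCG.J D ν)) = _ • of D (-l) (QCG.omega D x)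
    rw [map_mul, show QCG.omega D (QCG.J D ν) = QCG.J D ν from QCG.lift_J D _ ν, of_mul_J,
      pv_congr (a' := D.pairing ν l) ⟨-D.pairing ν l, by simp; ring⟩ rfl])

/-- The inverse of the automorphism `ω` of `𝐔̇`: `x 1_λ ↦ ω⁻¹(x) 1_{-λ}`. -/
def omegaInv : Udot D →ₗ[Qvpi] Udot D :=
  lift D (fun l => of D (-l) ∘ₗ (QCG.omega D).symm.toLinearMap)
  (fun l x ν => by
    change of D (-l) ((QCG.omega D).symm (x * QCG.K D ν)) = _ • of D (-l) ((QCG.omega D).symm x)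
    rw [map_mul, show (QCG.omega D).symm (QCG.K D ν) = QCG.K D (-ν) from QCG.lift_K D _ ν,
      of_mul_K]
    simp)
  (fun l x ν => by
    change of D (-l) ((QCG.omega D).symm (x * QCG.J D ν)) = _ • of D (-l) ((QCG.omega D).symm x)
    rw [map_mul, show (QCG.omega D).symm (QCG.J D ν) = QCG.J D ν from QCG.lift_J D _ ν, of_mul_J,
      pv_congr (a' := D.pairing ν l) ⟨-D.pairing ν l, by simp; ring⟩ rfl])

theorem omega_of (l : X) (x : QCG D) : omega D (of D l x) = of D (-l) (QCG.omega D x) :=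
  lift_of D _ _ _ l x
theorem omegaInv_of (l : X) (x : QCG D) :
    omegaInv D (of D l x) = of D (-l) ((QCG.omega D).symm x) :=
  lift_of D _ _ _ l x

theorem omega_omegaInv (w : Udot D) : omega D (omegaInv D w) = w := by
  induction w using induction with
  | of l x => rw [omegaInv_of, omega_of, neg_neg, AlgEquiv.apply_symm_apply]
  | add x y hx hy => rw [map_add, map_add, hx, hy]

theorem omegaInv_omega (w : Udot D) : omegaInv D (omega D w) = w := by
  induction w using induction with
  | of l x => rw [omega_of, omegaInv_of, neg_neg, AlgEquiv.symm_apply_apply]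
  | add x y hx hy => rw [map_add, map_add, hx, hy]

/-- The element `1_λ x = ∑ γ, x_γ 1_{λ - γ}`. -/
def oneMul (l : X) : QCG D →ₗ[Qvpi] Udot D where
  toFun x := (QCG.grade D x).coeff.sum fun γ y => of D (l - γ) y
  map_add' x y := by
    rw [map_add, AddMonoidAlgebra.coeff_add, Finsupp.sum_add_index'] <;> simp
  map_smul' c x := by
    rw [map_smul, AddMonoidAlgebra.coeff_smul, Finsupp.sum_smul_index', Finsupp.smul_sum] <;> simp

theorem oneMul_single_mul (l : X) (k : QCG D) (z : AddMonoidAlgebra (QCG D) X) :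
    (AddMonoidAlgebra.single 0 k * z).coeff.sum (fun γ y => of D (l - γ) y) =
      k • z.coeff.sum fun γ y => of D (l - γ) y := by
  induction z using AddMonoidAlgebra.induction_linear with
  | zero => simp
  | add x y hx hy =>
    rw [mul_add, AddMonoidAlgebra.coeff_add, AddMonoidAlgebra.coeff_add, Finsupp.sum_add_index',
      Finsupp.sum_add_index', hx, hy, smul_add] <;> simp
  | single γ y =>
    rw [AddMonoidAlgebra.single_mul_single, zero_add, AddMonoidAlgebra.coeff_single,
      AddMonoidAlgebra.coeff_single, Finsupp.sum_single_index (by simp),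
      Finsupp.sum_single_index (by simp), smul_of]

theorem oneMul_K_mul (l : X) (ν : Y) (x : QCG D) :
    oneMul D l (QCG.K D ν * x) = pv 0 (D.pairing ν l) • oneMul D l x := by
  change (QCG.grade D (QCG.K D ν * x)).coeff.sum (fun γ y => of D (l - γ) y) =
    pv 0 (D.pairing ν l) • (QCG.grade D x).coeff.sum fun γ y => of D (l - γ) y
  rw [map_mul, QCG.grade, QCG.lift_K, oneMul_single_mul, Finsupp.smul_sum, Finsupp.smul_sum]
  refine Finsupp.sum_congr fun γ _ => ?_
  have h := QCG.K_mul_comp D ν x γ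
  change QCG.K D ν • of D (l - γ) (QCG.comp D γ x) = _ • of D (l - γ) (QCG.comp D γ x)
  rw [smul_of, h, map_smul, of_mul_K, smul_smul, pv_mul, ← map_add, add_sub_cancel, add_zero]

theorem oneMul_J_mul (l : X) (ν : Y) (x : QCG D) :
    oneMul D l (QCG.J D ν * x) = pv (D.pairing ν l) 0 • oneMul D l x := by
  change (QCG.grade D (QCG.J D ν * x)).coeff.sum (fun γ y => of D (l - γ) y) =
    pv (D.pairing ν l) 0 • (QCG.grade D x).coeff.sum fun γ y => of D (l - γ) y
  rw [map_mul, QCG.grade, QCG.lift_J, oneMul_single_mul, Finsupp.smul_sum, Finsupp.smul_sum]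
  refine Finsupp.sum_congr fun γ _ => ?_
  have h := QCG.J_mul_comp D ν x γ
  change QCG.J D ν • of D (l - γ) (QCG.comp D γ x) = _ • of D (l - γ) (QCG.comp D γ x)
  rw [smul_of, h, map_smul, of_mul_J, smul_smul, pv_mul, ← map_add, add_sub_cancel, add_zero]

open MulOpposite in
/-- The anti-automorphism `ρ` of `𝐔̇`: `x 1_λ ↦ 1_{-λ} ρ(x)`. -/
def rho : Udot D →ₗ[Qvpi] Udot D :=
  lift D (fun l => oneMul D (-l) ∘ₗ (opLinearEquiv Qvpi).symm.toLinearMap ∘ₗ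
      (QCG.rho D).toLinearMap)
  (fun l x ν => by
    change oneMul D (-l) (unop (QCG.rho D (x * QCG.K D ν))) =
      _ • oneMul D (-l) (unop (QCG.rho D x))
    rw [map_mul, unop_mul, show QCG.rho D (QCG.K D ν) = op (QCG.K D (-ν)) from QCG.lift_K D _ ν,
      unop_op, oneMul_K_mul]
    simp)
  (fun l x ν => by
    change oneMul D (-l) (unop (QCG.rho D (x * QCG.J D ν))) =
      _ • oneMul D (-l) (unop (QCG.rho D x))
    rw [map_mul, unop_mul, show QCG.rho D (QCG.J D ν) = op (QCG.J D ν) from QCG.lift_J D _ ν,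
      unop_op, oneMul_J_mul,
      pv_congr (a' := D.pairing ν l) ⟨-D.pairing ν l, by simp; ring⟩ rfl])

theorem rho_of (l : X) (x : QCG D) :
    rho D (of D l x) = oneMul D (-l) (QCG.rho D x).unop :=
  lift_of D _ _ _ l x

end Udot

/-- The conditions on a bilinear form `B` on `𝐔̇`, for an anti-automorphism `τ` of `𝐔` and a form
`b` on `𝐟`. -/
structure IsDotForm (τ : QCG D →ₐ[Qvpi] (QCG D)ᵐᵒᵖ) (b : Half D → Half D → Qvpi)
    (B : Udot D →ₗ[Qvpi] Udot D →ₗ[Qvpi] Qvpi) : Prop where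
  weight : ∀ (l₁ l₂ m₁ m₂ : X) (x y : Udot D), ¬(l₁ = m₁ ∧ l₂ = m₂) →
    B (Udot.one D l₁ * x * Udot.one D l₂) (Udot.one D m₁ * y * Udot.one D m₂) = 0
  adjoint : ∀ (u : QCG D) (x y : Udot D), B (u • x) y = B x ((τ u).unop • y)
  minus : ∀ (l : X) (x y : Half D),
    B (Udot.of D l (QCG.minus D x)) (Udot.of D l (QCG.minus D y)) = b x y
  symm : ∀ x y : Udot D, B x y = B y x

end QuantumCovering

end

noncomputable section

namespace QuantumCovering

/-! ### Scalars -/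

/-! A form of type (τ, β) amounts to a family of functionals φ_λ(w) = (1_λ, w 1_λ) on 𝐔. The
adjunction gives (u 1_λ, w 1_λ) = φ_λ(τ(u) w), different right weights are orthogonal, and condition
3 prescribes φ_λ on the elements τ(x⁻) y⁻.

Uniqueness: these elements together with the torus span 𝐔, because E_i is τ(F_i) up to a scalar and
a torus factor, and E_i can be moved across y⁻ at the cost of two skew derivations (`E_mul_minus`).
Hence a functional that is equivariant on the right under the torus is determined by its values on
them (`functional_ext`). Most later identities between functionals are checked there only.

Existence: the values on τ(x⁻) y⁻ must be free to choose. For this 𝐔 is made to act on 𝐟 ⊗ 𝐟, where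
x ⊗ y plays the role of x⁺ y⁻ 1_λ. The hard point is the Serre relation for the operators F_i
(`Model.serre_f`). It holds on 1 ⊗ y, and it spreads to all of 𝐟 ⊗ 𝐟 because the Serre element
commutes with each E_n up to a unit, which is a formal consequence of the commutation rule between
E_n and the F_j (`mul_serre`). A twisted change of coordinates then sends τ((rev x)⁻) y⁻ (1 ⊗ 1) to
x ⊗ y, and β gives φ_λ. Symmetry of β and self-adjointness of the dilations of 𝐟 make φ_λ invariant
under τ, and the form follows (`exists_dotForm`).

Part (b): bar followed by † is v ↦ v⁻¹ on scalars. It conjugates τ₁ into τ₁'' (`anti_tau1_dagBar`),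
and † preserves the form on 𝐟, so the transported form has type (τ₁'', β̄). Its invariance rests on
an adjunction for right multiplication, φ_λ(τ₁''(u) w) = φ_{λ+|u|}(w τ₁(u)) for homogeneous u
(`anti_homog_mul`). For u = F_i this expresses that right multiplication by θ_i on 𝐟 is adjoint to a
right skew derivation. Since ρ τ₁'' = τ₁ ρ and reversal is an isometry of 𝐟, invariance under ρ
follows. For ω one has τ₁'' ω = ω⁻¹ τ₁''; on monomials the powers of v and the torus factors cancel
when the weights agree, and both sides vanish otherwise. -/

theorem Qvpi.ringHom_ext {S : Type*} [Ring S] {φ ψ : Qvpi →+* S} (hπ : φ piElt = ψ piElt)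
    (hv : φ (ofRat RatFunc.X) = ψ (ofRat RatFunc.X)) : φ = ψ := by
  have h : φ.comp ofRat = ψ.comp ofRat := by
    refine IsLocalization.ringHom_ext (nonZeroDivisors (Polynomial ℚ)) ?_
    refine Polynomial.ringHom_ext (fun a => ?_) ?_
    -- Ring homomorphisms out of ℚ are unique, so the constants need no hypothesis.
    · exact RingHom.congr_fun (Subsingleton.elim
        (((φ.comp ofRat).comp (algebraMap (Polynomial ℚ) (RatFunc ℚ))).comp Polynomial.C)
        (((ψ.comp ofRat).comp (algebraMap (Polynomial ℚ) (RatFunc ℚ))).comp Polynomial.C)) a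
    · simpa [RatFunc.algebraMap_X] using hv
  ext x
  obtain ⟨p, rfl⟩ := AdjoinRoot.mk_surjective x
  induction p using Polynomial.induction_on' with
  | add p q hp hq =>
    have e := (AdjoinRoot.mk (Polynomial.X ^ 2 - 1 : Polynomial (RatFunc ℚ))).map_add p q
    exact (congrArg φ e).trans ((map_add φ _ _).trans (((congrArg₂ (· + ·) hp hq)).trans
      ((map_add ψ _ _).symm.trans (congrArg ψ e).symm)))
  | monomial n a =>
    have e : AdjoinRoot.mk (Polynomial.X ^ 2 - 1 : Polynomial (RatFunc ℚ))
        (Polynomial.monomial n a) = ofRat a * piElt ^ n := by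
      rw [← Polynomial.C_mul_X_pow_eq_monomial, map_mul, map_pow]; rfl
    refine (congrArg φ e).trans (Eq.trans ?_ (congrArg ψ e).symm)
    have h1 : φ (ofRat a) = ψ (ofRat a) := RingHom.congr_fun h a
    rw [map_mul, map_mul, map_pow, map_pow, hπ, h1]

theorem piElt_eq : piElt = pv 1 0 := by simp [pv, piU]

theorem ofRat_X_eq : ofRat RatFunc.X = pv 0 1 := by
  rw [pv, zpow_zero, one_mul, zpow_one]; rfl

/-- Bar and dagger act on the monomials π^a v^b by explicit formulas, so identities between their
composites become arithmetic of exponents. -/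
theorem Qvpi.ringHom_ext_pv {S : Type*} [Ring S] {φ ψ : Qvpi →+* S}
    (h : ∀ a b, φ (pv a b) = ψ (pv a b)) : φ = ψ :=
  Qvpi.ringHom_ext (by rw [piElt_eq, h]) (by rw [ofRat_X_eq, h])

theorem barR_barR (c : Qvpi) : barR (barR c) = c := by
  have : barR.comp barR = RingHom.id _ := Qvpi.ringHom_ext_pv fun a b => by
    rw [RingHom.comp_apply, barR_pv, barR_pv, RingHom.id_apply, neg_neg, add_neg_cancel_right]
  exact RingHom.congr_fun this c

theorem dagR_barR (c : Qvpi) : dagR (barR c) = barR (dagR c) := by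
  have : dagR.comp barR = barR.comp dagR := Qvpi.ringHom_ext_pv fun a b => by
    rw [RingHom.comp_apply, RingHom.comp_apply, barR_pv, dagR_pv, dagR_pv, barR_pv]
    exact pv_congr ⟨-b, by ring⟩ rfl
  exact RingHom.congr_fun this c

theorem dagR_dagR (c : Qvpi) : dagR (dagR c) = c := by
  have : dagR.comp dagR = RingHom.id _ := Qvpi.ringHom_ext_pv fun a b => by
    rw [RingHom.comp_apply, dagR_pv, dagR_pv, RingHom.id_apply]
    exact pv_congr ⟨b, by ring⟩ rfl
  exact RingHom.congr_fun this c

theorem pv_mul_neg (a b : ℤ) : pv a b * pv (-a) (-b) = 1 := by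
  rw [pv_mul, add_neg_cancel, add_neg_cancel, pv_zero]

theorem isUnit_pv (a b : ℤ) : IsUnit (pv a b) := Units.isUnit _

theorem pv_pi_neg (a b : ℤ) : pv (-a) b = pv a b := pv_congr ⟨-a, by ring⟩ rfl

/-- An element that scales in the same way by two distinct powers of `v` is zero. -/
theorem eq_zero_of_pv_mul {a b : ℤ} (h : a ≠ b) {t : Qvpi} (ht : pv 0 a * t = pv 0 b * t) :
    t = 0 := by
  have hc : pv 0 (a - b) * t = t := by
    have := congrArg (pv 0 (-b) * ·) ht
    simp only [← mul_assoc, pv_mul, neg_add_cancel, add_zero, pv_zero, one_mul] at this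
    rwa [neg_add_eq_sub] at this
  have h2 : pv 0 ((a - b) + (a - b)) * t = t := by
    have e := pv_mul 0 (a - b) 0 (a - b)
    rw [add_zero] at e
    rw [← e, mul_assoc, hc, hc]
  have h4 : pv 0 (2 * (a - b) + 2 * (a - b)) * t = t := by
    have e := pv_mul 0 (2 * (a - b)) 0 (2 * (a - b))
    rw [add_zero] at e
    rw [← two_mul] at h2
    rw [← e, mul_assoc, h2, h2]
  -- The exponent c = a - b was doubled twice because π drops out of `qd (2 * c)`, which equals
  -- v^(-2c) (v^(4c) - 1).
  have hq : qd (2 * (a - b)) * t = 0 := by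
    have e : qd (2 * (a - b)) =
        pv 0 (-(2 * (a - b))) * (pv 0 (2 * (a - b) + 2 * (a - b)) - 1) := by
      generalize a - b = c
      rw [mul_sub, pv_mul, mul_one, qd]
      congr 1
      exact pv_congr ⟨c, by ring⟩ (by ring)
    rw [e, mul_assoc, sub_mul, h4, one_mul, sub_self, mul_zero]
  exact (isUnit_qd (m := 2 * (a - b)) (by omega)).mul_right_eq_zero.mp hq

/-- The Kronecker symbol with values in `ℚ(v)^π`. -/
def kd {I : Type*} (i j : I) : Qvpi := by classical exact if i = j then 1 else 0

theorem kd_self {I : Type*} (i : I) : kd i i = 1 := if_pos rfl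
theorem kd_ne {I : Type*} {i j : I} (h : i ≠ j) : kd i j = 0 := if_neg h
theorem kd_symm {I : Type*} (i j : I) : kd i j = kd j i := by
  by_cases h : i = j
  · rw [h]
  · rw [kd_ne h, kd_ne (Ne.symm h)]

variable {I X Y : Type*} [AddCommGroup X] [AddCommGroup Y] (D : Datum I X Y)

theorem barR_kd (i j : I) : barR (kd i j) = kd i j := by
  by_cases h : i = j
  · rw [h, kd_self, map_one]
  · rw [kd_ne h, map_zero]
theorem dagR_kd (i j : I) : dagR (kd i j) = kd i j := by
  by_cases h : i = j
  · rw [h, kd_self, map_one]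
  · rw [kd_ne h, map_zero]

/-- Bar-consistency gives p(i)² ≡ d_i mod 2, so the sign in the commutator of E_i and F_i is π_i. -/
theorem Datum.pv_p (i : I) (b : ℤ) : pv (D.p i * D.p i) b = pv (D.d i) b := by
  have h := QCG.pv_p D i
  rw [← add_zero (D.p i * D.p i), ← zero_add b, ← pv_mul, h, pv_mul, add_zero]

theorem Datum.serre_smul {A : Type*} [Ring A] [Algebra Qvpi A] (i j : I) (a b : Qvpi) (x y : A) :
    D.serre i j (a • x) (b • y) = (a ^ D.b i j * b) • D.serre i j x y := by
  unfold Datum.serre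
  rw [Finset.smul_sum]
  refine Finset.sum_congr rfl fun k hk => ?_
  have hk' : k ≤ D.b i j := Nat.lt_succ_iff.mp (Finset.mem_range.mp hk)
  rw [smul_pow, smul_pow, smul_mul_smul_comm, smul_mul_smul_comm, smul_smul, smul_smul]
  congr 1
  have : a ^ D.b i j = a ^ (D.b i j - k) * a ^ k := by rw [← pow_add, Nat.sub_add_cancel hk']
  rw [this]; ring

/-! ### Dilations, left and right skew derivations of 𝐟, and the bar-conjugate form. -/

namespace Half

/-- Induction on the generators of `𝐟`, by left multiplication. -/
theorem left_induction {P : Half D → Prop} (one : P 1)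
    (smul : ∀ (c : Qvpi) (x), P x → P (c • x)) (add : ∀ x y, P x → P y → P (x + y))
    (θ_mul : ∀ i x, P x → P (θ D i * x)) (x : Half D) : P x := by
  obtain ⟨x, rfl⟩ := mk_surjective D x
  induction x using free_left_induction with
  | one => rw [map_one]; exact one
  | smul c x h => rw [map_smul]; exact smul c _ h
  | add x y hx hy => rw [map_add]; exact add _ _ hx hy
  | ι_mul i x h => rw [map_mul]; exact θ_mul i _ h

theorem bar_bar (x : Half D) : bar D (bar D x) = x := by
  induction x using left_induction with
  | one => rw [map_one, map_one]
  | smul c x h => rw [bar_smul, bar_smul, barR_barR, h]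
  | add x y hx hy => rw [map_add, map_add, hx, hy]
  | θ_mul i x h => rw [map_mul, map_mul, bar_θ, bar_θ, h]

theorem deriv_θ_mul_kd (m j : I) (x : Half D) : deriv D m (θ D j * x) =
    twistScalar D m j • (θ D j * deriv D m x) + kd m j • x := deriv_θ_mul D m j x

/-- The automorphism of `𝐟` with `θ_i ↦ c_i θ_i`. -/
def dil (c : I → Qvpi) : Half D →ₐ[Qvpi] Half D :=
  lift D (fun i => c i • θ D i) fun i j h => by
    rw [D.serre_smul, serre_θ D h, smul_zero]

theorem dil_θ (c : I → Qvpi) (i : I) : dil D c (θ D i) = c i • θ D i := lift_θ D _ _ i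

theorem dil_θ_mul (c : I → Qvpi) (i : I) (x : Half D) :
    dil D c (θ D i * x) = c i • (θ D i * dil D c x) := by
  rw [map_mul, dil_θ, smul_mul_assoc]

theorem dil_dil (c c' : I → Qvpi) (x : Half D) :
    dil D c (dil D c' x) = dil D (fun i => c i * c' i) x := by
  induction x using left_induction with
  | one => simp
  | smul c x h => simp only [map_smul, h]
  | add x y hx hy => simp only [map_add, hx, hy]
  | θ_mul i x h => rw [dil_θ_mul, map_smul, dil_θ_mul, dil_θ_mul, h, smul_smul, mul_comm]

theorem dil_one (x : Half D) : dil D (fun _ => 1) x = x := by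
  induction x using left_induction with
  | one => simp
  | smul c x h => simp only [map_smul, h]
  | add x y hx hy => simp only [map_add, hx, hy]
  | θ_mul i x h => rw [dil_θ_mul, h, one_smul]

theorem dil_comm (c c' : I → Qvpi) (x : Half D) :
    dil D c (dil D c' x) = dil D c' (dil D c x) := by
  rw [dil_dil, dil_dil]; simp only [mul_comm]

theorem dil_dil_of_mul_eq_one {c c' : I → Qvpi} (h : ∀ i, c i * c' i = 1) (x : Half D) :
    dil D c (dil D c' x) = x := by
  rw [dil_dil, funext h, dil_one]

/-- The derivation deletes one letter θ_m, and with it the scaling factor of that letter. -/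
theorem deriv_dil (c : I → Qvpi) (m : I) (x : Half D) :
    deriv D m (dil D c x) = c m • dil D c (deriv D m x) := by
  induction x using left_induction with
  | one => simp [deriv_one]
  | smul a x h => simp only [map_smul, h]; rw [smul_comm]
  | add x y hx hy => simp only [map_add, hx, hy, smul_add]
  | θ_mul j x h =>
    rw [dil_θ_mul, map_smul, deriv_θ_mul_kd, deriv_θ_mul_kd, map_add, map_smul, map_smul,
      dil_θ_mul, h]
    by_cases hm : m = j
    · subst hm; simp only [kd_self, mul_smul_comm]
    · simp only [kd_ne hm, mul_smul_comm, zero_smul, add_zero]; module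

theorem counit_dil (c : I → Qvpi) (x : Half D) : counit D (dil D c x) = counit D x := by
  induction x using left_induction with
  | one => simp
  | smul a x h => simp only [map_smul, h]
  | add x y hx hy => simp only [map_add, hx, hy]
  | θ_mul j x h => rw [dil_θ_mul, map_smul, counit_θ_mul, counit_θ_mul, smul_zero]

/-- The skew derivation of `𝐟` conjugate to `_i r` under the bar involution. -/
def derivBar (m : I) : Half D →ₗ[Qvpi] Half D where
  toFun x := bar D (deriv D m (bar D x))
  map_add' x y := by simp
  map_smul' c x := by rw [bar_smul, map_smul, bar_smul, barR_barR]; rfl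

theorem derivBar_apply (m : I) (x : Half D) :
    derivBar D m x = bar D (deriv D m (bar D x)) := rfl

theorem derivBar_one (m : I) : derivBar D m 1 = 0 := by
  rw [derivBar_apply, map_one, deriv_one, map_zero]

/-- The scalar `π ^ (p(i) p(j)) v ^ (i · j)`. -/
def twistBar (i j : I) : Qvpi := pv (D.p i * D.p j) (D.dot i j)

/-- Bar contributes an extra π^(i·j), which is 1 because i·j is even. -/
theorem barR_twistScalar (i j : I) : barR (twistScalar D i j) = twistBar D i j := by
  rw [twistScalar, barR_pv, neg_neg, twistBar]
  exact pv_congr (by simpa using D.even_dot i j) rfl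

theorem derivBar_θ_mul (m j : I) (x : Half D) : derivBar D m (θ D j * x) =
    twistBar D m j • (θ D j * derivBar D m x) + kd m j • x := by
  rw [derivBar_apply, map_mul, bar_θ, deriv_θ_mul_kd, map_add, bar_smul, bar_smul, map_mul, bar_θ,
    barR_twistScalar, barR_kd, bar_bar, derivBar_apply]

theorem derivBar_dil (c : I → Qvpi) (m : I) (x : Half D) :
    derivBar D m (dil D c x) = c m • dil D c (derivBar D m x) := by
  induction x using left_induction with
  | one => simp [derivBar_one]
  | smul a x h => simp only [map_smul, h]; rw [smul_comm]
  | add x y hx hy => simp only [map_add, hx, hy, smul_add]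
  | θ_mul j x h =>
    rw [dil_θ_mul, map_smul, derivBar_θ_mul, derivBar_θ_mul, map_add, map_smul, map_smul,
      dil_θ_mul, h]
    by_cases hm : m = j
    · subst hm; simp only [kd_self, mul_smul_comm]
    · simp only [kd_ne hm, mul_smul_comm, zero_smul, add_zero]; module

/-- The automorphism of `𝐟` with `θ_j ↦ π ^ (p(i) p(j)) v ^ (i · j) θ_j`. -/
abbrev dilBar (i : I) : Half D →ₐ[Qvpi] Half D := dil D (twistBar D i)

theorem twistBar_symm (i j : I) : twistBar D i j = twistBar D j i := by
  rw [twistBar, twistBar, mul_comm, D.dot_symm]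

theorem twistBar_mul_twistScalar (i j : I) : twistBar D i j * twistScalar D i j = 1 := by
  rw [twistBar, twistScalar, pv_mul, add_neg_cancel]
  exact QCG.pv_even ⟨_, rfl⟩

/-- The right skew derivation `r̄_i` of `𝐟`. -/
def rderivBar (m : I) : Half D →ₗ[Qvpi] Half D := (dilBar D m).toLinearMap ∘ₗ deriv D m

theorem rderivBar_apply (m : I) (x : Half D) : rderivBar D m x = dilBar D m (deriv D m x) := rfl

theorem rderivBar_one (m : I) : rderivBar D m 1 = 0 := by
  rw [rderivBar_apply, deriv_one, map_zero]

/-- The dilation scales θ_j by the inverse of the twist in the Leibniz rule for `deriv`. Left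
factors therefore pass without a scalar, and the twist moves into the Kronecker term. -/
theorem rderivBar_θ_mul (m j : I) (x : Half D) : rderivBar D m (θ D j * x) =
    θ D j * rderivBar D m x + kd m j • dilBar D m x := by
  rw [rderivBar_apply, deriv_θ_mul_kd, map_add, map_smul, map_smul, dil_θ_mul, smul_smul, mul_comm,
    twistBar_mul_twistScalar, one_smul, rderivBar_apply]

/-- The Leibniz rule on the other side has the same twist as `derivBar_θ_mul`. This makes
`rderivBar` the mirror image of `derivBar` under reversal. -/
theorem rderivBar_mul_θ (m k : I) (x : Half D) : rderivBar D m (x * θ D k) =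
    twistBar D m k • (rderivBar D m x * θ D k) + kd m k • x := by
  induction x using left_induction with
  | one =>
    have := rderivBar_θ_mul D m k 1
    rw [rderivBar_one, mul_zero, zero_add, map_one, mul_one] at this
    rw [one_mul, this, rderivBar_one, zero_mul, smul_zero, zero_add]
  | smul a x h =>
    simp only [smul_mul_assoc, map_smul, h, smul_add]
    rw [smul_comm a, smul_comm a (kd m k)]
  | add x y hx hy => simp only [add_mul, map_add, hx, hy, smul_add]; abel
  | θ_mul j x h =>
    rw [mul_assoc, rderivBar_θ_mul, h, rderivBar_θ_mul, map_mul, dil_θ]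
    simp only [mul_add, add_mul, mul_smul_comm, smul_mul_assoc, smul_add, mul_assoc]
    module

/-- Deletions from the two ends of a word do not interfere. The only mixed term matches because the
twist is symmetric in its two indices. -/
theorem derivBar_rderivBar (i j : I) (x : Half D) :
    derivBar D i (rderivBar D j x) = rderivBar D j (derivBar D i x) := by
  induction x using left_induction with
  | one => rw [rderivBar_one, derivBar_one, map_zero, map_zero]
  | smul a x h => simp only [map_smul, h]
  | add x y hx hy => simp only [map_add, hx, hy]
  | θ_mul k x h =>
    rw [rderivBar_θ_mul, derivBar_θ_mul, map_add, map_add, map_smul, map_smul, map_smul,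
      derivBar_θ_mul, rderivBar_θ_mul, derivBar_dil, h]
    by_cases hjk : j = k
    · subst hjk
      rw [kd_self, twistBar_symm D i j]; module
    · rw [kd_ne hjk]; module

/-! ### The form conjugate to `(·,·)` under the bar involution -/

theorem form_counit_bar (x : Half D) : barR (counit D (bar D x)) = counit D x := by
  induction x using left_induction with
  | one => simp
  | smul a x h => rw [bar_smul, map_smul, smul_eq_mul, map_mul, barR_barR, h, map_smul, smul_eq_mul]
  | add x y hx hy => simp only [map_add, hx, hy]
  | θ_mul j x h => rw [map_mul, bar_θ, counit_θ_mul, counit_θ_mul, map_zero]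

/-- The bilinear form `(x, y) ↦ \overline{(x̄, ȳ)}` on `𝐟`. -/
def barForm : Half D →ₗ[Qvpi] Half D →ₗ[Qvpi] Qvpi :=
  LinearMap.mk₂ Qvpi (fun x y => barR (form D (bar D x) (bar D y)))
    (fun x x' y => by simp)
    (fun c x y => by
      rw [bar_smul, map_smul, LinearMap.smul_apply, smul_eq_mul, map_mul, barR_barR, smul_eq_mul])
    (fun x y y' => by simp)
    (fun c x y => by rw [bar_smul, map_smul, smul_eq_mul, map_mul, barR_barR, smul_eq_mul])

theorem barForm_apply (x y : Half D) : barForm D x y = barR (form D (bar D x) (bar D y)) := rfl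

theorem barForm_symm (x y : Half D) : barForm D x y = barForm D y x := by
  rw [barForm_apply, form_symm, barForm_apply]

theorem barForm_one_left (y : Half D) : barForm D 1 y = counit D y := by
  rw [barForm_apply, map_one, form_one_left, form_counit_bar]

/-- The number `1 / (1 - π_i v_i ^ (-2)) = π_i v_i / (π_i v_i - v_i⁻¹)`. -/
def barScalar (i : I) : Qvpi := pv (D.d i) (D.d i) * Ring.inverse (qd (D.d i))

theorem one_sub_pv (i : I) : 1 - pv (D.d i) (2 * D.d i) = -pv 0 (D.d i) * qd (D.d i) := by
  rw [qd, neg_mul, mul_sub, pv_mul, pv_mul, zero_add, zero_add, add_neg_cancel, pv_zero, two_mul]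
  ring

/-- Since 1 - π_i v_i² = -v_i (π_i v_i - v_i⁻¹), the scalar can be written through `qd`, whose
behaviour under bar is a mere change of sign. -/
theorem formScalar_eq (i : I) :
    formScalar D i = -(pv 0 (-D.d i) * Ring.inverse (qd (D.d i))) := by
  have hu := isUnit_qd (D.d_ne i)
  have h1 : IsUnit (1 - pv (D.d i) (2 * D.d i)) := by
    rw [one_sub_pv]; exact (isUnit_pv _ _).neg.mul hu
  refine h1.mul_right_cancel ?_
  rw [formScalar, Ring.inverse_mul_cancel _ h1, one_sub_pv]
  have h2 := Ring.inverse_mul_cancel _ hu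
  have h3 := pv_mul_neg 0 (D.d i)
  rw [neg_zero] at h3
  linear_combination -pv 0 (D.d i) * pv 0 (-D.d i) * h2 - h3

theorem barR_formScalar (i : I) : barR (formScalar D i) = barScalar D i := by
  rw [formScalar_eq, map_neg, map_mul, barR_inverse_qd, barR_pv, barScalar]
  rw [zero_add, pv_pi_neg, neg_neg]; ring

theorem barForm_θ_mul (i : I) (x y : Half D) :
    barForm D (θ D i * x) y = barScalar D i * barForm D x (derivBar D i y) := by
  rw [barForm_apply, map_mul, bar_θ, form_θ_mul, map_mul, barR_formScalar, barForm_apply,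
    derivBar_apply, bar_bar]

/-- The counit sees only words of length one here, and for these there is no difference between
deleting from the left and from the right. -/
theorem counit_derivBar (i : I) (y : Half D) :
    counit D (derivBar D i y) = counit D (rderivBar D i y) := by
  induction y using left_induction with
  | one => rw [derivBar_one, rderivBar_one]
  | smul a x h => simp only [map_smul, h]
  | add x y hx hy => simp only [map_add, hx, hy]
  | θ_mul k x h =>
    rw [derivBar_θ_mul, rderivBar_θ_mul, map_add, map_add, map_smul, map_smul, map_smul,
      counit_θ_mul, counit_θ_mul, counit_dil, smul_zero]

/-- The letters of x are stripped from the left by `barForm_θ_mul`. The resulting left derivations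
commute with the right one, and the empty word is `counit_derivBar`. -/
theorem barForm_mul_θ (i : I) (x : Half D) : ∀ y, barForm D (x * θ D i) y =
    barScalar D i * barForm D x (rderivBar D i y) := by
  induction x using left_induction with
  | one =>
    intro y
    have := barForm_θ_mul D i 1 y
    rw [mul_one] at this
    rw [one_mul, this, barForm_one_left, barForm_one_left, counit_derivBar]
  | smul a x h =>
    intro y
    simp only [smul_mul_assoc, map_smul, LinearMap.smul_apply, h, smul_eq_mul]; ring
  | add x y hx hy =>
    intro z
    simp only [add_mul, map_add, LinearMap.add_apply, hx, hy]; ring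
  | θ_mul k x h =>
    intro y
    rw [mul_assoc, barForm_θ_mul, h, barForm_θ_mul, derivBar_rderivBar]; ring

/-- Every θ_i has the same scaling factor on both sides, so each dilation is self-adjoint. This
encodes the orthogonality of different weights of 𝐟, and also supplies the equivariance under the
torus below. -/
theorem barForm_dil (c : I → Qvpi) (x : Half D) : ∀ y, barForm D (dil D c x) y =
    barForm D x (dil D c y) := by
  induction x using left_induction with
  | one => intro y; rw [map_one, barForm_one_left, barForm_one_left, counit_dil]
  | smul a x h => intro y; simp only [map_smul, LinearMap.smul_apply, h]
  | add x y hx hy => intro z; simp only [map_add, LinearMap.add_apply, hx, hy]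
  | θ_mul k x h =>
    intro y
    rw [dil_θ_mul, map_smul, LinearMap.smul_apply, barForm_θ_mul, barForm_θ_mul, h, derivBar_dil,
      map_smul, smul_eq_mul, smul_eq_mul]
    ring

theorem form_dil (c : I → Qvpi) (x : Half D) : ∀ y, form D (dil D c x) y =
    form D x (dil D c y) := by
  induction x using left_induction with
  | one => intro y; rw [map_one, form_one_left, form_one_left, counit_dil]
  | smul a x h => intro y; simp only [map_smul, LinearMap.smul_apply, h]
  | add x y hx hy => intro z; simp only [map_add, LinearMap.add_apply, hx, hy]
  | θ_mul k x h =>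
    intro y
    rw [dil_θ_mul, map_smul, LinearMap.smul_apply, form_θ_mul, form_θ_mul, h, deriv_dil,
      map_smul, smul_eq_mul, smul_eq_mul]
    ring

/-- The anti-automorphism of `𝐟` fixing every `θ_i`, as a homomorphism to the opposite algebra. -/
def revHom : Half D →ₐ[Qvpi] (Half D)ᵐᵒᵖ :=
  lift D (fun i => MulOpposite.op (θ D i)) fun _ _ h => Datum.serre_op D h (serre_θ D h)

/-- The anti-automorphism of `𝐟` fixing every `θ_i`. -/
def rev : Half D →ₗ[Qvpi] Half D :=
  (MulOpposite.opLinearEquiv Qvpi).symm.toLinearMap ∘ₗ (revHom D).toLinearMap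

theorem rev_apply (x : Half D) : rev D x = (revHom D x).unop := rfl

theorem rev_mul (x y : Half D) : rev D (x * y) = rev D y * rev D x := by
  simp only [rev_apply, map_mul, MulOpposite.unop_mul]

theorem rev_one : rev D 1 = 1 := by simp only [rev_apply, map_one, MulOpposite.unop_one]

theorem rev_θ (i : I) : rev D (θ D i) = θ D i := by
  rw [rev_apply, revHom, lift_θ, MulOpposite.unop_op]

theorem rev_θ_mul (i : I) (x : Half D) : rev D (θ D i * x) = rev D x * θ D i := by
  rw [rev_mul, rev_θ]

theorem rev_rev (x : Half D) : rev D (rev D x) = x := by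
  induction x using left_induction with
  | one => rw [rev_one, rev_one]
  | smul a x h => simp only [map_smul, h]
  | add x y hx hy => simp only [map_add, hx, hy]
  | θ_mul k x h => rw [rev_θ_mul, rev_mul, rev_θ, h]

theorem rderivBar_rev (i : I) (x : Half D) :
    rderivBar D i (rev D x) = rev D (derivBar D i x) := by
  induction x using left_induction with
  | one => rw [rev_one, rderivBar_one, derivBar_one, map_zero]
  | smul a x h => simp only [map_smul, h]
  | add x y hx hy => simp only [map_add, hx, hy]
  | θ_mul k x h =>
    rw [rev_θ_mul, rderivBar_mul_θ, derivBar_θ_mul, map_add, map_smul, map_smul, rev_θ_mul, h]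

theorem counit_rev (x : Half D) : counit D (rev D x) = counit D x := by
  induction x using left_induction with
  | one => rw [rev_one]
  | smul a x h => simp only [map_smul, h]
  | add x y hx hy => simp only [map_add, hx, hy]
  | θ_mul k x h => rw [rev_θ_mul, map_mul, map_mul, mul_comm, h]

/-- Reversal exchanges left and right multiplication by θ_i and exchanges their adjoints `derivBar`
and `rderivBar`; both adjunctions carry the same scalar. -/
theorem barForm_rev (x : Half D) : ∀ y, barForm D (rev D x) (rev D y) = barForm D x y := by
  induction x using left_induction with
  | one => intro y; rw [rev_one, barForm_one_left, barForm_one_left, counit_rev]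
  | smul a x h => intro y; simp only [map_smul, LinearMap.smul_apply, h]
  | add x y hx hy => intro z; simp only [map_add, LinearMap.add_apply, hx, hy]
  | θ_mul k x h =>
    intro y
    rw [rev_θ_mul, barForm_mul_θ, rderivBar_rev, h, barForm_θ_mul]

end Half

end QuantumCovering

end

/-! ### Commutation of 𝐔⁻ with the torus and with E_i, and determination of functionals. -/

noncomputable section

namespace QuantumCovering

variable {I X Y : Type*} [AddCommGroup X] [AddCommGroup Y] (D : Datum I X Y)

namespace Half

/-- The automorphism of `𝐟` with `θ_i ↦ v ^ ⟨μ, i'⟩ θ_i`. -/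
abbrev adK (μ : Y) : Half D →ₐ[Qvpi] Half D := dil D fun i => pv 0 (D.pairing μ (D.rootX i))

/-- The automorphism of `𝐟` with `θ_i ↦ π ^ ⟨μ, i'⟩ θ_i`. -/
abbrev adJ (μ : Y) : Half D →ₐ[Qvpi] Half D := dil D fun i => pv (D.pairing μ (D.rootX i)) 0

/-- The automorphism of `𝐟` with `θ_j ↦ π ^ (p(i) p(j)) θ_j`. -/
abbrev par (i : I) : Half D →ₐ[Qvpi] Half D := dil D fun j => pv (D.p i * D.p j) 0

/-- The automorphism of `𝐟` with `θ_j ↦ v ^ (i · j) θ_j`. -/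
abbrev wt (i : I) : Half D →ₐ[Qvpi] Half D := dil D fun j => pv 0 (D.dot i j)

theorem par_par (i : I) (x : Half D) : par D i (par D i x) = x :=
  dil_dil_of_mul_eq_one D (fun _ => by rw [QCG.pv_mul_self]) x

/-- The twist has two sources in 𝐔: the parity factor arises when E_i crosses x⁻, the weight factor
when K̃_i does. -/
theorem dilBar_eq (i : I) (x : Half D) : dilBar D i x = par D i (wt D i x) := by
  rw [dilBar, par, wt, dil_dil]
  simp only [pv_mul, add_zero, zero_add]
  rfl

theorem adK_tilde (i : I) : adK D (D.d i • D.rootY i) = wt D i := by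
  simp only [adK, wt, QCG.pairing_tilde]

end Half

namespace QCG

theorem minus_θ (i : I) : minus D (Half.θ D i) = F D i := Half.lift_θ D _ _ i

theorem minus_θ_mul (i : I) (x : Half D) :
    minus D (Half.θ D i * x) = F D i * minus D x := by rw [map_mul, minus_θ]

theorem F_mul_J (μ : Y) (i : I) :
    F D i * J D μ = pv (D.pairing μ (D.rootX i)) 0 • (J D μ * F D i) := by
  rw [(isRep D).j_f, smul_smul, pv_mul]; simp [pv_zero]

theorem minus_mul_K (μ : Y) (x : Half D) :
    minus D x * K D μ = K D μ * minus D (Half.adK D μ x) := by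
  induction x using Half.left_induction with
  | one => simp
  | smul a x h => simp only [map_smul, smul_mul_assoc, mul_smul_comm, h]
  | add x y hx hy => simp only [map_add, add_mul, mul_add, hx, hy]
  | θ_mul i x h =>
    rw [minus_θ_mul, mul_assoc, h, ← mul_assoc, F_mul_K, Half.dil_θ_mul, map_smul, minus_θ_mul,
      smul_mul_assoc, mul_smul_comm, mul_assoc]

theorem minus_mul_J (μ : Y) (x : Half D) :
    minus D x * J D μ = J D μ * minus D (Half.adJ D μ x) := by
  induction x using Half.left_induction with
  | one => simp
  | smul a x h => simp only [map_smul, smul_mul_assoc, mul_smul_comm, h]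
  | add x y hx hy => simp only [map_add, add_mul, mul_add, hx, hy]
  | θ_mul i x h =>
    rw [minus_θ_mul, mul_assoc, h, ← mul_assoc, F_mul_J, Half.dil_θ_mul, map_smul, minus_θ_mul,
      smul_mul_assoc, mul_smul_comm, mul_assoc]

theorem K_mul_minus (μ : Y) (x : Half D) :
    K D μ * minus D x = minus D (Half.adK D (-μ) x) * K D μ := by
  rw [minus_mul_K, Half.dil_dil_of_mul_eq_one]
  intro i; simp [pv_mul, pv_zero]

theorem J_mul_minus (μ : Y) (x : Half D) :
    J D μ * minus D x = minus D (Half.adJ D (-μ) x) * J D μ := by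
  rw [minus_mul_J, Half.dil_dil_of_mul_eq_one]
  intro i; simp [pv_mul, pv_zero]

theorem E_mul_F (i k : I) : E D i * F D k = pv (D.p i * D.p k) 0 • (F D k * E D i) +
    (kd i k * Ring.inverse (qd (D.d i))) • (Jt D i * Kt D i - Ktinv D i) := by
  by_cases h : i = k
  · subst h
    rw [kd_self, one_mul, ← comm_self, pv_p, add_sub_cancel]
  · rw [kd_ne h, zero_mul, zero_smul, add_zero]
    exact sub_eq_zero.mp (comm_ne D h)

theorem F_mul_Kt (i k : I) : F D k * Kt D i = pv 0 (D.dot i k) • (Kt D i * F D k) := by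
  rw [Kt, F_mul_K, pairing_tilde]

theorem F_mul_Ktinv (i k : I) : F D k * Ktinv D i = pv 0 (-D.dot i k) • (Ktinv D i * F D k) := by
  rw [Ktinv, F_mul_K, map_neg, LinearMap.neg_apply, pairing_tilde]

/-- The commutation of `E_i` with `𝐔⁻`. -/
theorem E_mul_minus (i : I) (x : Half D) : E D i * minus D x =
    minus D (Half.par D i x) * E D i + Ring.inverse (qd (D.d i)) •
      (Jt D i * Kt D i * minus D (Half.derivBar D i x) -
        Ktinv D i * minus D (Half.deriv D i x)) := by
  induction x using Half.left_induction with
  | one => simp [Half.derivBar_one, Half.deriv_one]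
  | smul a x h =>
    simp only [map_smul, smul_mul_assoc, mul_smul_comm, h]; module
  | add x y hx hy => simp only [map_add, add_mul, mul_add, hx, hy]; module
  | θ_mul k x h =>
    rw [minus_θ_mul, ← mul_assoc, E_mul_F, add_mul, smul_mul_assoc, mul_assoc, h,
      Half.derivBar_θ_mul, Half.deriv_θ_mul_kd, Half.dil_θ_mul]
    simp only [map_smul, map_add, minus_θ_mul, mul_add, smul_mul_assoc, sub_mul, mul_smul_comm,
      mul_sub]
    -- Pulling the torus factors to the left of F_k produces v^(±i·k). Together with π^(p(i)p(k))
    -- these are the twists of the two Leibniz rules.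
    have e1 : F D k * (Jt D i * Kt D i * minus D (Half.derivBar D i x)) =
        pv 0 (D.dot i k) • (Jt D i * Kt D i * (F D k * minus D (Half.derivBar D i x))) := by
      rw [← mul_assoc, ← mul_assoc, ← Jt_comm_F, mul_assoc (Jt D i), F_mul_Kt]
      simp only [mul_smul_comm, smul_mul_assoc, mul_assoc]
    have e2 : F D k * (Ktinv D i * minus D (Half.deriv D i x)) =
        pv 0 (-D.dot i k) • (Ktinv D i * (F D k * minus D (Half.deriv D i x))) := by
      rw [← mul_assoc, F_mul_Ktinv]
      simp only [smul_mul_assoc, mul_assoc]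
    rw [e1, e2]
    have e3 : Half.twistBar D i k = pv (D.p i * D.p k) 0 * pv 0 (D.dot i k) := by
      rw [pv_mul, add_zero, zero_add, Half.twistBar]
    have e4 : twistScalar D i k = pv (D.p i * D.p k) 0 * pv 0 (-D.dot i k) := by
      rw [pv_mul, add_zero, zero_add, twistScalar]
    rw [e3, e4]
    simp only [mul_assoc]
    module

theorem minus_mul_E (i : I) (x : Half D) : minus D x * E D i =
    E D i * minus D (Half.par D i x) - Ring.inverse (qd (D.d i)) •
      (Jt D i * Kt D i * minus D (Half.derivBar D i (Half.par D i x)) -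
        Ktinv D i * minus D (Half.deriv D i (Half.par D i x))) := by
  rw [E_mul_minus, Half.par_par, add_sub_cancel_right]

end QCG

/-- The linear map underlying a homomorphism to the opposite algebra. -/
def anti {D : Datum I X Y} (τ : QCG D →ₐ[Qvpi] (QCG D)ᵐᵒᵖ) : QCG D →ₗ[Qvpi] QCG D :=
  (MulOpposite.opLinearEquiv Qvpi).symm.toLinearMap ∘ₗ τ.toLinearMap

section anti
variable {D} (τ : QCG D →ₐ[Qvpi] (QCG D)ᵐᵒᵖ)

theorem anti_apply (u : QCG D) : anti τ u = (τ u).unop := rfl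
theorem anti_mul (u w : QCG D) : anti τ (u * w) = anti τ w * anti τ u := by
  simp only [anti_apply, map_mul, MulOpposite.unop_mul]
theorem anti_one : anti τ 1 = 1 := by simp only [anti_apply, map_one, MulOpposite.unop_one]

end anti

theorem QCG.JK_mul_JK (μ ν μ' ν' : Y) :
    (J D μ * K D ν) * (J D μ' * K D ν') = J D (μ + μ') * K D (ν + ν') := by
  rw [mul_assoc, ← mul_assoc (K D ν), ← J_comm_K, ← J_mul, ← K_mul]; simp only [mul_assoc]

-- The elements τ(x⁻) y⁻ J_μ K_ν span 𝐔, and on them f is a scalar times a value that vanishes. To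
-- see this, a general u is placed to their right and its letters are absorbed one at a time: torus
-- letters join J_μ K_ν, an F_i extends y⁻, and an E_i is moved left across y⁻ and then joins the
-- τ-factor through `hE`.
open QCG in
theorem QCG.functional_eq_zero {τ : QCG D →ₐ[Qvpi] (QCG D)ᵐᵒᵖ}
    (hE : ∀ i, ∃ (c : Qvpi) (μ ν : Y), E D i = c • (anti τ (F D i) * (J D μ * K D ν)))
    {l : X} {f : QCG D →ₗ[Qvpi] Qvpi}
    (hK : ∀ u ν, f (u * K D ν) = pv 0 (D.pairing ν l) * f u)
    (hJ : ∀ u ν, f (u * J D ν) = pv (D.pairing ν l) 0 * f u)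
    (h : ∀ x y, f (anti τ (minus D x) * minus D y) = 0) : f = 0 := by
  have key : ∀ u : QCG D, ∀ x y μ ν,
      f (anti τ (minus D x) * minus D y * (J D μ * K D ν) * u) = 0 := by
    intro u
    induction u using left_induction with
    | one =>
      intro x y μ ν
      rw [mul_one, ← mul_assoc, hK, hJ, h, mul_zero, mul_zero]
    | smul c u hu => intro x y μ ν; rw [mul_smul_comm, map_smul, hu, smul_zero]
    | add u w hu hw => intro x y μ ν; rw [mul_add, map_add, hu, hw, add_zero]
    | hK μ' u hu =>
      intro x y μ ν
      rw [← mul_assoc, mul_assoc _ _ (K D μ'), mul_assoc (J D μ), K_mul]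
      exact hu _ _ _ _
    | hJ μ' u hu =>
      intro x y μ ν
      rw [← mul_assoc, mul_assoc _ _ (J D μ'), mul_assoc (J D μ), ← J_comm_K, ← mul_assoc (J D μ),
        J_mul]
      exact hu _ _ _ _
    | hF i u hu =>
      intro x y μ ν
      have e : J D μ * K D ν * F D i = (pv (-D.pairing μ (D.rootX i)) 0 *
          pv 0 (-D.pairing ν (D.rootX i))) • (F D i * (J D μ * K D ν)) := by
        rw [mul_assoc, (isRep D).k_f, mul_smul_comm, ← mul_assoc, (isRep D).j_f, smul_mul_assoc,
          smul_smul, mul_comm, mul_assoc]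
      rw [← mul_assoc, mul_assoc _ _ (F D i), e, mul_smul_comm, smul_mul_assoc, map_smul,
        ← mul_assoc, mul_assoc (anti τ (minus D x)), ← minus_θ, ← map_mul, hu, smul_zero]
    | hE i u hu =>
      intro x y μ ν
      have e : J D μ * K D ν * E D i = (pv (D.pairing μ (D.rootX i)) 0 *
          pv 0 (D.pairing ν (D.rootX i))) • (E D i * (J D μ * K D ν)) := by
        rw [mul_assoc, (isRep D).k_e, mul_smul_comm, ← mul_assoc, (isRep D).j_e, smul_mul_assoc,
          smul_smul, mul_comm, mul_assoc]
      -- The torus terms left over by `minus_mul_E` lie between the two factors. Pushing them to the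
      -- right only changes z by a dilation, so the induction hypothesis still applies.
      have hJK : ∀ μ' ν' (z : Half D), f (anti τ (minus D x) * (J D μ' * K D ν' * minus D z) *
          (J D μ * K D ν) * u) = 0 := by
        intro μ' ν' z
        rw [mul_assoc (J D μ'), K_mul_minus, ← mul_assoc (J D μ'), J_mul_minus, mul_assoc,
          mul_assoc, mul_assoc (minus D _), mul_assoc (minus D _), ← mul_assoc, mul_assoc (J D μ'),
          ← mul_assoc (K D ν'), ← mul_assoc (J D μ'), ← mul_assoc (J D μ'),
          JK_mul_JK, ← mul_assoc]
        exact hu _ _ _ _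
      rw [← mul_assoc, mul_assoc _ _ (E D i), e, mul_smul_comm, smul_mul_assoc, map_smul,
        ← mul_assoc, mul_assoc (anti τ (minus D x)), minus_mul_E]
      -- Since τ reverses products, τ(x⁻) τ(F_i) = τ((θ_i x)⁻). The remaining torus factor is again
      -- pushed to the right.
      have h1 : f (anti τ (minus D x) * (E D i * minus D (Half.par D i y)) *
          (J D μ * K D ν) * u) = 0 := by
        obtain ⟨c, μ', ν', hc⟩ := hE i
        have := fun z => hu (Half.θ D i * x) z (μ' + μ) (ν' + ν)
        rw [hc, smul_mul_assoc, mul_smul_comm, smul_mul_assoc, smul_mul_assoc, map_smul,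
          mul_assoc (anti τ (F D i)), ← mul_assoc (anti τ (minus D x)), ← anti_mul, ← minus_θ_mul,
          mul_assoc (J D μ'), K_mul_minus, ← mul_assoc (J D μ'), J_mul_minus, mul_assoc,
          mul_assoc, mul_assoc (minus D _), mul_assoc (minus D _), ← mul_assoc, mul_assoc (J D μ'),
          ← mul_assoc (K D ν'), ← mul_assoc (J D μ'), ← mul_assoc (J D μ'),
          JK_mul_JK, ← mul_assoc, this, smul_zero]
      have h2 := hJK (D.d i • D.rootY i) (D.d i • D.rootY i)
        (Half.derivBar D i (Half.par D i y))
      have h3 := hJK 0 (-(D.d i • D.rootY i)) (Half.deriv D i (Half.par D i y))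
      rw [(isRep D).j_zero, one_mul] at h3
      simp only [mul_sub, sub_mul, smul_sub, mul_smul_comm, smul_mul_assoc, map_sub, map_smul]
      rw [h1, Jt, Kt, Ktinv, h2, h3]
      simp
  ext u
  have := key u 1 1 0 0
  simpa [anti_one, (isRep D).j_zero, (isRep D).k_zero] using this

open QCG in
/-- A functional on `𝐔 1_λ` is determined by its values at the elements `τ(x⁻) y⁻ 1_λ`. -/
theorem QCG.functional_ext {τ : QCG D →ₐ[Qvpi] (QCG D)ᵐᵒᵖ}
    (hE : ∀ i, ∃ (c : Qvpi) (μ ν : Y), E D i = c • (anti τ (F D i) * (J D μ * K D ν)))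
    (l : X) {f g : QCG D →ₗ[Qvpi] Qvpi}
    (hK : ∀ u ν, f (u * K D ν) = pv 0 (D.pairing ν l) * f u)
    (hJ : ∀ u ν, f (u * J D ν) = pv (D.pairing ν l) 0 * f u)
    (hK' : ∀ u ν, g (u * K D ν) = pv 0 (D.pairing ν l) * g u)
    (hJ' : ∀ u ν, g (u * J D ν) = pv (D.pairing ν l) 0 * g u)
    (h : ∀ x y, f (anti τ (minus D x) * minus D y) = g (anti τ (minus D x) * minus D y)) :
    f = g := by
  refine sub_eq_zero.mp (QCG.functional_eq_zero D hE (l := l) ?_ ?_ ?_)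
  · intro u ν; rw [LinearMap.sub_apply, hK, hK', LinearMap.sub_apply, mul_sub]
  · intro u ν; rw [LinearMap.sub_apply, hJ, hJ', LinearMap.sub_apply, mul_sub]
  · intro x y; rw [LinearMap.sub_apply, h, sub_self]

end QuantumCovering

end

noncomputable section

namespace QuantumCovering

variable {I X Y : Type*} [AddCommGroup X] [AddCommGroup Y] (D : Datum I X Y)

/-! ### Commutation with the Serre relations -/

section
variable {A : Type*} [Ring A] [Algebra Qvpi A]

/-- The matrix with rows `(c_i t_i, δ_mi)` and `(0, t_i)`. -/
def skewMatrix (c : I → Qvpi) (t : I → A) (m i : I) : Matrix (Fin 2) (Fin 2) A :=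
  !![c i • t i, algebraMap Qvpi A (kd m i); 0, t i]

/-- The skew derivation on noncommutative polynomials determined by `skewMatrix`. -/
def skewDeriv (c : I → Qvpi) (t : I → A) (m : I) : FreeAlgebra Qvpi I →ₗ[Qvpi] A where
  toFun x := FreeAlgebra.lift Qvpi (skewMatrix c t m) x 0 1
  map_add' x y := by simp
  map_smul' c x := by simp

theorem lift_skewMatrix_snd (c : I → Qvpi) (t : I → A) (m : I)
    (x : FreeAlgebra Qvpi I) : FreeAlgebra.lift Qvpi (skewMatrix c t m) x 1 0 = 0 ∧
      FreeAlgebra.lift Qvpi (skewMatrix c t m) x 1 1 = FreeAlgebra.lift Qvpi t x := by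
  induction x using FreeAlgebra.induction with
  | grade0 r => simp [Matrix.algebraMap_matrix_apply]
  | grade1 i => simp [skewMatrix]
  | mul a b ha hb => simp [Matrix.mul_apply, Fin.sum_univ_two, ha, hb]
  | add a b ha hb => simp [ha, hb]

theorem skewDeriv_one (c : I → Qvpi) (t : I → A) (m : I) : skewDeriv c t m 1 = 0 := by
  change FreeAlgebra.lift Qvpi (skewMatrix c t m) 1 0 1 = _
  simp

theorem skewDeriv_ι_mul (c : I → Qvpi) (t : I → A) (m j : I) (x : FreeAlgebra Qvpi I) :
    skewDeriv c t m (FreeAlgebra.ι Qvpi j * x) =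
      c j • (t j * skewDeriv c t m x) + kd m j • FreeAlgebra.lift Qvpi t x := by
  change FreeAlgebra.lift Qvpi (skewMatrix c t m) (FreeAlgebra.ι Qvpi j * x) 0 1 = _
  rw [map_mul, Matrix.mul_apply, Fin.sum_univ_two, FreeAlgebra.lift_ι_apply,
    (lift_skewMatrix_snd c t m x).2]
  simp [skewMatrix, skewDeriv, Algebra.smul_def, mul_assoc]

/-- The conditions on the scalars `c` under which `skewDeriv` vanishes at the Serre relation. -/
structure SerreScalars (c : I → Qvpi) (m : I) : Prop where
  alt : ∀ i, i ≠ m → ∑ k ∈ Finset.range (D.b i m + 1),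
    D.serreCoeff i m k * c i ^ (D.b i m - k) = 0
  step : ∀ j, m ≠ j → ∀ k, k < D.b m j →
    D.serreCoeff m j (k + 1) * (c m ^ (D.b m j - (k + 1)) * c j *
        ∑ s ∈ Finset.range (k + 1), c m ^ s) +
      D.serreCoeff m j k * ∑ s ∈ Finset.range (D.b m j - k), c m ^ s = 0

theorem serreScalars_twistScalar (m : I) : SerreScalars D (twistScalar D m) m where
  alt _ h := serreCoeff_alt D h
  step _ h _ hk := serreCoeff_step D h hk

/-- The Serre coefficients are bar-invariant and bar exchanges the two twists, so these identities
are the bar conjugates of those for `twistScalar`. -/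
theorem serreScalars_twistBar (m : I) : SerreScalars D (Half.twistBar D m) m where
  alt i h := by
    have := congrArg barR (serreCoeff_alt D h)
    simpa only [map_sum, map_mul, map_pow, barR_serreCoeff, Half.barR_twistScalar, map_zero,
      Half.twistBar_symm D m i] using this
  step j h k hk := by
    have := congrArg barR (serreCoeff_step D h hk)
    simpa only [map_sum, map_mul, map_pow, map_add, barR_serreCoeff, Half.barR_twistScalar,
      map_zero] using this

/-- The t_i are arbitrary elements here, not subject to Serre relations: the coefficient of every
word in the derivative is already zero. This permits the use of operators whose Serre relations are
still to be proved. -/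
theorem skewDeriv_serre {c : I → Qvpi} {m : I} (hc : SerreScalars D c m) (t : I → A) {i j : I}
    (h : i ≠ j) :
    skewDeriv c t m (D.serre i j (FreeAlgebra.ι Qvpi i) (FreeAlgebra.ι Qvpi j)) = 0 := by
  change FreeAlgebra.lift Qvpi (skewMatrix c t m) _ 0 1 = 0
  rw [D.map_serre, FreeAlgebra.lift_ι_apply, FreeAlgebra.lift_ι_apply, skewMatrix, skewMatrix,
    Datum.serre]
  simp only [mat_word]
  simp only [Matrix.sum_apply, Matrix.smul_apply, Matrix.of_apply, Matrix.cons_val',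
      Matrix.cons_val_zero, Matrix.cons_val_one,
      smul_add, Finset.sum_add_distrib, smul_smul]
  -- Deleting the single middle letter leaves the same power of t_i in every summand, so the
  -- coefficients collect into the alternating sum `alt`.
  have h3 : ∑ k ∈ Finset.range (D.b i j + 1),
      (D.serreCoeff i j k * (c i ^ (D.b i j - k) * kd m j)) • t i ^ (D.b i j - k + k) = 0 := by
    by_cases hm : m = j
    · subst hm
      rw [← zero_smul Qvpi (t i ^ D.b i m), ← hc.alt i h, Finset.sum_smul]
      refine Finset.sum_congr rfl fun k hk => ?_
      rw [Nat.sub_add_cancel (Nat.lt_succ_iff.mp (Finset.mem_range.mp hk)), kd_self, mul_one]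
    · rw [kd_ne hm]; simp
  rw [h3, add_zero]
  by_cases hm : m = i
  · subst hm
    -- Deleting a t_i to the right of t_j in the word with index k + 1, or to the left of it in the
    -- word with index k, gives the same word. The split-off terms k = 0 and k = b have empty
    -- geometric sums, and the rest cancels in pairs by `step`.
    rw [Finset.sum_range_succ', Finset.sum_range_succ _ (D.b m j)]
    simp only [Finset.range_zero, Finset.sum_empty, mul_zero, zero_mul, zero_smul, add_zero,
      Nat.sub_self]
    rw [← Finset.sum_add_distrib]
    refine Finset.sum_eq_zero fun k hk => ?_
    rw [Nat.add_sub_cancel, Nat.sub_sub, ← add_smul, kd_self, mul_one, mul_one,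
      hc.step j h k (Finset.mem_range.mp hk), zero_smul]
  · rw [kd_ne hm]; simp

variable {e h₁ h₂ : A} {f : I → A} {m : I}

/-- This is the commutation rule `E_mul_minus` for arbitrary elements e, f_j, with h₁ and h₂ in
place of the two torus terms. It is evaluated on the free algebra, where no relation among the f_j
is needed. -/
theorem mul_freeLift
    (hef : ∀ j, e * f j = pv (D.p m * D.p j) 0 • (f j * e) + kd m j • (h₁ + h₂))
    (hf₁ : ∀ j, f j * h₁ = pv 0 (D.dot m j) • (h₁ * f j))
    (hf₂ : ∀ j, f j * h₂ = pv 0 (-D.dot m j) • (h₂ * f j)) (x : FreeAlgebra Qvpi I) :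
    e * FreeAlgebra.lift Qvpi f x =
      FreeAlgebra.lift Qvpi (fun j => pv (D.p m * D.p j) 0 • f j) x * e +
        h₁ * skewDeriv (Half.twistBar D m) f m x + h₂ * skewDeriv (twistScalar D m) f m x := by
  induction x using free_left_induction with
  | one => simp [skewDeriv_one]
  | smul c x h => simp only [map_smul, mul_smul_comm, smul_mul_assoc, h, smul_add]
  | add x y hx hy => simp only [map_add, mul_add, add_mul, hx, hy]; abel
  | ι_mul j x h =>
    have e3 : Half.twistBar D m j = pv (D.p m * D.p j) 0 * pv 0 (D.dot m j) := by
      rw [pv_mul, add_zero, zero_add, Half.twistBar]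
    have e4 : twistScalar D m j = pv (D.p m * D.p j) 0 * pv 0 (-D.dot m j) := by
      rw [pv_mul, add_zero, zero_add, twistScalar]
    rw [map_mul, map_mul, FreeAlgebra.lift_ι_apply, FreeAlgebra.lift_ι_apply, ← mul_assoc, hef,
      add_mul, smul_mul_assoc, mul_assoc, h, skewDeriv_ι_mul, skewDeriv_ι_mul, mul_add, mul_add,
      ← mul_assoc (f j) h₁, ← mul_assoc (f j) h₂, hf₁, hf₂, e3, e4]
    simp only [smul_mul_assoc, mul_smul_comm, mul_add, add_mul, mul_assoc]
    module

/-- Both derivatives of the Serre element vanish, and what remains is the Serre element in rescaled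
letters; it is homogeneous, so the rescaling comes out as a unit. -/
theorem mul_serre
    (hef : ∀ j, e * f j = pv (D.p m * D.p j) 0 • (f j * e) + kd m j • (h₁ + h₂))
    (hf₁ : ∀ j, f j * h₁ = pv 0 (D.dot m j) • (h₁ * f j))
    (hf₂ : ∀ j, f j * h₂ = pv 0 (-D.dot m j) • (h₂ * f j)) {i j : I} (h : i ≠ j) :
    ∃ c : Qvpi, IsUnit c ∧ e * D.serre i j (f i) (f j) = c • (D.serre i j (f i) (f j) * e) := by
  have key := mul_freeLift D hef hf₁ hf₂ (D.serre i j (FreeAlgebra.ι Qvpi i) (FreeAlgebra.ι Qvpi j))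
  rw [skewDeriv_serre D (serreScalars_twistBar D m) f h,
    skewDeriv_serre D (serreScalars_twistScalar D m) f h, mul_zero, mul_zero, add_zero, add_zero,
    D.map_serre, D.map_serre, FreeAlgebra.lift_ι_apply, FreeAlgebra.lift_ι_apply,
    FreeAlgebra.lift_ι_apply, FreeAlgebra.lift_ι_apply, D.serre_smul, smul_mul_assoc] at key
  exact ⟨_, ((isUnit_pv _ _).pow _).mul (isUnit_pv _ _), key⟩

end

/-! ### The induced module `𝐔 1_λ` on `𝐟 ⊗ 𝐟` -/

namespace Half

theorem adK_adK (μ ν : Y) (x : Half D) : adK D μ (adK D ν x) = adK D (μ + ν) x := by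
  rw [adK, adK, dil_dil, adK]; simp only [pv_mul, add_zero, map_add, LinearMap.add_apply]
theorem adJ_adJ (μ ν : Y) (x : Half D) : adJ D μ (adJ D ν x) = adJ D (μ + ν) x := by
  rw [adJ, adJ, dil_dil, adJ]; simp only [pv_mul, add_zero, map_add, LinearMap.add_apply]
theorem adK_zero (x : Half D) : adK D (0 : Y) x = x := by
  have := dil_one D x
  simpa [adK, pv_zero] using this
theorem adJ_zero (x : Half D) : adJ D (0 : Y) x = x := by
  have := dil_one D x
  simpa [adJ, pv_zero] using this
theorem adJ_add_self (ν : Y) (x : Half D) : adJ D (ν + ν) x = x := by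
  rw [← adJ_adJ]
  exact dil_dil_of_mul_eq_one D (fun _ => QCG.pv_mul_self _) x
-- J̃_i scales θ_j by π^(i·j), and i·j is even.
theorem adJ_tilde (i : I) (x : Half D) : adJ D (D.d i • D.rootY i) x = x := by
  have := dil_one D x
  simpa only [adJ, QCG.pairing_tilde, QCG.pv_even (D.even_dot i _)] using this

end Half

open TensorProduct

/-- The space of the module `𝐔 1_λ`. -/
abbrev Model : Type _ := Half D ⊗[Qvpi] Half D

namespace Model
open Half

/-- The action of `𝐔⁺`. -/
def leftHom : Half D →ₐ[Qvpi] Module.End Qvpi (Model D) :=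
  (Module.End.rTensorAlgHom Qvpi (Half D) (Half D)).comp (Algebra.lmul Qvpi (Half D))

theorem leftHom_tmul (z x y : Half D) : leftHom D z (x ⊗ₜ y) = (z * x) ⊗ₜ[Qvpi] y := by
  exact LinearMap.rTensor_tmul _ _ _ _

/-- The action of `E_i`. -/
def e (i : I) : Module.End Qvpi (Model D) := leftHom D (θ D i)

theorem e_tmul (i : I) (x y : Half D) : e D i (x ⊗ₜ y) = (θ D i * x) ⊗ₜ[Qvpi] y :=
  leftHom_tmul D _ x y

variable (l : X)

/-- The action of `K_ν`. -/
def k (ν : Y) : Module.End Qvpi (Model D) :=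
  pv 0 (D.pairing ν l) • TensorProduct.map (adK D ν).toLinearMap (adK D (-ν)).toLinearMap

theorem k_tmul (ν : Y) (x y : Half D) : k D l ν (x ⊗ₜ y) =
    pv 0 (D.pairing ν l) • (adK D ν x ⊗ₜ[Qvpi] adK D (-ν) y) := rfl

/-- The action of `J_ν`. -/
def j (ν : Y) : Module.End Qvpi (Model D) :=
  pv (D.pairing ν l) 0 • TensorProduct.map (adJ D ν).toLinearMap (adJ D (-ν)).toLinearMap

theorem j_tmul (ν : Y) (x y : Half D) : j D l ν (x ⊗ₜ y) =
    pv (D.pairing ν l) 0 • (adJ D ν x ⊗ₜ[Qvpi] adJ D (-ν) y) := rfl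

/-- The number `d_i ⟨i, λ⟩`. -/
def lev (i : I) : ℤ := D.pairing (D.d i • D.rootY i) l

/-- The action of `F_i`. -/
def f (i : I) : Module.End Qvpi (Model D) :=
  TensorProduct.map (par D i).toLinearMap (LinearMap.mulLeft Qvpi (θ D i)) -
    (pv (D.d i + lev D l i) (lev D l i - D.dot i i) * Ring.inverse (qd (D.d i))) •
      TensorProduct.map (deriv D i ∘ₗ (adK D (D.d i • D.rootY i)).toLinearMap)
        (adK D (-(D.d i • D.rootY i))).toLinearMap +
    (pv (D.d i) (D.dot i i - lev D l i) * Ring.inverse (qd (D.d i))) •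
      TensorProduct.map (derivBar D i ∘ₗ (adK D (-(D.d i • D.rootY i))).toLinearMap)
        (adK D (D.d i • D.rootY i)).toLinearMap

theorem f_tmul (i : I) (x y : Half D) : f D l i (x ⊗ₜ y) =
    par D i x ⊗ₜ[Qvpi] (θ D i * y) -
    (pv (D.d i + lev D l i) (lev D l i - D.dot i i) * Ring.inverse (qd (D.d i))) •
      (deriv D i (adK D (D.d i • D.rootY i) x) ⊗ₜ[Qvpi] adK D (-(D.d i • D.rootY i)) y) +
    (pv (D.d i) (D.dot i i - lev D l i) * Ring.inverse (qd (D.d i))) •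
      (derivBar D i (adK D (-(D.d i • D.rootY i)) x) ⊗ₜ[Qvpi] adK D (D.d i • D.rootY i) y) := rfl

theorem end_ext {φ ψ : Module.End Qvpi (Model D)}
    (h : ∀ x y : Half D, φ (x ⊗ₜ y) = ψ (x ⊗ₜ y)) : φ = ψ := TensorProduct.ext' h

theorem k_mul_k (μ ν : Y) : k D l μ * k D l ν = k D l (μ + ν) := end_ext D fun x y => by
  rw [Module.End.mul_apply, k_tmul, map_smul, k_tmul, k_tmul, adK_adK, adK_adK, smul_smul, pv_mul,
    map_add, LinearMap.add_apply, neg_add, add_comm (D.pairing ν l), add_zero]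

theorem j_mul_j (μ ν : Y) : j D l μ * j D l ν = j D l (μ + ν) := end_ext D fun x y => by
  rw [Module.End.mul_apply, j_tmul, map_smul, j_tmul, j_tmul, adJ_adJ, adJ_adJ, smul_smul, pv_mul,
    map_add, LinearMap.add_apply, neg_add, add_comm (D.pairing ν l), add_zero]

theorem j_mul_k (μ ν : Y) : j D l μ * k D l ν = k D l ν * j D l μ := end_ext D fun x y => by
  rw [Module.End.mul_apply, Module.End.mul_apply, k_tmul, j_tmul, map_smul, map_smul, k_tmul,
    j_tmul, dil_comm, dil_comm (D := D) _ _ y, smul_comm]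

theorem k_zero : k D l (0 : Y) = 1 := end_ext D fun x y => by
  rw [k_tmul, neg_zero, adK_zero, adK_zero, map_zero, LinearMap.zero_apply, pv_zero, one_smul]; rfl

theorem j_zero : j D l (0 : Y) = 1 := end_ext D fun x y => by
  rw [j_tmul, neg_zero, adJ_zero, adJ_zero, map_zero, LinearMap.zero_apply, pv_zero, one_smul]; rfl

theorem j_sq (ν : Y) : j D l ν * j D l ν = 1 := end_ext D fun x y => by
  rw [j_mul_j, j_tmul, neg_add, adJ_add_self, adJ_add_self, map_add, LinearMap.add_apply,
    QCG.pv_even ⟨_, rfl⟩, one_smul]; rfl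

theorem k_mul_e (μ : Y) (i : I) :
    k D l μ * e D i = pv 0 (D.pairing μ (D.rootX i)) • (e D i * k D l μ) := end_ext D fun x y => by
  rw [Module.End.mul_apply, LinearMap.smul_apply, Module.End.mul_apply, e_tmul, k_tmul, k_tmul,
    map_smul, e_tmul, dil_θ_mul, ← TensorProduct.smul_tmul', smul_comm]

theorem j_mul_e (μ : Y) (i : I) :
    j D l μ * e D i = pv (D.pairing μ (D.rootX i)) 0 • (e D i * j D l μ) := end_ext D fun x y => by
  rw [Module.End.mul_apply, LinearMap.smul_apply, Module.End.mul_apply, e_tmul, j_tmul, j_tmul,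
    map_smul, e_tmul, dil_θ_mul, ← TensorProduct.smul_tmul', smul_comm]

/-- Diagonal operators commute with `F_i` up to scalars. -/
theorem map_dil_f {c c' : I → Qvpi} {i : I} (h : c' i * c i = 1) (x y : Half D) :
    TensorProduct.map (dil D c).toLinearMap (dil D c').toLinearMap (f D l i (x ⊗ₜ y)) =
      c' i • f D l i (dil D c x ⊗ₜ dil D c' y) := by
  have h1 (z : Half D) : dil D c (deriv D i z) = c' i • deriv D i (dil D c z) := by
    rw [deriv_dil, smul_smul, h, one_smul]
  have h2 (z : Half D) : dil D c (derivBar D i z) = c' i • derivBar D i (dil D c z) := by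
    rw [derivBar_dil, smul_smul, h, one_smul]
  rw [f_tmul, f_tmul, map_add, map_sub, map_smul, map_smul, TensorProduct.map_tmul,
    TensorProduct.map_tmul, TensorProduct.map_tmul]
  simp only [AlgHom.toLinearMap_apply, h1, h2, dil_θ_mul, ← TensorProduct.smul_tmul',
    TensorProduct.tmul_smul]
  rw [dil_comm D c, dil_comm D c, dil_comm D c, dil_comm D c', dil_comm D c']
  module

theorem k_mul_f (μ : Y) (i : I) :
    k D l μ * f D l i = pv 0 (-D.pairing μ (D.rootX i)) • (f D l i * k D l μ) :=
  end_ext D fun x y => by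
  rw [Module.End.mul_apply, LinearMap.smul_apply, Module.End.mul_apply, k_tmul, map_smul, k,
    LinearMap.smul_apply, map_dil_f, smul_comm]
  · change pv 0 (D.pairing (-μ) (D.rootX i)) • pv 0 (D.pairing μ l) •
      f D l i (adK D μ x ⊗ₜ[Qvpi] adK D (-μ) y) = _
    rw [map_neg, LinearMap.neg_apply]
  · simp [pv_mul, pv_zero]

theorem j_mul_f (μ : Y) (i : I) :
    j D l μ * f D l i = pv (-D.pairing μ (D.rootX i)) 0 • (f D l i * j D l μ) :=
  end_ext D fun x y => by
  rw [Module.End.mul_apply, LinearMap.smul_apply, Module.End.mul_apply, j_tmul, map_smul, j,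
    LinearMap.smul_apply, map_dil_f, smul_comm]
  · change pv (D.pairing (-μ) (D.rootX i)) 0 • pv (D.pairing μ l) 0 •
      f D l i (adJ D μ x ⊗ₜ[Qvpi] adJ D (-μ) y) = _
    rw [map_neg, LinearMap.neg_apply]
  · simp [pv_mul, pv_zero]

/-- J̃_i is central in 𝐔, so on a module generated by one weight vector it must be a scalar. -/
theorem j_tilde (i : I) : j D l (D.d i • D.rootY i) = pv (lev D l i) 0 • 1 :=
  end_ext D fun x y => by
  have h : adJ D (-(D.d i • D.rootY i)) y = y := by
    have := adJ_adJ D (-(D.d i • D.rootY i)) (D.d i • D.rootY i) y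
    rwa [adJ_tilde, neg_add_cancel, adJ_zero] at this
  rw [j_tmul, adJ_tilde, h]; rfl

/-- The formula for `f` is what moving F_i to the right through x⁺ in x⁺ y⁻ 1_λ would give. E_i adds
a letter on the left of x. The Leibniz parts agree because the parity sign squares to 1, and the
Kronecker parts are the values of J̃_i K̃_i and K̃_i⁻¹ on x ⊗ y. -/
theorem e_mul_f (i m : I) : e D i * f D l m = pv (D.p i * D.p m) 0 • (f D l m * e D i) +
    kd i m • ((Ring.inverse (qd (D.d i)) • (j D l (D.d i • D.rootY i) * k D l (D.d i • D.rootY i))) +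
      (-Ring.inverse (qd (D.d i))) • k D l (-(D.d i • D.rootY i))) := by
  rw [j_tilde, smul_mul_assoc, one_mul]
  refine end_ext D fun x y => ?_
  have hd1 : deriv D m (adK D (D.d m • D.rootY m) (θ D i * x)) =
      pv (D.p i * D.p m) 0 • (θ D i * deriv D m (adK D (D.d m • D.rootY m) x)) +
      (pv 0 (D.dot m i) * kd i m) • adK D (D.d m • D.rootY m) x := by
    rw [dil_θ_mul, QCG.pairing_tilde, map_smul, deriv_θ_mul_kd, smul_add, smul_smul, smul_smul,
      twistScalar, pv_mul, kd_symm m i, zero_add, add_neg_cancel, mul_comm (D.p i)]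
  have hd2 : derivBar D m (adK D (-(D.d m • D.rootY m)) (θ D i * x)) =
      pv (D.p i * D.p m) 0 • (θ D i * derivBar D m (adK D (-(D.d m • D.rootY m)) x)) +
      (pv 0 (-D.dot m i) * kd i m) • adK D (-(D.d m • D.rootY m)) x := by
    have h1 : D.pairing (-(D.d m • D.rootY m)) (D.rootX i) = -D.dot m i := by
      rw [map_neg, LinearMap.neg_apply, QCG.pairing_tilde]
    rw [dil_θ_mul, h1, map_smul, derivBar_θ_mul,
      smul_add, smul_smul, smul_smul,
      twistBar, pv_mul, kd_symm m i, zero_add, neg_add_cancel, mul_comm (D.p i)]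
  have hpp : pv (D.p i * D.p m) 0 * pv (D.p i * D.p m) 0 = 1 := QCG.pv_mul_self _
  have hk : D.pairing (-(D.d i • D.rootY i)) l = -lev D l i := by
    rw [map_neg, LinearMap.neg_apply, lev]
  have hk' : D.pairing (D.d i • D.rootY i) l = lev D l i := rfl
  rw [Module.End.mul_apply, f_tmul, map_add, map_sub, map_smul, map_smul, e_tmul, e_tmul, e_tmul,
    LinearMap.add_apply, LinearMap.smul_apply, Module.End.mul_apply, e_tmul, f_tmul, hd1, hd2,
    dil_θ_mul, LinearMap.smul_apply, LinearMap.add_apply, LinearMap.smul_apply,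
    LinearMap.smul_apply, LinearMap.smul_apply, k_tmul, k_tmul, neg_neg, hk, hk',
    TensorProduct.add_tmul, TensorProduct.add_tmul, ← TensorProduct.smul_tmul',
    ← TensorProduct.smul_tmul', ← TensorProduct.smul_tmul', ← TensorProduct.smul_tmul',
    ← TensorProduct.smul_tmul', mul_comm (D.p m)]
  generalize (θ D i * par D m x) ⊗ₜ[Qvpi] (θ D m * y) = t₁
  generalize (θ D i * deriv D m (adK D (D.d m • D.rootY m) x)) ⊗ₜ[Qvpi]
    adK D (-(D.d m • D.rootY m)) y = t₂
  generalize (θ D i * derivBar D m (adK D (-(D.d m • D.rootY m)) x)) ⊗ₜ[Qvpi]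
    adK D (D.d m • D.rootY m) y = t₃
  by_cases him : i = m
  · subst him
    generalize adK D (D.d i • D.rootY i) x ⊗ₜ[Qvpi] adK D (-(D.d i • D.rootY i)) y = t₄
    generalize adK D (-(D.d i • D.rootY i)) x ⊗ₜ[Qvpi] adK D (D.d i • D.rootY i) y = t₅
    rw [kd_self]
    -- The two coefficients in `f` are normalised for these identities: after the sign π_i and the
    -- factor v^(±i·i) from the dilation, the eigenvalues on the generating vector remain.
    have e1 : pv (D.p i * D.p i) 0 * (pv (D.d i + lev D l i) (lev D l i - D.dot i i) *
        Ring.inverse (qd (D.d i)) * pv 0 (D.dot i i)) =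
        Ring.inverse (qd (D.d i)) * pv (lev D l i) 0 * pv 0 (lev D l i) := by
      rw [D.pv_p]
      have : pv (D.d i) 0 * pv (D.d i + lev D l i) (lev D l i - D.dot i i) * pv 0 (D.dot i i) =
          pv (lev D l i) 0 * pv 0 (lev D l i) := by
        rw [pv_mul, pv_mul, pv_mul]; exact pv_congr ⟨D.d i, by ring⟩ (by ring)
      linear_combination Ring.inverse (qd (D.d i)) * this
    have e2 : pv (D.p i * D.p i) 0 * (pv (D.d i) (D.dot i i - lev D l i) *
        Ring.inverse (qd (D.d i)) * pv 0 (-D.dot i i)) =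
        Ring.inverse (qd (D.d i)) * pv 0 (-lev D l i) := by
      rw [D.pv_p]
      have : pv (D.d i) 0 * pv (D.d i) (D.dot i i - lev D l i) * pv 0 (-D.dot i i) =
          pv 0 (-lev D l i) := by
        rw [pv_mul, pv_mul]; exact pv_congr ⟨D.d i, by ring⟩ (by ring)
      linear_combination Ring.inverse (qd (D.d i)) * this
    set a := pv (D.d i + lev D l i) (lev D l i - D.dot i i) * Ring.inverse (qd (D.d i))
    set b := pv (D.d i) (D.dot i i - lev D l i) * Ring.inverse (qd (D.d i))
    linear_combination (norm := module) (-hpp) • t₁ + a • hpp • t₂ - b • hpp • t₃ + e1 • t₄ - e2 • t₅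
  · rw [kd_ne him]
    set a := pv (D.d m + lev D l m) (lev D l m - D.dot m m) * Ring.inverse (qd (D.d m))
    set b := pv (D.d m) (D.dot m m - lev D l m) * Ring.inverse (qd (D.d m))
    linear_combination (norm := module) (-hpp) • t₁ + a • hpp • t₂ - b • hpp • t₃

theorem f_one_tmul (i : I) (y : Half D) : f D l i (1 ⊗ₜ y) = 1 ⊗ₜ[Qvpi] (θ D i * y) := by
  have h1 : ∀ ν, adK D ν 1 = 1 := fun ν => map_one _
  rw [f_tmul, h1, h1, map_one, Half.deriv_one, derivBar_one, TensorProduct.zero_tmul,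
    TensorProduct.zero_tmul, smul_zero, smul_zero, sub_zero, add_zero]

theorem lift_f_one_tmul (x : FreeAlgebra Qvpi I) : ∀ y : Half D,
    FreeAlgebra.lift Qvpi (f D l) x (1 ⊗ₜ y) = 1 ⊗ₜ[Qvpi] (mk D x * y) := by
  induction x using free_left_induction with
  | one => intro y; rw [map_one, map_one, one_mul]; rfl
  | smul c x h =>
    intro y; rw [map_smul, map_smul, LinearMap.smul_apply, h, smul_mul_assoc,
      TensorProduct.tmul_smul]
  | add x y hx hy =>
    intro z; rw [map_add, map_add, LinearMap.add_apply, hx, hy, add_mul, TensorProduct.tmul_add]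
  | ι_mul i x h =>
    intro y; rw [map_mul, map_mul, Module.End.mul_apply, h, FreeAlgebra.lift_ι_apply, f_one_tmul,
      mul_assoc]; rfl

/-- On 1 ⊗ y the operators F_i act by left multiplication in 𝐟, so the Serre element kills these
vectors. The operators E_n generate everything from them, and the Serre element commutes with E_n up
to a unit. -/
theorem serre_f {i m : I} (h : i ≠ m) : D.serre i m (f D l i) (f D l m) = 0 := by
  have h1 : ∀ y : Half D, D.serre i m (f D l i) (f D l m) (1 ⊗ₜ y) = 0 := by
    intro y
    have := lift_f_one_tmul D l (D.serre i m (FreeAlgebra.ι Qvpi i) (FreeAlgebra.ι Qvpi m)) y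
    rw [D.map_serre, D.map_serre, FreeAlgebra.lift_ι_apply, FreeAlgebra.lift_ι_apply] at this
    rw [this, show mk D (FreeAlgebra.ι Qvpi i) = θ D i from rfl,
      show mk D (FreeAlgebra.ι Qvpi m) = θ D m from rfl, serre_θ D h, zero_mul,
      TensorProduct.tmul_zero]
  refine end_ext D fun x y => ?_
  induction x using left_induction with
  | one => exact h1 y
  | smul c x hx => rw [← TensorProduct.smul_tmul', map_smul, hx]; simp
  | add x z hx hz => rw [TensorProduct.add_tmul, map_add, hx, hz]; simp
  | θ_mul n x hx =>
    obtain ⟨c, hc, hs⟩ := mul_serre D (e := e D n) (f := f D l) (m := n)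
      (fun k => e_mul_f D l n k)
      (fun k => by
        rw [mul_smul_comm, smul_mul_assoc, j_tilde, smul_mul_assoc, one_mul, mul_smul_comm,
          smul_mul_assoc, k_mul_f, QCG.pairing_tilde, smul_comm (pv 0 (D.dot n k)),
          smul_comm (pv 0 (D.dot n k)), smul_smul (pv 0 (D.dot n k)), pv_mul]
        simp [pv_zero])
      (fun k => by
        rw [mul_smul_comm, smul_mul_assoc, k_mul_f, map_neg, LinearMap.neg_apply,
          QCG.pairing_tilde, smul_comm (pv 0 (-D.dot n k)), smul_smul (pv 0 (-D.dot n k)), pv_mul]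
        simp [pv_zero]) h
    have := LinearMap.congr_fun hs (x ⊗ₜ y)
    rw [Module.End.mul_apply, hx, LinearMap.zero_apply, map_zero, LinearMap.smul_apply,
      Module.End.mul_apply, e_tmul] at this
    rw [LinearMap.zero_apply]
    exact hc.smul_eq_zero.mp this.symm

theorem isRep : IsRep D (e D) (f D l) (k D l) (j D l) where
  j_mul := j_mul_j D l
  k_mul := k_mul_k D l
  k_zero := k_zero D l
  j_zero := j_zero D l
  j_sq := j_sq D l
  j_k := j_mul_k D l
  j_e := j_mul_e D l
  j_f := j_mul_f D l
  k_e := k_mul_e D l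
  k_f := k_mul_f D l
  comm_self i := by
    rw [e_mul_f, kd_self, one_smul, add_sub_cancel_left]; module
  comm_ne i m h := by rw [e_mul_f, kd_ne h, zero_smul, add_zero, sub_self]
  serre_e i m h := by rw [e, e, ← D.map_serre, serre_θ D h, map_zero]
  serre_f _ _ h := serre_f D l h

/-- The action of `𝐔`. -/
def act : QCG D →ₐ[Qvpi] Module.End Qvpi (Model D) := QCG.lift D (isRep D l)

theorem act_E (i : I) : act D l (QCG.E D i) = e D i := QCG.lift_E D _ i
theorem act_F (i : I) : act D l (QCG.F D i) = f D l i := QCG.lift_F D _ i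
theorem act_K (ν : Y) : act D l (QCG.K D ν) = k D l ν := QCG.lift_K D _ ν
theorem act_J (ν : Y) : act D l (QCG.J D ν) = j D l ν := QCG.lift_J D _ ν

theorem act_minus (x : Half D) : ∀ y : Half D,
    act D l (QCG.minus D x) (1 ⊗ₜ y) = 1 ⊗ₜ[Qvpi] (x * y) := by
  induction x using left_induction with
  | one => intro y; rw [map_one, map_one, one_mul]; rfl
  | smul c x h => intro y; simp only [map_smul, LinearMap.smul_apply, h, smul_mul_assoc,
      TensorProduct.tmul_smul]
  | add x y hx hy => intro z; simp only [map_add, LinearMap.add_apply, hx, hy, add_mul,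
      TensorProduct.tmul_add]
  | θ_mul i x h =>
    intro y
    rw [QCG.minus_θ_mul, map_mul, Module.End.mul_apply, h, act_F, f_one_tmul, mul_assoc]

end Model

end QuantumCovering

end

/-! ### Existence: functionals with prescribed values on τ(x⁻) y⁻, and the forms they define. -/

noncomputable section

namespace QuantumCovering

open TensorProduct

variable {I X Y : Type*} [AddCommGroup X] [AddCommGroup Y] (D : Datum I X Y)

/-- An involutive anti-automorphism of `𝐔` that fixes all `K_ν` and `J_ν` and has
`F_i ↦ a_i K̃_i ^ ε E_i` for units `a_i`, with inverses `b_i`. -/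
structure IsDotAnti (τ : QCG D →ₐ[Qvpi] (QCG D)ᵐᵒᵖ) (a b : I → Qvpi) (ε : ℤ) : Prop where
  K : ∀ ν, anti τ (QCG.K D ν) = QCG.K D ν
  J : ∀ ν, anti τ (QCG.J D ν) = QCG.J D ν
  anti_anti : ∀ u, anti τ (anti τ u) = u
  ab : ∀ i, a i * b i = 1
  F : ∀ i, anti τ (QCG.F D i) = a i • (QCG.K D (ε • D.d i • D.rootY i) * QCG.E D i)

theorem Datum.pairing_eps (ε : ℤ) (i m : I) :
    D.pairing (ε • D.d i • D.rootY i) (D.rootX m) = ε * D.dot i m := by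
  rw [map_zsmul, LinearMap.smul_apply, QCG.pairing_tilde, smul_eq_mul]

theorem QCG.K_mul_K_neg (ν : Y) : K D ν * K D (-ν) = 1 := by
  rw [K_mul, add_neg_cancel]; exact (isRep D).k_zero

namespace IsDotAnti
variable {D} {τ : QCG D →ₐ[Qvpi] (QCG D)ᵐᵒᵖ} {a b : I → Qvpi} {ε : ℤ}

theorem exists_E (h : IsDotAnti D τ a b ε) (i : I) : ∃ (c : Qvpi) (μ ν : Y),
    QCG.E D i = c • (anti τ (QCG.F D i) * (QCG.J D μ * QCG.K D ν)) := by
  -- The equation τ(F_i) = a_i K̃_i^ε E_i is solved for E_i, with the torus factor moved to the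
  -- right; this costs v^(-ε i·i).
  refine ⟨b i * pv 0 (-(ε * D.dot i i)), 0, -(ε • D.d i • D.rootY i), ?_⟩
  rw [h.F, (QCG.isRep D).j_zero, one_mul, (QCG.isRep D).k_e, D.pairing_eps, smul_mul_assoc,
    smul_mul_assoc, mul_assoc, QCG.K_mul_K_neg, mul_one, smul_smul, smul_smul]
  have e1 := pv_mul_neg 0 (ε * D.dot i i)
  rw [neg_zero] at e1
  have : b i * pv 0 (-(ε * D.dot i i)) * (a i * pv 0 (ε * D.dot i i)) = 1 := by
    linear_combination a i * b i * e1 + h.ab i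
  rw [← mul_assoc] at this
  rw [this, one_smul]

end IsDotAnti

/-- The homomorphism `𝐟 → 𝐔` with `θ_i ↦ b_i K̃_i ^ (-ε) E_i`. -/
def plusTwist (b : I → Qvpi) (ε : ℤ) : Half D →ₐ[Qvpi] QCG D :=
  Half.lift D (fun i => b i • (QCG.K D (-(ε • D.d i • D.rootY i)) * QCG.E D i)) fun i j h => by
    rw [D.serre_smul, D.serre_qcomm i j (QCG.E_mul_K D _ i) (QCG.E_mul_K D _ i) ?_
      ((QCG.isRep D).serre_e i j h) (QCG.K_comm_K D _ _), smul_zero]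
    rw [QCG.E_mul_K]
    simp only [map_neg, LinearMap.neg_apply, D.pairing_eps, D.dot_symm i j]

theorem plusTwist_θ (b : I → Qvpi) (ε : ℤ) (i : I) : plusTwist D b ε (Half.θ D i) =
    b i • (QCG.K D (-(ε • D.d i • D.rootY i)) * QCG.E D i) := Half.lift_θ D _ _ i

theorem K_mul_plusTwist (b : I → Qvpi) (ε : ℤ) (ν : Y) (x : Half D) :
    QCG.K D ν * plusTwist D b ε x = plusTwist D b ε (Half.adK D ν x) * QCG.K D ν := by
  induction x using Half.left_induction with
  | one => simp
  | smul a x h => simp only [map_smul, smul_mul_assoc, mul_smul_comm, h]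
  | add x y hx hy => simp only [map_add, add_mul, mul_add, hx, hy]
  | θ_mul i x h =>
    have e : QCG.K D ν * plusTwist D b ε (Half.θ D i) =
        pv 0 (D.pairing ν (D.rootX i)) • (plusTwist D b ε (Half.θ D i) * QCG.K D ν) := by
      rw [plusTwist_θ, mul_smul_comm, ← mul_assoc, QCG.K_comm_K, mul_assoc, (QCG.isRep D).k_e]
      simp only [smul_mul_assoc, mul_smul_comm, mul_assoc]
      rw [smul_comm]
    rw [map_mul, ← mul_assoc, e, smul_mul_assoc, mul_assoc, h, Half.dil_θ_mul, map_smul, map_mul,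
      smul_mul_assoc, mul_assoc]

namespace Model
open Half

variable (b : I → Qvpi) (ε : ℤ) (l : X)

/-- The change of coordinates on `𝐔 1_λ` that turns `τ(x⁻) y⁻ 1_λ` into `rev x ⊗ y`. -/
def straighten : Model D →ₗ[Qvpi] Model D :=
  TensorProduct.lift (LinearMap.mk₂ Qvpi (fun x y => act D l (plusTwist D b ε x) (1 ⊗ₜ y))
    (fun x x' y => by simp) (fun c x y => by simp)
    (fun x y y' => by simp [TensorProduct.tmul_add]) (fun c x y => by simp))

theorem straighten_tmul (x y : Half D) : straighten D b ε l (x ⊗ₜ y) =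
    act D l (plusTwist D b ε x) (1 ⊗ₜ y) := rfl

theorem straighten_one_tmul (y : Half D) : straighten D b ε l (1 ⊗ₜ y) = 1 ⊗ₜ y := by
  rw [straighten_tmul, map_one, map_one]; rfl

theorem straighten_e (i : I) (t : Model D) : straighten D b ε l (e D i t) =
    act D l (plusTwist D b ε (θ D i)) (straighten D b ε l t) := by
  induction t using TensorProduct.induction_on with
  | zero => simp
  | tmul x y => rw [e_tmul, straighten_tmul, straighten_tmul, map_mul, map_mul]; rfl
  | add x y hx hy => simp only [map_add, hx, hy]

theorem straighten_k (ν : Y) (t : Model D) : straighten D b ε l (k D l ν t) =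
    k D l ν (straighten D b ε l t) := by
  induction t using TensorProduct.induction_on with
  | zero => simp
  | tmul x y =>
    have h := congrArg (fun u => act D l u (1 ⊗ₜ[Qvpi] y)) (K_mul_plusTwist D b ε ν x)
    simp only [map_mul, Module.End.mul_apply, act_K] at h
    rw [straighten_tmul, h, k_tmul, k_tmul, map_smul, map_smul, straighten_tmul]
    have h1 : adK D ν 1 = 1 := map_one _
    rw [h1]
  | add x y hx hy => simp only [map_add, hx, hy]

variable {D b ε} {τ : QCG D →ₐ[Qvpi] (QCG D)ᵐᵒᵖ} {a : I → Qvpi} (h : IsDotAnti D τ a b ε)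
include h

/-- The change of coordinates commutes with the torus and turns E_i into b_i K̃_i^(-ε) E_i, which
cancels the factor a_i K̃_i^ε in τ(F_i). -/
theorem straighten_anti_F (i : I) (t : Model D) :
    straighten D b ε l (act D l (anti τ (QCG.F D i)) t) = e D i (straighten D b ε l t) := by
  rw [h.F, map_smul, map_mul, LinearMap.smul_apply, Module.End.mul_apply, act_K, act_E, map_smul,
    straighten_k, straighten_e, plusTwist_θ, map_smul, map_mul, act_K, act_E, LinearMap.smul_apply,
    map_smul, smul_smul, h.ab, one_smul, ← Module.End.mul_apply, ← mul_assoc, k_mul_k,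
    add_neg_cancel, k_zero, one_mul]

/-- Each τ(F_i) adds the letter θ_i on the left, and `rev` compensates for the reversal of products
by τ. Thus the values of a functional on these vectors can be prescribed at will, without any
inverse of `straighten`. -/
theorem straighten_anti_minus (x y : Half D) :
    straighten D b ε l (act D l (anti τ (QCG.minus D (rev D x))) (1 ⊗ₜ y)) = x ⊗ₜ y := by
  induction x using left_induction with
  | one => rw [rev_one, map_one, anti_one, map_one, Module.End.one_apply, straighten_one_tmul]
  | smul c x hx => simp only [map_smul, LinearMap.smul_apply, hx, TensorProduct.smul_tmul']
  | add x y hx hy => simp only [map_add, LinearMap.add_apply, hx, hy, TensorProduct.add_tmul]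
  | θ_mul i x hx =>
    rw [rev_θ_mul, map_mul, QCG.minus_θ, anti_mul, map_mul, Module.End.mul_apply,
      straighten_anti_F l h, hx, e_tmul]

end Model

open QCG in
/-- The existence of functionals on `𝐔 1_λ` with given values at the elements `τ(x⁻) y⁻ 1_λ`. -/
theorem exists_functional {τ : QCG D →ₐ[Qvpi] (QCG D)ᵐᵒᵖ} {a b : I → Qvpi} {ε : ℤ}
    (h : IsDotAnti D τ a b ε) (β : Half D →ₗ[Qvpi] Half D →ₗ[Qvpi] Qvpi) (l : X) :
    ∃ φ : QCG D →ₗ[Qvpi] Qvpi, (∀ u ν, φ (u * K D ν) = pv 0 (D.pairing ν l) * φ u) ∧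
      (∀ u ν, φ (u * J D ν) = pv (D.pairing ν l) 0 * φ u) ∧
      ∀ x y, φ (anti τ (minus D x) * minus D y) = β x y := by
  -- The functional applies u to the generating vector 1 ⊗ 1, straightens the result, and evaluates
  -- β after undoing the reversal.
  refine ⟨TensorProduct.lift (β ∘ₗ Half.rev D) ∘ₗ Model.straighten D b ε l ∘ₗ
    LinearMap.applyₗ (1 ⊗ₜ 1) ∘ₗ (Model.act D l).toLinearMap, ?_, ?_, ?_⟩
  · intro u ν
    have e : Model.k D l ν (1 ⊗ₜ[Qvpi] 1) = pv 0 (D.pairing ν l) • (1 ⊗ₜ[Qvpi] 1) := by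
      rw [Model.k_tmul, map_one, map_one]
    simp only [LinearMap.comp_apply, AlgHom.toLinearMap_apply, map_mul, LinearMap.applyₗ_apply_apply,
      Module.End.mul_apply, Model.act_K, e, map_smul, smul_eq_mul]
  · intro u ν
    have e : Model.j D l ν (1 ⊗ₜ[Qvpi] 1) = pv (D.pairing ν l) 0 • (1 ⊗ₜ[Qvpi] 1) := by
      rw [Model.j_tmul, map_one, map_one]
    simp only [LinearMap.comp_apply, AlgHom.toLinearMap_apply, map_mul, LinearMap.applyₗ_apply_apply,
      Module.End.mul_apply, Model.act_J, e, map_smul, smul_eq_mul]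
  · intro x y
    simp only [LinearMap.comp_apply, AlgHom.toLinearMap_apply, map_mul, LinearMap.applyₗ_apply_apply,
      Module.End.mul_apply, Model.act_minus, mul_one]
    have := Model.straighten_anti_minus l h (Half.rev D x) y
    rw [Half.rev_rev] at this
    rw [this, TensorProduct.lift.tmul, LinearMap.comp_apply, Half.rev_rev]

/-! ### Forms on `𝐔̇` -/

namespace Udot

theorem smul_smul_comm (u : QCG D) (c : Qvpi) (w : Udot D) : u • c • w = c • u • w := by
  rw [← algebraMap_smul (QCG D) c, ← algebraMap_smul (QCG D) c, smul_smul, smul_smul,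
    Algebra.commutes]

/-- This reduces condition 1 to homogeneous components of elements u 1_m, on which the torus acts by
a character. -/
theorem one_mul_mul_one (l m : X) (w : Udot D) :
    ∃ u, one D l * w * one D m = of D m (QCG.comp D (l - m) u) := by
  have hadd : ∀ w z : Udot D, one D l * (w + z) * one D m =
      one D l * w * one D m + one D l * z * one D m := by
    intro w z
    change mulHom D (mulHom D _ _) _ = mulHom D (mulHom D _ _) _ + mulHom D (mulHom D _ _) _
    rw [map_add, map_add, LinearMap.add_apply]
  induction w using induction with
  | of η x =>
    rw [one, one, of_mul_of, of_mul_of, one_mul]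
    by_cases h : η - m = 0
    · have : QCG.comp D (η - m) 1 = 1 := by
        change (QCG.grade D 1).coeff _ = 1
        rw [map_one, h, AddMonoidAlgebra.coeff_one_zero]
      rw [this, mul_one, sub_eq_zero.mp h]
      exact ⟨_, rfl⟩
    · rw [QCG.comp_one_of_ne D h, mul_zero, map_zero]
      exact ⟨0, by rw [map_zero, map_zero]⟩
  | add x y hx hy =>
    obtain ⟨u, hu⟩ := hx
    obtain ⟨w, hw⟩ := hy
    exact ⟨u + w, by rw [hadd, hu, hw, map_add, map_add]⟩

theorem K_smul_of_comp (ν : Y) (m γ : X) (u : QCG D) : QCG.K D ν • of D m (QCG.comp D γ u) =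
    pv 0 (D.pairing ν (m + γ)) • of D m (QCG.comp D γ u) := by
  rw [smul_of, QCG.K_mul_comp, map_smul, of_mul_K, smul_smul, pv_mul, map_add, add_zero, add_comm]

end Udot

theorem Datum.exists_pairing_ne {l m : X} (h : l ≠ m) : ∃ ν, D.pairing ν l ≠ D.pairing ν m := by
  by_contra! hc
  exact h (D.perfect.bijective_right.injective (LinearMap.ext hc))

section
variable {τ : QCG D →ₐ[Qvpi] (QCG D)ᵐᵒᵖ} {B : Udot D →ₗ[Qvpi] Udot D →ₗ[Qvpi] Qvpi}

/-- Each K_ν is self-adjoint, so eigenvectors with different eigenvalues are orthogonal. The perfect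
pairing provides a ν that separates l from m. -/
theorem form_eq_zero_of_weight (hτ : ∀ ν, anti τ (QCG.K D ν) = QCG.K D ν)
    (adj : ∀ u x y, B (u • x) y = B x (anti τ u • y)) {x y : Udot D} {l m : X} (h : l ≠ m)
    (hx : ∀ ν, QCG.K D ν • x = pv 0 (D.pairing ν l) • x)
    (hy : ∀ ν, QCG.K D ν • y = pv 0 (D.pairing ν m) • y) : B x y = 0 := by
  obtain ⟨ν, hν⟩ := D.exists_pairing_ne h
  refine eq_zero_of_pv_mul hν ?_
  have := adj (QCG.K D ν) x y
  rwa [hτ, hx, hy, map_smul, LinearMap.smul_apply, map_smul] at this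

/-- Left weights are separated by the adjunction for K_ν, so only the orthogonality of different
right weights has to be supplied. -/
theorem weight_of_diag (hτ : ∀ ν, anti τ (QCG.K D ν) = QCG.K D ν)
    (adj : ∀ u x y, B (u • x) y = B x (anti τ u • y))
    (diag : ∀ l m x y, l ≠ m → B (Udot.of D l x) (Udot.of D m y) = 0)
    (l₁ l₂ m₁ m₂ : X) (x y : Udot D) (h : ¬(l₁ = m₁ ∧ l₂ = m₂)) :
    B (Udot.one D l₁ * x * Udot.one D l₂) (Udot.one D m₁ * y * Udot.one D m₂) = 0 := by
  obtain ⟨u, hu⟩ := Udot.one_mul_mul_one D l₁ l₂ x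
  obtain ⟨w, hw⟩ := Udot.one_mul_mul_one D m₁ m₂ y
  rw [hu, hw]
  by_cases h2 : l₂ = m₂
  · have h1 : l₁ ≠ m₁ := fun h1 => h ⟨h1, h2⟩
    refine form_eq_zero_of_weight D hτ adj h1 (fun ν => ?_) (fun ν => ?_)
    · rw [Udot.K_smul_of_comp, add_sub_cancel]
    · rw [Udot.K_smul_of_comp, add_sub_cancel]
  · exact diag _ _ _ _ h2

end

/-- The functional on `𝐔̇` with `w 1_μ ↦ δ_λμ φ(w)`. -/
def dotFunctional (l : X) (φ : QCG D →ₗ[Qvpi] Qvpi)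
    (hK : ∀ u ν, φ (u * QCG.K D ν) = pv 0 (D.pairing ν l) * φ u)
    (hJ : ∀ u ν, φ (u * QCG.J D ν) = pv (D.pairing ν l) 0 * φ u) : Udot D →ₗ[Qvpi] Qvpi :=
  Udot.lift D (fun m => (kd l m : Qvpi) • φ)
    (fun m u ν => by
      by_cases h : l = m
      · subst h; rw [kd_self, one_smul, hK]; rfl
      · rw [kd_ne h, zero_smul]; simp)
    (fun m u ν => by
      by_cases h : l = m
      · subst h; rw [kd_self, one_smul, hJ]; rfl
      · rw [kd_ne h, zero_smul]; simp)

theorem dotFunctional_of (l : X) (φ : QCG D →ₗ[Qvpi] Qvpi) (hK hJ) (m : X) (w : QCG D) :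
    dotFunctional D l φ hK hJ (Udot.of D m w) = kd l m * φ w :=
  Udot.lift_of D _ _ _ m w

/-- The form is (u 1_λ, w 1_μ) = δ_λμ φ_λ(τ(u) w). The adjunction is automatic because τ reverses
products, and symmetry is the invariance of φ_λ under τ together with τ² = 1. Invariance also
converts right equivariance under the torus into left equivariance, which is what makes the form
well defined in its first argument. -/
theorem exists_dotForm_of_functional {τ : QCG D →ₐ[Qvpi] (QCG D)ᵐᵒᵖ}
    (τK : ∀ ν, anti τ (QCG.K D ν) = QCG.K D ν) (τJ : ∀ ν, anti τ (QCG.J D ν) = QCG.J D ν)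
    (ττ : ∀ u, anti τ (anti τ u) = u) (φ : X → QCG D →ₗ[Qvpi] Qvpi)
    (hK : ∀ l u ν, φ l (u * QCG.K D ν) = pv 0 (D.pairing ν l) * φ l u)
    (hJ : ∀ l u ν, φ l (u * QCG.J D ν) = pv (D.pairing ν l) 0 * φ l u)
    (hτ : ∀ l u, φ l (anti τ u) = φ l u) (β : Half D → Half D → Qvpi)
    (hβ : ∀ l x y, φ l (anti τ (QCG.minus D x) * QCG.minus D y) = β x y) :
    ∃ B, IsDotForm D τ β B := by
  have hK' : ∀ l u ν, φ l (QCG.K D ν * u) = pv 0 (D.pairing ν l) * φ l u := by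
    intro l u ν; rw [← hτ, anti_mul, τK, hK, hτ]
  have hJ' : ∀ l u ν, φ l (QCG.J D ν * u) = pv (D.pairing ν l) 0 * φ l u := by
    intro l u ν; rw [← hτ, anti_mul, τJ, hJ, hτ]
  let ψ : X → Udot D →ₗ[Qvpi] Qvpi := fun l => dotFunctional D l (φ l) (hK l) (hJ l)
  have hψK : ∀ l ν w, ψ l (QCG.K D ν • w) = pv 0 (D.pairing ν l) * ψ l w := by
    intro l ν w
    induction w using Udot.induction with
    | of m x => rw [Udot.smul_of, dotFunctional_of, dotFunctional_of, hK']; ring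
    | add x y hx hy => rw [smul_add, map_add, hx, hy, map_add, mul_add]
  have hψJ : ∀ l ν w, ψ l (QCG.J D ν • w) = pv (D.pairing ν l) 0 * ψ l w := by
    intro l ν w
    induction w using Udot.induction with
    | of m x => rw [Udot.smul_of, dotFunctional_of, dotFunctional_of, hJ']; ring
    | add x y hx hy => rw [smul_add, map_add, hx, hy, map_add, mul_add]
  let B : Udot D →ₗ[Qvpi] Udot D →ₗ[Qvpi] Qvpi := Udot.lift D
    (fun l => LinearMap.mk₂ Qvpi (fun u w => ψ l (anti τ u • w))
      (fun u u' w => by rw [map_add, add_smul, map_add])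
      (fun c u w => by rw [(anti τ).map_smul, smul_assoc, (ψ l).map_smul])
      (fun u w w' => by rw [smul_add, map_add])
      (fun c u w => by rw [Udot.smul_smul_comm, map_smul]))
    (fun l u ν => by
      ext w
      change ψ l (anti τ (u * QCG.K D ν) • w) = pv 0 (D.pairing ν l) * ψ l (anti τ u • w)
      rw [anti_mul, τK, mul_smul, hψK])
    (fun l u ν => by
      ext w
      change ψ l (anti τ (u * QCG.J D ν) • w) = pv (D.pairing ν l) 0 * ψ l (anti τ u • w)
      rw [anti_mul, τJ, mul_smul, hψJ])
  have hB' : ∀ l u w, B (Udot.of D l u) w = ψ l (anti τ u • w) := by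
    intro l u w
    exact LinearMap.congr_fun (Udot.lift_of D _ _ _ l u) w
  have hB : ∀ l m u w, B (Udot.of D l u) (Udot.of D m w) = kd l m * φ l (anti τ u * w) := by
    intro l m u w
    rw [hB', Udot.smul_of, dotFunctional_of]
  have adj : ∀ u x y, B (u • x) y = B x (anti τ u • y) := by
    intro u x y
    induction x using Udot.induction with
    | of m x => rw [Udot.smul_of, hB', hB', anti_mul, mul_smul]
    | add x y hx hy => rw [smul_add, map_add, map_add, LinearMap.add_apply, LinearMap.add_apply, hx, hy]
  refine ⟨B, weight_of_diag D τK adj ?_, adj, ?_, ?_⟩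
  · intro l m x y h; rw [hB, kd_ne h, zero_mul]
  · intro l x y; rw [hB, kd_self, one_mul, hβ]
  · intro x y
    induction x using Udot.induction with
    | of l u =>
      induction y using Udot.induction with
      | of m w =>
        rw [hB, hB]
        by_cases h : l = m
        · subst h
          rw [← hτ, anti_mul, ττ]
        · rw [kd_ne h, kd_ne (Ne.symm h), zero_mul, zero_mul]
      | add x y hx hy => rw [map_add, map_add, LinearMap.add_apply, hx, hy]
    | add x z hx hz => rw [map_add, map_add, LinearMap.add_apply, hx, hz]

-- Only the τ-invariance of φ_λ remains, and on τ(x⁻) y⁻ it is the symmetry of β. To apply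
-- `functional_ext` to φ_λ ∘ τ, left equivariance under the torus is needed beforehand, and this
-- comes from `βdil`.
open QCG in
theorem exists_dotForm {τ : QCG D →ₐ[Qvpi] (QCG D)ᵐᵒᵖ} {a b : I → Qvpi} {ε : ℤ}
    (h : IsDotAnti D τ a b ε) (β : Half D →ₗ[Qvpi] Half D →ₗ[Qvpi] Qvpi)
    (βsymm : ∀ x y, β x y = β y x) (βdil : ∀ c x y, β (Half.dil D c x) y = β x (Half.dil D c y)) :
    ∃ B, IsDotForm D τ (fun x y => β x y) B := by
  choose φ hK hJ hβ using exists_functional D h β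
  have hleft : ∀ l u ν, φ l (K D ν * u) = pv 0 (D.pairing ν l) * φ l u := by
    intro l u ν
    refine LinearMap.congr_fun (f := φ l ∘ₗ LinearMap.mulLeft Qvpi (K D ν))
      (g := pv 0 (D.pairing ν l) • φ l) (functional_ext D h.exists_E l ?_ ?_ ?_ ?_ ?_) u
    · intro u μ
      change φ l (K D ν * (u * K D μ)) = _ * φ l (K D ν * u)
      rw [← mul_assoc, hK]
    · intro u μ
      change φ l (K D ν * (u * J D μ)) = _ * φ l (K D ν * u)
      rw [← mul_assoc, hJ]
    · intro u μ
      change _ * φ l (u * K D μ) = _ * (_ * φ l u)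
      rw [hK]; ring
    · intro u μ
      change _ * φ l (u * J D μ) = _ * (_ * φ l u)
      rw [hJ]; ring
    · intro x y
      change φ l (K D ν * (anti τ (minus D x) * minus D y)) = _ * φ l _
      -- Because τ fixes K_ν, moving K_ν across τ(x⁻) dilates x. Moving it on across y⁻ dilates y
      -- inversely, and the two dilations cancel in β.
      have e : K D ν * anti τ (minus D x) = anti τ (minus D (Half.adK D ν x)) * K D ν := by
        rw [← h.K, ← anti_mul, ← anti_mul, minus_mul_K]
      rw [← mul_assoc, e, mul_assoc, K_mul_minus, ← mul_assoc, hK, hβ, hβ, βdil, Half.adK_adK,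
        add_neg_cancel, Half.adK_zero]
  have hleftJ : ∀ l u ν, φ l (J D ν * u) = pv (D.pairing ν l) 0 * φ l u := by
    intro l u ν
    refine LinearMap.congr_fun (f := φ l ∘ₗ LinearMap.mulLeft Qvpi (J D ν))
      (g := pv (D.pairing ν l) 0 • φ l) (functional_ext D h.exists_E l ?_ ?_ ?_ ?_ ?_) u
    · intro u μ
      change φ l (J D ν * (u * K D μ)) = _ * φ l (J D ν * u)
      rw [← mul_assoc, hK]
    · intro u μ
      change φ l (J D ν * (u * J D μ)) = _ * φ l (J D ν * u)
      rw [← mul_assoc, hJ]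
    · intro u μ
      change _ * φ l (u * K D μ) = _ * (_ * φ l u)
      rw [hK]; ring
    · intro u μ
      change _ * φ l (u * J D μ) = _ * (_ * φ l u)
      rw [hJ]; ring
    · intro x y
      change φ l (J D ν * (anti τ (minus D x) * minus D y)) = _ * φ l _
      have e : J D ν * anti τ (minus D x) = anti τ (minus D (Half.adJ D ν x)) * J D ν := by
        rw [← h.J, ← anti_mul, ← anti_mul, minus_mul_J]
      rw [← mul_assoc, e, mul_assoc, J_mul_minus, ← mul_assoc, hJ, hβ, hβ, βdil, Half.adJ_adJ,
        add_neg_cancel, Half.adJ_zero]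
  refine exists_dotForm_of_functional D h.K h.J h.anti_anti φ hK hJ ?_ _ hβ
  intro l u
  refine LinearMap.congr_fun (f := φ l ∘ₗ anti τ) (functional_ext D h.exists_E l ?_ ?_ (hK l) (hJ l) ?_) u
  · intro u ν
    change φ l (anti τ (u * K D ν)) = _ * φ l (anti τ u)
    rw [anti_mul, h.K, hleft]
  · intro u ν
    change φ l (anti τ (u * J D ν)) = _ * φ l (anti τ u)
    rw [anti_mul, h.J, hleftJ]
  · intro x y
    change φ l (anti τ (anti τ (minus D x) * minus D y)) = _
    rw [anti_mul, h.anti_anti, hβ, hβ, βsymm]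

end QuantumCovering

end

noncomputable section

namespace QuantumCovering

variable {I X Y : Type*} [AddCommGroup X] [AddCommGroup Y] (D : Datum I X Y)

/-! ### Homogeneous elements -/

/-- The homogeneous elements of degree `γ`, generated by homogeneous generators. -/
inductive Homog : X → QCG D → Prop
  | scalar (c : Qvpi) : Homog 0 (algebraMap Qvpi _ c)
  | E (i : I) : Homog (D.rootX i) (QCG.E D i)
  | F (i : I) : Homog (-D.rootX i) (QCG.F D i)
  | K (ν : Y) : Homog 0 (QCG.K D ν)
  | J (ν : Y) : Homog 0 (QCG.J D ν)
  | mul {γ γ' : X} {u u' : QCG D} : Homog γ u → Homog γ' u' → Homog (γ + γ') (u * u')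
  | add {γ : X} {u u' : QCG D} : Homog γ u → Homog γ u' → Homog γ (u + u')

namespace Homog
variable {D} {γ γ' : X} {u : QCG D}

theorem one : Homog D 0 (1 : QCG D) := by
  rw [← map_one (algebraMap Qvpi (QCG D))]; exact scalar 1

theorem smul (c : Qvpi) (h : Homog D γ u) : Homog D γ (c • u) := by
  rw [Algebra.smul_def]
  have := mul (scalar (D := D) c) h
  rwa [zero_add] at this

theorem J_mul (ν : Y) (h : Homog D γ u) : Homog D γ (QCG.J D ν * u) := by
  have := mul (J ν) h
  rwa [zero_add] at this

theorem piJt_mul (i : I) (h : Homog D γ u) : Homog D γ (QCG.piJt D i * u) := by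
  rw [QCG.piJt, smul_mul_assoc]
  exact (h.J_mul _).smul _

theorem grade_eq (h : Homog D γ u) : QCG.grade D u = AddMonoidAlgebra.single γ u := by
  induction h with
  | scalar c => rw [AlgHom.commutes]; rfl
  | E i => exact QCG.lift_E D _ i
  | F i => exact QCG.lift_F D _ i
  | K ν => exact QCG.lift_K D _ ν
  | J ν => exact QCG.lift_J D _ ν
  | mul _ _ h h' => rw [map_mul, h, h', AddMonoidAlgebra.single_mul_single]
  | add _ _ h h' => rw [map_add, h, h', AddMonoidAlgebra.single_add]

theorem comp_eq (h : Homog D γ u) : QCG.comp D γ u = u := by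
  change (QCG.grade D u).coeff γ = u
  rw [h.grade_eq, AddMonoidAlgebra.coeff_single, Finsupp.single_eq_same]

theorem oneMul_eq (h : Homog D γ u) (l : X) : Udot.oneMul D l u = Udot.of D (l - γ) u := by
  change (QCG.grade D u).coeff.sum _ = _
  rw [h.grade_eq, AddMonoidAlgebra.coeff_single, Finsupp.sum_single_index (by simp)]

theorem K_smul (h : Homog D γ u) (ν : Y) (m : X) : QCG.K D ν • Udot.of D m u =
    pv 0 (D.pairing ν (m + γ)) • Udot.of D m u := by
  have := Udot.K_smul_of_comp D ν m γ u
  rwa [h.comp_eq] at this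

theorem one_mul_mul_one (h : Homog D γ u) (m : X) :
    Udot.one D (m + γ) * Udot.of D m u * Udot.one D m = Udot.of D m u := by
  rw [Udot.one, Udot.one, Udot.of_mul_of, Udot.of_mul_of, add_sub_cancel_left, sub_self,
    h.comp_eq, Homog.one.comp_eq, one_mul, mul_one]

/-- `𝐔` is spanned by its homogeneous elements. -/
theorem induction {P : QCG D → Prop} (homog : ∀ γ u, Homog D γ u → P u)
    (add : ∀ u w, P u → P w → P (u + w)) (u : QCG D) : P u := by
  have key : ∀ u, u ∈ AddSubmonoid.closure {u | ∃ γ, Homog D γ u} := by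
    intro u
    have left : ∀ a γ, Homog D γ a → ∀ u ∈ AddSubmonoid.closure {u | ∃ γ, Homog D γ u},
        a * u ∈ AddSubmonoid.closure {u | ∃ γ, Homog D γ u} := by
      intro a γ ha u hu
      induction hu using AddSubmonoid.closure_induction with
      | mem u hu =>
        obtain ⟨γ', hu⟩ := hu
        exact AddSubmonoid.subset_closure ⟨_, ha.mul hu⟩
      | zero => rw [mul_zero]; exact zero_mem _
      | add u w _ _ hu hw => rw [mul_add]; exact add_mem hu hw
    induction u using QCG.left_induction with
    | one => exact AddSubmonoid.subset_closure ⟨_, one⟩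
    | smul c u hu => rw [Algebra.smul_def]; exact left _ _ (scalar c) _ hu
    | add u w hu hw => exact add_mem hu hw
    | hE i u hu => exact left _ _ (E i) _ hu
    | hF i u hu => exact left _ _ (F i) _ hu
    | hK ν u hu => exact left _ _ (K ν) _ hu
    | hJ ν u hu => exact left _ _ (J ν) _ hu
  induction key u using AddSubmonoid.closure_induction with
  | mem u hu => exact hu.elim fun γ hu => homog γ u hu
  | zero => exact homog 0 0 (by rw [← map_zero (algebraMap Qvpi (QCG D))]; exact scalar 0)
  | add u w _ _ hu hw => exact add u w hu hw

end Homog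

/-- Bilinear forms on `𝐔̇` agree if they agree on homogeneous elements. -/
theorem Udot.homog_induction {P : Udot D → Prop} (of : ∀ l γ u, Homog D γ u → P (Udot.of D l u))
    (add : ∀ x y, P x → P y → P (x + y)) (x : Udot D) : P x := by
  induction x using Udot.induction with
  | of l u =>
    induction u using Homog.induction with
    | homog γ u h => exact of l γ u h
    | add u w hu hw => rw [map_add]; exact add _ _ hu hw
  | add x y hx hy => exact add _ _ hx hy

/-! ### Reduction of a form to its functionals, and uniqueness. -/

namespace IsDotForm
variable {D} {τ : QCG D →ₐ[Qvpi] (QCG D)ᵐᵒᵖ} {β : Half D → Half D → Qvpi}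
  {B : Udot D →ₗ[Qvpi] Udot D →ₗ[Qvpi] Qvpi} (h : IsDotForm D τ β B)
include h

/-- A homogeneous u 1_l is unchanged by its left and right idempotents, so condition 1 applies to
it. -/
theorem of_of_of_ne {l m : X} (hlm : l ≠ m) (u w : QCG D) :
    B (Udot.of D l u) (Udot.of D m w) = 0 := by
  induction u using Homog.induction with
  | homog γ u hu =>
    induction w using Homog.induction with
    | homog γ' w hw =>
      rw [← hu.one_mul_mul_one l, ← hw.one_mul_mul_one m]
      exact h.weight _ _ _ _ _ _ fun h => hlm h.2
    | add u w hu hw => rw [map_add, map_add, hu, hw, add_zero]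
  | add u w hu hw => rw [map_add, map_add, LinearMap.add_apply, hu, hw, add_zero]

theorem of_of (l : X) (u w : QCG D) : B (Udot.of D l u) (Udot.of D l w) =
    B (Udot.one D l) (Udot.of D l (anti τ u * w)) := by
  rw [← Udot.smul_of, anti_apply, ← h.adjoint, Udot.one, Udot.smul_of, mul_one]

end IsDotForm

/-- The functional `w ↦ (1_λ, w 1_λ)` on `𝐔`. -/
def oneFunctional {D : Datum I X Y} (B : Udot D →ₗ[Qvpi] Udot D →ₗ[Qvpi] Qvpi) (l : X) :
    QCG D →ₗ[Qvpi] Qvpi := B (Udot.one D l) ∘ₗ Udot.of D l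

section
variable {D}
variable (B : Udot D →ₗ[Qvpi] Udot D →ₗ[Qvpi] Qvpi) (l : X)

theorem oneFunctional_mul_K (u : QCG D) (ν : Y) : oneFunctional B l (u * QCG.K D ν) =
    pv 0 (D.pairing ν l) * oneFunctional B l u := by
  rw [oneFunctional, LinearMap.comp_apply, Udot.of_mul_K, map_smul]; rfl

theorem oneFunctional_mul_J (u : QCG D) (ν : Y) : oneFunctional B l (u * QCG.J D ν) =
    pv (D.pairing ν l) 0 * oneFunctional B l u := by
  rw [oneFunctional, LinearMap.comp_apply, Udot.of_mul_J, map_smul]; rfl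

end

namespace IsDotForm
variable {D} {τ : QCG D →ₐ[Qvpi] (QCG D)ᵐᵒᵖ} {β : Half D → Half D → Qvpi}
  {B B₂ : Udot D →ₗ[Qvpi] Udot D →ₗ[Qvpi] Qvpi} (h : IsDotForm D τ β B)
include h

theorem oneFunctional_minus (l : X) (x y : Half D) :
    oneFunctional B l (anti τ (QCG.minus D x) * QCG.minus D y) = β x y := by
  rw [← h.minus l, h.of_of]; rfl

/-- This is the symmetry of the form on the pair u 1_λ, 1_λ; that τ is an involution is not used. -/
theorem oneFunctional_anti (l : X) (u : QCG D) :
    oneFunctional B l (anti τ u) = oneFunctional B l u := by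
  have h1 := h.of_of l u 1
  have h2 := h.of_of l 1 u
  rw [mul_one] at h1
  rw [anti_one, one_mul] at h2
  exact h1.symm.trans ((h.symm _ _).trans h2)

/-- By `of_of` the form is recovered from its functionals, and these agree on the elements τ(x⁻) y⁻
by condition 3. -/
theorem unique {a b : I → Qvpi} {ε : ℤ} (hτ : IsDotAnti D τ a b ε) (h₂ : IsDotForm D τ β B₂) :
    B = B₂ := by
  have key : ∀ l, oneFunctional B l = oneFunctional B₂ l := fun l =>
    QCG.functional_ext D hτ.exists_E l (oneFunctional_mul_K B l) (oneFunctional_mul_J B l)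
      (oneFunctional_mul_K B₂ l) (oneFunctional_mul_J B₂ l) fun x y => by
        rw [h.oneFunctional_minus, h₂.oneFunctional_minus]
  refine LinearMap.ext₂ fun x y => ?_
  induction x using Udot.induction with
  | of l u =>
    induction y using Udot.induction with
    | of m w =>
      by_cases hlm : l = m
      · subst hlm
        rw [h.of_of, h₂.of_of]
        exact LinearMap.congr_fun (key l) _
      · rw [h.of_of_of_ne hlm, h₂.of_of_of_ne hlm]
    | add x y hx hy => rw [map_add, map_add, hx, hy]
  | add x y hx hy => rw [map_add, map_add, LinearMap.add_apply, LinearMap.add_apply, hx, hy]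

end IsDotForm

/-! ### The anti-automorphisms `τ₁`, `τ₁'` and `τ₁''` -/

/-- The composition of two anti-homomorphisms. -/
def antiComp {D : Datum I X Y} (σ τ : QCG D →ₐ[Qvpi] (QCG D)ᵐᵒᵖ) : QCG D →ₐ[Qvpi] QCG D :=
  AlgHom.ofLinearMap (anti σ ∘ₗ anti τ)
    (by simp only [LinearMap.comp_apply, anti_one])
    (fun u w => by simp only [LinearMap.comp_apply, anti_mul])

theorem antiComp_apply {D : Datum I X Y} (σ τ : QCG D →ₐ[Qvpi] (QCG D)ᵐᵒᵖ) (u : QCG D) :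
    antiComp σ τ u = anti σ (anti τ u) := rfl

namespace QCG

theorem anti_tau1_E (i : I) : anti (tau1 D) (E D i) = pv 0 (-D.d i) • (Ktinv D i * F D i) :=
  (congrArg MulOpposite.unop (lift_E D (tau_isRep D (tauData_tau1 D)) i)).trans
    (smul_mul_assoc _ _ _)
theorem anti_tau1_F (i : I) : anti (tau1 D) (F D i) = pv 0 (-D.d i) • (Kt D i * E D i) :=
  (congrArg MulOpposite.unop (lift_F D (tau_isRep D (tauData_tau1 D)) i)).trans
    (smul_mul_assoc _ _ _)
theorem anti_tau1_K (ν : Y) : anti (tau1 D) (K D ν) = K D ν :=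
  congrArg MulOpposite.unop (lift_K D (tau_isRep D (tauData_tau1 D)) ν)
theorem anti_tau1_J (ν : Y) : anti (tau1 D) (J D ν) = J D ν :=
  congrArg MulOpposite.unop (lift_J D (tau_isRep D (tauData_tau1 D)) ν)

theorem anti_tau1Prime_E (i : I) :
    anti (tau1Prime D) (E D i) = pv 0 (D.d i) • (Kt D i * F D i) :=
  (congrArg MulOpposite.unop (lift_E D (tau_isRep D (tauData_tau1Prime D)) i)).trans
    (smul_mul_assoc _ _ _)
theorem anti_tau1Prime_F (i : I) :
    anti (tau1Prime D) (F D i) = pv 0 (D.d i) • (Ktinv D i * E D i) :=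
  (congrArg MulOpposite.unop (lift_F D (tau_isRep D (tauData_tau1Prime D)) i)).trans
    (smul_mul_assoc _ _ _)
theorem anti_tau1Prime_K (ν : Y) : anti (tau1Prime D) (K D ν) = K D ν :=
  congrArg MulOpposite.unop (lift_K D (tau_isRep D (tauData_tau1Prime D)) ν)
theorem anti_tau1Prime_J (ν : Y) : anti (tau1Prime D) (J D ν) = J D ν :=
  congrArg MulOpposite.unop (lift_J D (tau_isRep D (tauData_tau1Prime D)) ν)

theorem anti_tau1Second_E (i : I) :
    anti (tau1Second D) (E D i) = pv 0 (D.d i) • (piJt D i * (Kt D i * F D i)) := by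
  refine (congrArg MulOpposite.unop (lift_E D (tau_isRep D
    ((tauData_tau1Prime D).mul_central D (piJt D) (piJt_comm D) (piJt_sq D))) i)).trans ?_
  rw [MulOpposite.unop_op, mul_assoc, smul_mul_assoc, mul_smul_comm]
theorem anti_tau1Second_F (i : I) :
    anti (tau1Second D) (F D i) = pv 0 (D.d i) • (piJt D i * (Ktinv D i * E D i)) := by
  refine (congrArg MulOpposite.unop (lift_F D (tau_isRep D
    ((tauData_tau1Prime D).mul_central D (piJt D) (piJt_comm D) (piJt_sq D))) i)).trans ?_
  rw [MulOpposite.unop_op, mul_assoc, smul_mul_assoc, mul_smul_comm]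
theorem anti_tau1Second_K (ν : Y) : anti (tau1Second D) (K D ν) = K D ν :=
  congrArg MulOpposite.unop (lift_K D (tau_isRep D
    ((tauData_tau1Prime D).mul_central D (piJt D) (piJt_comm D) (piJt_sq D))) ν)
theorem anti_tau1Second_J (ν : Y) : anti (tau1Second D) (J D ν) = J D ν :=
  congrArg MulOpposite.unop (lift_J D (tau_isRep D
    ((tauData_tau1Prime D).mul_central D (piJt D) (piJt_comm D) (piJt_sq D))) ν)

theorem anti_rho_E (i : I) : anti (rho D) (E D i) = piJt D i * E D i :=
  congrArg MulOpposite.unop (lift_E D (rho_isRep D) i)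
theorem anti_rho_F (i : I) : anti (rho D) (F D i) = F D i :=
  congrArg MulOpposite.unop (lift_F D (rho_isRep D) i)
theorem anti_rho_K (ν : Y) : anti (rho D) (K D ν) = K D (-ν) :=
  congrArg MulOpposite.unop (lift_K D (rho_isRep D) ν)
theorem anti_rho_J (ν : Y) : anti (rho D) (J D ν) = J D ν :=
  congrArg MulOpposite.unop (lift_J D (rho_isRep D) ν)

theorem omega_E (i : I) : omega D (E D i) = F D i := lift_E D (omega_isRep D) i
theorem omega_F (i : I) : omega D (F D i) = piJt D i * E D i := lift_F D (omega_isRep D) i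
theorem omega_K (ν : Y) : omega D (K D ν) = K D (-ν) := lift_K D (omega_isRep D) ν
theorem omega_J (ν : Y) : omega D (J D ν) = J D ν := lift_J D (omega_isRep D) ν
theorem omega_symm_E (i : I) : (omega D).symm (E D i) = piJt D i * F D i :=
  lift_E D (omegaInv_isRep D) i
theorem omega_symm_F (i : I) : (omega D).symm (F D i) = E D i := lift_F D (omegaInv_isRep D) i
theorem omega_symm_K (ν : Y) : (omega D).symm (K D ν) = K D (-ν) := lift_K D (omegaInv_isRep D) ν
theorem omega_symm_J (ν : Y) : (omega D).symm (J D ν) = J D ν := lift_J D (omegaInv_isRep D) ν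

theorem Kt_mul_Ktinv (i : I) : Kt D i * Ktinv D i = 1 := K_mul_K_neg D _
theorem Ktinv_mul_Kt (i : I) : Ktinv D i * Kt D i = 1 := by
  rw [Ktinv, Kt, K_comm_K]; exact K_mul_K_neg D _
theorem E_mul_Kt (i k : I) : E D k * Kt D i = pv 0 (-D.dot i k) • (Kt D i * E D k) := by
  rw [Kt, E_mul_K, pairing_tilde]
theorem E_mul_Ktinv (i k : I) : E D k * Ktinv D i = pv 0 (D.dot i k) • (Ktinv D i * E D k) := by
  rw [Ktinv, E_mul_K, map_neg, LinearMap.neg_apply, pairing_tilde, neg_neg]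

theorem anti_Kt {τ : QCG D →ₐ[Qvpi] (QCG D)ᵐᵒᵖ} (h : ∀ ν, anti τ (K D ν) = K D ν) (i : I) :
    anti τ (Kt D i) = Kt D i := h _
theorem anti_Ktinv {τ : QCG D →ₐ[Qvpi] (QCG D)ᵐᵒᵖ} (h : ∀ ν, anti τ (K D ν) = K D ν) (i : I) :
    anti τ (Ktinv D i) = Ktinv D i := h _
theorem anti_piJt {τ : QCG D →ₐ[Qvpi] (QCG D)ᵐᵒᵖ} (h : ∀ ν, anti τ (J D ν) = J D ν) (i : I) :
    anti τ (piJt D i) = piJt D i := by rw [piJt, map_smul, Jt, h]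

theorem Kt_mul_Ktinv_mul (i : I) (x : QCG D) : Kt D i * (Ktinv D i * x) = x := by
  rw [← mul_assoc, Kt_mul_Ktinv, one_mul]
theorem Ktinv_mul_Kt_mul (i : I) (x : QCG D) : Ktinv D i * (Kt D i * x) = x := by
  rw [← mul_assoc, Ktinv_mul_Kt, one_mul]
theorem piJt_mul_piJt_mul (i : I) (x : QCG D) : piJt D i * (piJt D i * x) = x := by
  rw [← mul_assoc, piJt_sq, one_mul]

theorem pv_smul_eq_self {b : ℤ} (h : b = 0) (x : QCG D) : pv 0 b • x = x := by
  rw [h, pv_zero, one_smul]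

theorem isDotAnti_tau1 : IsDotAnti D (tau1 D) (fun i => pv 0 (-D.d i)) (fun i => pv 0 (D.d i)) 1 where
  K := anti_tau1_K D
  J := anti_tau1_J D
  anti_anti u := by
    have : antiComp (tau1 D) (tau1 D) = AlgHom.id _ _ := by
      refine hom_ext D (fun i => ?_) (fun i => ?_) (fun ν => ?_) (fun ν => ?_) <;>
        rw [antiComp_apply, AlgHom.id_apply]
      · rw [anti_tau1_E, map_smul, anti_mul, anti_tau1_F, anti_Ktinv D (anti_tau1_K D),
          smul_mul_assoc, mul_assoc, E_mul_Ktinv, mul_smul_comm, Kt_mul_Ktinv_mul, smul_smul,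
          smul_smul, pv_mul, pv_mul, D.dot_self]
        exact pv_smul_eq_self D (by ring) _
      · rw [anti_tau1_F, map_smul, anti_mul, anti_tau1_E, anti_Kt D (anti_tau1_K D),
          smul_mul_assoc, mul_assoc, F_mul_Kt, mul_smul_comm, Ktinv_mul_Kt_mul, smul_smul,
          smul_smul, pv_mul, pv_mul, D.dot_self]
        exact pv_smul_eq_self D (by ring) _
      · rw [anti_tau1_K, anti_tau1_K]
      · rw [anti_tau1_J, anti_tau1_J]
    exact DFunLike.congr_fun this u
  ab i := by rw [pv_mul, neg_add_cancel, add_zero, pv_zero]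
  F i := by rw [one_smul]; exact anti_tau1_F D i

theorem isDotAnti_tau1Prime :
    IsDotAnti D (tau1Prime D) (fun i => pv 0 (D.d i)) (fun i => pv 0 (-D.d i)) (-1) where
  K := anti_tau1Prime_K D
  J := anti_tau1Prime_J D
  anti_anti u := by
    have : antiComp (tau1Prime D) (tau1Prime D) = AlgHom.id _ _ := by
      refine hom_ext D (fun i => ?_) (fun i => ?_) (fun ν => ?_) (fun ν => ?_) <;>
        rw [antiComp_apply, AlgHom.id_apply]
      · rw [anti_tau1Prime_E, map_smul, anti_mul, anti_tau1Prime_F,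
          anti_Kt D (anti_tau1Prime_K D),
          smul_mul_assoc, mul_assoc, E_mul_Kt, mul_smul_comm, Ktinv_mul_Kt_mul, smul_smul,
          smul_smul, pv_mul, pv_mul, D.dot_self]
        exact pv_smul_eq_self D (by ring) _
      · rw [anti_tau1Prime_F, map_smul, anti_mul, anti_tau1Prime_E,
          anti_Ktinv D (anti_tau1Prime_K D),
          smul_mul_assoc, mul_assoc, F_mul_Ktinv, mul_smul_comm, Kt_mul_Ktinv_mul, smul_smul,
          smul_smul, pv_mul, pv_mul, D.dot_self]
        exact pv_smul_eq_self D (by ring) _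
      · rw [anti_tau1Prime_K, anti_tau1Prime_K]
      · rw [anti_tau1Prime_J, anti_tau1Prime_J]
    exact DFunLike.congr_fun this u
  ab i := by rw [pv_mul, add_neg_cancel, add_zero, pv_zero]
  F i := by rw [neg_one_zsmul]; exact anti_tau1Prime_F D i

/-- `τ₁''` is an involution. -/
theorem anti_tau1Second_anti (u : QCG D) : anti (tau1Second D) (anti (tau1Second D) u) = u := by
  have : antiComp (tau1Second D) (tau1Second D) = AlgHom.id _ _ := by
    refine hom_ext D (fun i => ?_) (fun i => ?_) (fun ν => ?_) (fun ν => ?_) <;>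
      rw [antiComp_apply, AlgHom.id_apply]
    · rw [anti_tau1Second_E, map_smul, anti_mul, anti_mul, anti_tau1Second_F,
        anti_Kt D (anti_tau1Second_K D), anti_piJt D (anti_tau1Second_J D), ← piJt_comm,
        smul_mul_assoc, mul_smul_comm, mul_assoc, piJt_mul_piJt_mul, mul_assoc, E_mul_Kt,
        mul_smul_comm, Ktinv_mul_Kt_mul, smul_smul, smul_smul, pv_mul, pv_mul, D.dot_self]
      exact pv_smul_eq_self D (by ring) _
    · rw [anti_tau1Second_F, map_smul, anti_mul, anti_mul, anti_tau1Second_E,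
        anti_Ktinv D (anti_tau1Second_K D), anti_piJt D (anti_tau1Second_J D), ← piJt_comm,
        smul_mul_assoc, mul_smul_comm, mul_assoc, piJt_mul_piJt_mul, mul_assoc, F_mul_Ktinv,
        mul_smul_comm, Kt_mul_Ktinv_mul, smul_smul, smul_smul, pv_mul, pv_mul, D.dot_self]
      exact pv_smul_eq_self D (by ring) _
    · rw [anti_tau1Second_K, anti_tau1Second_K]
    · rw [anti_tau1Second_J, anti_tau1Second_J]
  exact DFunLike.congr_fun this u

/-- `E_i` in terms of `τ₁''(F_i)`. -/
theorem E_eq_tau1Second (i : I) : E D i = (pv (D.d i) (D.dot i i - D.d i)) •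
    (anti (tau1Second D) (F D i) * (J D (D.d i • D.rootY i) * K D (D.d i • D.rootY i))) := by
  have e1 : E D i * (Jt D i * Kt D i) = pv 0 (-D.dot i i) • (Jt D i * (Kt D i * E D i)) := by
    rw [← mul_assoc, ← Jt_comm_E, mul_assoc, E_mul_Kt, mul_smul_comm]
  have e2 : Ktinv D i * (Jt D i * (Kt D i * E D i)) = Jt D i * E D i := by
    rw [← mul_assoc, Ktinv, Jt, ← J_comm_K, mul_assoc]
    change _ * (Ktinv D i * _) = _
    rw [Ktinv_mul_Kt_mul]
  change _ = _ • (_ * (Jt D i * Kt D i))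
  rw [anti_tau1Second_F, smul_mul_assoc, mul_assoc, mul_assoc, e1, mul_smul_comm, e2,
    mul_smul_comm, piJt_mul_Jt, smul_smul, smul_smul, smul_smul, pv_mul, pv_mul, pv_mul,
    pv_congr (a' := 0) (b' := 0) ⟨D.d i, by ring⟩ (by rw [D.dot_self]; ring), pv_zero, one_smul]

/-- The factor J̃_i in τ₁''(F_i) does not fit the shape required by `IsDotAnti`, but this statement
is all that `functional_ext` needs. -/
theorem exists_E_tau1Second (i : I) : ∃ (c : Qvpi) (μ ν : Y),
    E D i = c • (anti (tau1Second D) (F D i) * (J D μ * K D ν)) :=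
  ⟨_, _, _, E_eq_tau1Second D i⟩

end QCG

theorem existsUnique_dotForm_tau1Prime : ∃! B' : Udot D →ₗ[Qvpi] Udot D →ₗ[Qvpi] Qvpi,
    IsDotForm D (QCG.tau1Prime D)
      (fun x y => barR (Half.form D (Half.bar D x) (Half.bar D y))) B' := by
  obtain ⟨B, hB⟩ := exists_dotForm D (QCG.isDotAnti_tau1Prime D) (Half.barForm D)
    (Half.barForm_symm D) (Half.barForm_dil D)
  exact ⟨B, hB, fun B₂ h₂ => IsDotForm.unique h₂ (QCG.isDotAnti_tau1Prime D) hB⟩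

theorem exists_dotForm_tau1 : ∃ B : Udot D →ₗ[Qvpi] Udot D →ₗ[Qvpi] Qvpi,
    IsDotForm D (QCG.tau1 D) (fun x y => Half.form D x y) B :=
  exists_dotForm D (QCG.isDotAnti_tau1 D) (Half.form D) (Half.form_symm D) (Half.form_dil D)

end QuantumCovering

end

/-! ### Bar followed by dagger, and the transported form. -/

noncomputable section

namespace QuantumCovering

variable {I X Y : Type*} [AddCommGroup X] [AddCommGroup Y] (D : Datum I X Y)

namespace Half

/-- The involution `†` of `𝐟` as a homomorphism of algebras into a twist. -/
def daggerHom : Half D →ₐ[Qvpi] Twist dagR (Half D) :=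
  lift D (A := Twist dagR (Half D)) (θ D) (fun i j h => by
    rw [D.serre_twist dagR (dagR_serreCoeff D h), serre_θ D h]; rfl)

/-- The involution `†` of `𝐟`, with `θ_i ↦ θ_i` and `v ↦ π v`. -/
def dagger : Half D →+* Half D := (daggerHom D).toRingHom

theorem dagger_θ (i : I) : dagger D (θ D i) = θ D i :=
  lift_θ D (A := Twist dagR (Half D)) _ _ i

theorem dagger_smul (c : Qvpi) (x : Half D) : dagger D (c • x) = dagR c • dagger D x :=
  map_smul (daggerHom D) c x

theorem dagR_twistScalar (i j : I) : dagR (twistScalar D i j) = twistScalar D i j := by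
  rw [twistScalar, dagR_pv]
  exact pv_congr (by simpa using D.even_dot i j) rfl

theorem dagR_formScalar (i : I) : dagR (formScalar D i) = formScalar D i := by
  have h1 : IsUnit (1 - pv (D.d i) (2 * D.d i)) := by
    rw [one_sub_pv]; exact (isUnit_pv _ _).neg.mul (isUnit_qd (D.d_ne i))
  rw [formScalar, map_inverse_of_isUnit _ h1, map_sub, map_one, dagR_pv,
    pv_congr (a' := D.d i) ⟨D.d i, by ring⟩ rfl]

theorem deriv_dagger (m : I) (x : Half D) :
    deriv D m (dagger D x) = dagger D (deriv D m x) := by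
  induction x using left_induction with
  | one => rw [map_one, deriv_one, map_zero]
  | smul c x h => rw [dagger_smul, map_smul, map_smul, dagger_smul, h]
  | add x y hx hy => simp only [map_add, hx, hy]
  | θ_mul i x h =>
    rw [map_mul, dagger_θ, deriv_θ_mul_kd, deriv_θ_mul_kd, h, map_add, dagger_smul, dagger_smul,
      map_mul, dagger_θ, dagR_twistScalar, dagR_kd]

theorem counit_dagger (x : Half D) : dagR (counit D (dagger D x)) = counit D x := by
  induction x using left_induction with
  | one => simp
  | smul a x h =>
    rw [dagger_smul, map_smul, smul_eq_mul, map_mul, dagR_dagR, h, map_smul, smul_eq_mul]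
  | add x y hx hy => simp only [map_add, hx, hy]
  | θ_mul j x h => rw [map_mul, dagger_θ, counit_θ_mul, counit_θ_mul, map_zero]

/-- The form is built from the twists and the numbers (θ_i, θ_i). These contain only even powers of
v, which † fixes. -/
theorem form_dagger (x : Half D) : ∀ y, dagR (form D (dagger D x) (dagger D y)) = form D x y := by
  induction x using left_induction with
  | one => intro y; rw [map_one, form_one_left, form_one_left, counit_dagger]
  | smul c x h =>
    intro y
    rw [dagger_smul, map_smul, map_smul, LinearMap.smul_apply, LinearMap.smul_apply, smul_eq_mul,
      map_mul, dagR_dagR, h, smul_eq_mul]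
  | add x z hx hz => intro y; simp only [map_add, LinearMap.add_apply, hx, hz]
  | θ_mul i x h =>
    intro y
    rw [map_mul, dagger_θ, form_θ_mul, form_θ_mul, map_mul, dagR_formScalar, deriv_dagger, h]

end Half

namespace QCG

/-- The composition of `†` and the bar involution on `𝐔`. -/
def dagBar : QCG D →+* QCG D := (dagger D).comp (bar D)

theorem dagBar_smul (c : Qvpi) (u : QCG D) :
    dagBar D (c • u) = dagR (barR c) • dagBar D u := by
  change dagger D (bar D _) = _
  rw [bar_smul, dagger_smul]; rfl

theorem dagBar_E (i : I) : dagBar D (E D i) = piJt D i * E D i := by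
  change dagger D (bar D _) = _
  rw [bar_E, dagger_E]

theorem dagBar_F (i : I) : dagBar D (F D i) = F D i := by
  change dagger D (bar D _) = _
  rw [bar_F, dagger_F]

theorem dagBar_K (ν : Y) : dagBar D (K D ν) = K D (-ν) := by
  change dagger D (bar D _) = _
  rw [bar_K, map_mul, dagger_J, dagger_K, J_neg, ← mul_assoc, J_sq, one_mul]

theorem dagBar_J (ν : Y) : dagBar D (J D ν) = J D ν := by
  change dagger D (bar D _) = _
  rw [bar_J, dagger_J]

theorem dagBar_Kt (i : I) : dagBar D (Kt D i) = Ktinv D i := dagBar_K D _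
theorem dagBar_Ktinv (i : I) : dagBar D (Ktinv D i) = Kt D i := by
  rw [Ktinv, dagBar_K, neg_neg]; rfl
theorem dagBar_piJt (i : I) : dagBar D (piJt D i) = piJt D i := by
  rw [piJt, dagBar_smul, barR_pv, dagR_pv, Jt, dagBar_J]; simp

/-- Bar sends v to π v⁻¹, and † sends this to π (π v)⁻¹ = v⁻¹: the two signs cancel. In the same way
J_ν disappears from the image of K_ν. -/
theorem dagBar_pv_zero (b : ℤ) : dagR (barR (pv 0 b)) = pv 0 (-b) := by
  rw [barR_pv, dagR_pv, zero_add, add_neg_cancel]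

theorem dagBar_minus (x : Half D) :
    dagBar D (minus D x) = minus D (Half.dagger D (Half.bar D x)) := by
  induction x using Half.left_induction with
  | one => simp only [map_one]
  | smul c x h => rw [map_smul, dagBar_smul, h, Half.bar_smul, Half.dagger_smul, map_smul]
  | add x y hx hy => simp only [map_add, hx, hy]
  | θ_mul i x h =>
    rw [minus_θ_mul, map_mul, map_mul, map_mul, dagBar_F, h, Half.bar_θ, Half.dagger_θ,
      minus_θ_mul]

/-- The composite inverts v and K̃_i, and multiplies E_i by π_i J̃_i. The latter is exactly the
extra factor in τ₁''. -/
theorem anti_tau1_dagBar (u : QCG D) :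
    anti (tau1 D) (dagBar D u) = dagBar D (anti (tau1Second D) u) := by
  induction u using QCG.induction with
  | scalar c =>
    rw [Algebra.algebraMap_eq_smul_one, dagBar_smul, map_smul, map_smul, dagBar_smul, map_one,
      anti_one, anti_one, map_one]
  | hE i =>
    rw [dagBar_E, anti_mul, anti_piJt D (anti_tau1_J D), anti_tau1_E, anti_tau1Second_E,
      dagBar_smul, map_mul, map_mul, dagBar_piJt, dagBar_Kt, dagBar_F, dagBar_pv_zero,
      ← piJt_comm, mul_smul_comm]
  | hF i =>
    rw [dagBar_F, anti_tau1_F, anti_tau1Second_F, dagBar_smul, map_mul, map_mul, dagBar_piJt,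
      dagBar_Ktinv, dagBar_E, dagBar_pv_zero, ← mul_assoc (Kt D i), ← piJt_comm, mul_assoc,
      piJt_mul_piJt_mul]
  | hK ν => rw [dagBar_K, anti_tau1_K, anti_tau1Second_K, dagBar_K]
  | hJ ν => rw [dagBar_J, anti_tau1_J, anti_tau1Second_J, dagBar_J]
  | mul u w hu hw => rw [map_mul, anti_mul, hu, hw, anti_mul, map_mul]
  | add u w hu hw => rw [map_add, map_add, hu, hw, map_add, map_add]

end QCG

namespace Udot

/-- The composition of `†` and the bar involution on `𝐔̇`. -/
def dagBar : Udot D →+ Udot D := (dagger D).comp (bar D)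

theorem dagBar_of (l : X) (u : QCG D) : dagBar D (of D l u) = of D l (QCG.dagBar D u) := by
  change dagger D (bar D _) = _
  rw [bar, map_of, dagger, map_of]; rfl

theorem dagBar_smul (u : QCG D) (w : Udot D) : dagBar D (u • w) = QCG.dagBar D u • dagBar D w := by
  induction w using Udot.induction with
  | of l x => rw [smul_of, dagBar_of, map_mul, dagBar_of, smul_of]
  | add x y hx hy => rw [smul_add, map_add, hx, hy, map_add, smul_add]

theorem dagBar_scalar_smul (c : Qvpi) (w : Udot D) :
    dagBar D (c • w) = dagR (barR c) • dagBar D w := by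
  rw [← one_smul (QCG D) w, ← smul_assoc, dagBar_smul, QCG.dagBar_smul, map_one, smul_assoc,
    one_smul, one_smul]

end Udot

theorem dagR_barR_dagR_barR (c : Qvpi) : dagR (barR (dagR (barR c))) = c := by
  rw [dagR_barR c, barR_barR, dagR_dagR]

/-- The form `(x, y)' = \overline{(x̄†, ȳ†)}†` on `𝐔̇`. -/
def twistForm (B : Udot D →ₗ[Qvpi] Udot D →ₗ[Qvpi] Qvpi) : Udot D →ₗ[Qvpi] Udot D →ₗ[Qvpi] Qvpi :=
  LinearMap.mk₂ Qvpi (fun x y => dagR (barR (B (Udot.dagBar D x) (Udot.dagBar D y))))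
    (fun x x' y => by simp)
    (fun c x y => by
      rw [Udot.dagBar_scalar_smul, map_smul, LinearMap.smul_apply, smul_eq_mul, map_mul, map_mul,
        dagR_barR_dagR_barR, smul_eq_mul])
    (fun x y y' => by simp)
    (fun c x y => by
      rw [Udot.dagBar_scalar_smul, map_smul, smul_eq_mul, map_mul, map_mul,
        dagR_barR_dagR_barR, smul_eq_mul])

theorem twistForm_apply (B : Udot D →ₗ[Qvpi] Udot D →ₗ[Qvpi] Qvpi) (x y : Udot D) :
    twistForm D B x y = dagR (barR (B (Udot.dagBar D x) (Udot.dagBar D y))) := rfl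

/-- The adjunction is transported by `anti_tau1_dagBar`. On 𝐔⁻ the dagger is absorbed by
`form_dagger`, so that only the bar conjugate of the form on 𝐟 is left. -/
theorem isDotForm_twistForm {B : Udot D →ₗ[Qvpi] Udot D →ₗ[Qvpi] Qvpi}
    (h : IsDotForm D (QCG.tau1 D) (fun x y => Half.form D x y) B) :
    IsDotForm D (QCG.tau1Second D) (fun x y => Half.barForm D x y) (twistForm D B) := by
  have adj : ∀ u x y, twistForm D B (u • x) y = twistForm D B x (anti (QCG.tau1Second D) u • y) := by
    intro u x y
    rw [twistForm_apply, twistForm_apply, Udot.dagBar_smul, Udot.dagBar_smul, h.adjoint,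
      ← anti_apply, QCG.anti_tau1_dagBar]
  refine ⟨weight_of_diag D (QCG.anti_tau1Second_K D) adj ?_, adj, ?_, ?_⟩
  · intro l m x y hlm
    rw [twistForm_apply, Udot.dagBar_of, Udot.dagBar_of, h.of_of_of_ne hlm, map_zero, map_zero]
  · intro l x y
    rw [twistForm_apply, Udot.dagBar_of, Udot.dagBar_of, QCG.dagBar_minus, QCG.dagBar_minus,
      h.minus, dagR_barR, Half.form_dagger, Half.barForm_apply]
  · intro x y
    rw [twistForm_apply, h.symm, twistForm_apply]

end QuantumCovering

end

/-! ### Right adjunction, and invariance under ρ and ω. -/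

noncomputable section

namespace QuantumCovering

variable {I X Y : Type*} [AddCommGroup X] [AddCommGroup Y] (D : Datum I X Y)

open QCG

theorem Half.adJ_neg_tilde (i : I) (x : Half D) : adJ D (-(D.d i • D.rootY i)) x = x := by
  conv_lhs => rw [← adJ_tilde D i x]
  rw [adJ_adJ, neg_add_cancel, adJ_zero]

namespace QCG

theorem Kt_mul_E (i : I) : Kt D i * E D i = pv (D.d i) (3 * D.d i) •
    (anti (tau1Second D) (F D i) *
      (J D (D.d i • D.rootY i) * K D (D.d i • D.rootY i + D.d i • D.rootY i))) := by
  have e : Kt D i * E D i = pv 0 (D.dot i i) • (E D i * Kt D i) := by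
    rw [E_mul_Kt, smul_smul, pv_mul, add_neg_cancel, add_zero, pv_zero, one_smul]
  rw [e, E_eq_tau1Second, smul_mul_assoc, smul_smul, pv_mul, mul_assoc, mul_assoc, Kt, K_mul,
    zero_add, pv_congr (b' := 3 * D.d i) ⟨0, sub_self _⟩ (by rw [D.dot_self]; ring)]

/-- The factor K̃_i completes the parity dilation to `dilBar` and cancels the K̃_i⁻¹ of the second
derivation. The result is a term free of torus factors, which will become the right derivation. -/
theorem minus_mul_Kt_mul_E (i : I) (y : Half D) : minus D y * (Kt D i * E D i) =
    Kt D i * E D i * minus D (Half.dilBar D i y) - Ring.inverse (qd (D.d i)) •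
      (Kt D i * (Jt D i * Kt D i * minus D (Half.derivBar D i (Half.dilBar D i y))) -
        minus D (Half.deriv D i (Half.dilBar D i y))) := by
  rw [← mul_assoc, Kt, minus_mul_K, mul_assoc, minus_mul_E, Half.adK_tilde, ← Half.dilBar_eq,
    mul_sub, mul_smul_comm, mul_sub, mul_assoc]
  change _ - _ • (_ - Kt D i * (Ktinv D i * _)) = _
  rw [Kt_mul_Ktinv_mul]
  simp only [Kt, mul_assoc]

theorem anti_rho_piJt (i : I) : anti (rho D) (piJt D i) = piJt D i := anti_piJt D (anti_rho_J D) i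

theorem anti_rho_minus (x : Half D) : anti (rho D) (minus D x) = minus D (Half.rev D x) := by
  induction x using Half.left_induction with
  | one => rw [Half.rev_one, map_one, anti_one]
  | smul c x h => simp only [map_smul, h]
  | add x y hx hy => simp only [map_add, hx, hy]
  | θ_mul i x h => rw [minus_θ_mul, anti_mul, h, anti_rho_F, Half.rev_θ_mul, map_mul, minus_θ]

/-- Both composites are homomorphisms, so generators suffice. Through this relation ρ exchanges the
left adjunction, given by τ₁'', with the right one, given by τ₁. -/
theorem anti_rho_tau1Second (u : QCG D) :
    anti (rho D) (anti (tau1Second D) u) = anti (tau1 D) (anti (rho D) u) := by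
  have : antiComp (rho D) (tau1Second D) = antiComp (tau1 D) (rho D) := by
    refine hom_ext D (fun i => ?_) (fun i => ?_) (fun ν => ?_) (fun ν => ?_) <;>
      rw [antiComp_apply, antiComp_apply]
    · have hK : anti (rho D) (Kt D i) = Ktinv D i := anti_rho_K D _
      rw [anti_tau1Second_E, map_smul, anti_mul, anti_mul, hK, anti_rho_F, anti_rho_piJt,
        anti_rho_E, anti_mul, anti_tau1_E, anti_piJt D (anti_tau1_J D), F_mul_Ktinv,
        smul_mul_assoc, smul_mul_assoc, smul_smul, pv_mul,
        pv_congr (a' := 0) (b' := -D.d i) ⟨0, by ring⟩ (by rw [D.dot_self]; ring)]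
    · have hK : anti (rho D) (Ktinv D i) = Kt D i := by rw [Ktinv, anti_rho_K, neg_neg]; rfl
      rw [anti_tau1Second_F, map_smul, anti_mul, anti_mul, hK, anti_rho_E, anti_rho_piJt,
        anti_rho_F, anti_tau1_F, ← piJt_comm, mul_assoc, piJt_mul_piJt_mul, E_mul_Kt, smul_smul,
        pv_mul, pv_congr (a' := 0) (b' := -D.d i) ⟨0, by ring⟩ (by rw [D.dot_self]; ring)]
    · rw [anti_tau1Second_K, anti_rho_K, anti_tau1_K]
    · rw [anti_tau1Second_J, anti_rho_J, anti_tau1_J]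
  exact DFunLike.congr_fun this u

/-- This is the reason for ω⁻¹ in the second argument: τ₁''(ω(u)) ω⁻¹(w) is the single image
ω⁻¹(τ₁''(u) w). -/
theorem anti_tau1Second_omega (u : QCG D) :
    anti (tau1Second D) (omega D u) = (omega D).symm (anti (tau1Second D) u) := by
  have hJ : ∀ i, (omega D).symm (piJt D i) = piJt D i := by
    intro i; rw [piJt, map_smul, Jt, omega_symm_J]
  have hK : ∀ i, (omega D).symm (Kt D i) = Ktinv D i := fun i => omega_symm_K D _
  have hK' : ∀ i, (omega D).symm (Ktinv D i) = Kt D i := by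
    intro i; rw [Ktinv, omega_symm_K, neg_neg]; rfl
  induction u using QCG.induction with
  | scalar c =>
    rw [AlgEquiv.commutes, Algebra.algebraMap_eq_smul_one, map_smul, anti_one, map_smul, map_one]
  | hE i =>
    rw [omega_E, anti_tau1Second_F, anti_tau1Second_E, map_smul, map_mul, map_mul, hJ, hK,
      omega_symm_F]
  | hF i =>
    rw [omega_F, anti_mul, anti_piJt D (anti_tau1Second_J D), anti_tau1Second_F,
      anti_tau1Second_E, map_smul, map_mul, map_mul, hJ, hK', omega_symm_E, ← piJt_comm,
      mul_smul_comm, piJt_mul_piJt_mul, ← mul_assoc (Kt D i), ← piJt_comm, mul_assoc,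
      piJt_mul_piJt_mul]
  | hK ν => rw [omega_K, anti_tau1Second_K, anti_tau1Second_K, omega_symm_K]
  | hJ ν => rw [omega_J, anti_tau1Second_J, omega_symm_J]
  | mul u w hu hw => rw [map_mul, anti_mul, hu, hw, anti_mul, map_mul]
  | add u w hu hw => rw [map_add, map_add, hu, hw, map_add, map_add]

end QCG

/-! ### Monomials and their weights. -/

namespace Half

/-- The monomial `θ_{i_1} ⋯ θ_{i_n}`. -/
def word (L : List I) : Half D := (L.map (θ D)).prod

theorem word_nil : word D [] = 1 := rfl

theorem word_cons (i : I) (L : List I) : word D (i :: L) = θ D i * word D L := by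
  rw [word, List.map_cons, List.prod_cons]; rfl

/-- `𝐟` is spanned by the monomials. -/
theorem word_induction {P : Half D → Prop} (word : ∀ L, P (word D L))
    (smul : ∀ (c : Qvpi) (x), P x → P (c • x)) (add : ∀ x y, P x → P y → P (x + y))
    (x : Half D) : P x := by
  have key : x ∈ Submodule.span Qvpi (Set.range (Half.word D)) := by
    induction x using left_induction with
    | one => exact Submodule.subset_span ⟨[], rfl⟩
    | smul c x h => exact Submodule.smul_mem _ c h
    | add x y hx hy => exact Submodule.add_mem _ hx hy
    | θ_mul i x h =>
      induction h using Submodule.span_induction with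
      | mem x hx =>
        obtain ⟨L, rfl⟩ := hx
        exact Submodule.subset_span ⟨i :: L, word_cons D i L⟩
      | zero => rw [mul_zero]; exact Submodule.zero_mem _
      | add x y _ _ hx hy => rw [mul_add]; exact Submodule.add_mem _ hx hy
      | smul c x _ hx => rw [mul_smul_comm]; exact Submodule.smul_mem _ c hx
  induction key using Submodule.span_induction with
  | mem x hx => obtain ⟨L, rfl⟩ := hx; exact word L
  | zero => simpa using smul 0 _ (word [])
  | add x y _ _ hx hy => exact add x y hx hy
  | smul c x _ hx => exact smul c x hx

theorem dil_word (c : I → Qvpi) (L : List I) : dil D c (word D L) = (L.map c).prod • word D L := by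
  induction L with
  | nil => rw [word_nil, map_one, List.map_nil, List.prod_nil, one_smul]
  | cons i L ih =>
    rw [word_cons, dil_θ_mul, ih, mul_smul_comm, smul_smul, List.map_cons, List.prod_cons]

theorem dil_rev_word (c : I → Qvpi) (L : List I) :
    dil D c (rev D (word D L)) = (L.map c).prod • rev D (word D L) := by
  induction L with
  | nil => rw [word_nil, rev_one, map_one, List.map_nil, List.prod_nil, one_smul]
  | cons i L ih =>
    rw [word_cons, rev_θ_mul, map_mul, dil_θ, ih, smul_mul_smul_comm, List.map_cons,
      List.prod_cons, mul_comm]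

/-- Some letter i occurs with different multiplicities. The self-adjoint dilation that scales θ_i by
v and fixes the other generators then acts by different powers of v. -/
theorem barForm_word_of_not_perm {L M : List I} (h : ¬L.Perm M) :
    barForm D (word D L) (word D M) = 0 := by
  classical
  rw [List.perm_iff_count] at h
  push Not at h
  obtain ⟨i, hi⟩ := h
  have key : ∀ L : List I, (L.map fun j => if i = j then pv 0 1 else 1).prod =
      pv 0 (L.count i) := by
    intro L
    induction L with
    | nil => simp [pv_zero]
    | cons j L ih =>
      rw [List.map_cons, List.prod_cons, ih]
      by_cases h : i = j
      · subst h; rw [if_pos rfl, List.count_cons_self, pv_mul, Nat.cast_succ, add_zero, add_comm]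
      · rw [if_neg h, one_mul, List.count_cons_of_ne (Ne.symm h)]
  refine eq_zero_of_pv_mul (Nat.cast_injective.ne hi) ?_
  have := barForm_dil D (fun j => if i = j then pv 0 1 else 1) (word D L) (word D M)
  rwa [dil_word, dil_word, key, key, map_smul, map_smul, LinearMap.smul_apply, smul_eq_mul,
    smul_eq_mul] at this

end Half

namespace Datum

/-- The element `∑ d_i i` of `Y`, for the weight of a monomial. -/
def coroot (L : List I) : Y := (L.map fun i => D.d i • D.rootY i).sum

/-- Half the square `|ν|² / 2` of the weight of a monomial. -/
def halfNorm : List I → ℤ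
  | [] => 0
  | i :: L => halfNorm L + D.d i + (L.map (D.dot i)).sum

theorem coroot_perm {L M : List I} (h : L.Perm M) : D.coroot L = D.coroot M :=
  (h.map _).sum_eq

theorem halfNorm_perm {L M : List I} (h : L.Perm M) : D.halfNorm L = D.halfNorm M := by
  induction h with
  | nil => rfl
  | cons i h ih => rw [halfNorm, halfNorm, ih, (h.map _).sum_eq]
  | swap i j L =>
    simp only [halfNorm, List.map_cons, List.sum_cons]
    rw [D.dot_symm i j]; ring
  | trans _ _ h h' => rw [h, h']

theorem pairing_coroot (L : List I) (i : I) :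
    D.pairing (D.coroot L) (D.rootX i) = (L.map (D.dot i)).sum := by
  induction L with
  | nil => simp [coroot]
  | cons j L ih =>
    rw [coroot, List.map_cons, List.sum_cons, map_add, LinearMap.add_apply, pairing_tilde,
      ← coroot, ih, List.map_cons, List.sum_cons, D.dot_symm]

end Datum

namespace QCG

/-- Each letter becomes E_i = v_i K̃_i⁻¹ τ₁(F_i). Collecting the torus factors on the left
accumulates half the square of the weight in the exponent, and `rev` appears because τ₁ reverses
products. -/
theorem omega_symm_word (L : List I) : (omega D).symm (minus D (Half.word D L)) =
    pv 0 (D.halfNorm L) • (K D (-D.coroot L) *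
      anti (tau1 D) (minus D (Half.rev D (Half.word D L)))) := by
  induction L with
  | nil =>
    rw [Half.word_nil, Half.rev_one, map_one, map_one, anti_one, Datum.coroot, List.map_nil,
      List.sum_nil, neg_zero, (isRep D).k_zero, Datum.halfNorm, pv_zero, one_smul, one_mul]
  | cons i L ih =>
    have e1 : E D i = pv 0 (D.d i) • (Ktinv D i * anti (tau1 D) (F D i)) := by
      rw [anti_tau1_F, mul_smul_comm, Ktinv_mul_Kt_mul, smul_smul, pv_mul, add_neg_cancel,
        add_zero, pv_zero, one_smul]
    have e2 : anti (tau1 D) (F D i) * K D (-D.coroot L) =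
        pv 0 (L.map (D.dot i)).sum • (K D (-D.coroot L) * anti (tau1 D) (F D i)) := by
      rw [anti_tau1_F, smul_mul_assoc, mul_assoc, E_mul_K, mul_smul_comm, ← mul_assoc, Kt,
        K_comm_K, mul_assoc, mul_smul_comm, smul_comm, map_neg, LinearMap.neg_apply, neg_neg,
        D.pairing_coroot]
    have e3 : K D (-D.coroot (i :: L)) = Ktinv D i * K D (-D.coroot L) := by
      rw [Ktinv, K_mul, ← neg_add, Datum.coroot, List.map_cons, List.sum_cons]; rfl
    rw [Half.word_cons, minus_θ_mul, map_mul, omega_symm_F, ih, Half.rev_θ_mul, map_mul, minus_θ,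
      anti_mul, e3, mul_smul_comm]
    conv_lhs => rw [e1]
    rw [smul_mul_assoc, smul_smul, mul_assoc, ← mul_assoc (anti _ _), e2, smul_mul_assoc,
      mul_smul_comm, smul_smul, pv_mul, pv_mul, Datum.halfNorm]
    simp only [mul_assoc, add_zero]

/-- The letters become v_i K̃_i F_i, and the torus factors are collected on the right. The exponent
and the torus element are inverse to those of `omega_symm_word`, so for equal weights they cancel in
the product. -/
theorem tau1Second_omega_word (L : List I) :
    anti (tau1Second D) (omega D (minus D (Half.word D L))) =
      pv 0 (-D.halfNorm L) • (minus D (Half.rev D (Half.word D L)) * K D (D.coroot L)) := by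
  induction L with
  | nil =>
    rw [Half.word_nil, Half.rev_one, map_one, map_one, anti_one, Datum.coroot, List.map_nil,
      List.sum_nil, (isRep D).k_zero, Datum.halfNorm, neg_zero, pv_zero, one_smul, one_mul]
  | cons i L ih =>
    have e1 : anti (tau1Second D) (omega D (F D i)) = pv 0 (D.d i) • (Kt D i * F D i) := by
      rw [omega_F, anti_mul, anti_piJt D (anti_tau1Second_J D), anti_tau1Second_E, ← piJt_comm,
        mul_smul_comm, piJt_mul_piJt_mul]
    have e2 : K D (D.coroot L) * (Kt D i * F D i) =
        pv 0 (-(2 * D.d i + (L.map (D.dot i)).sum)) • (F D i * K D (D.coroot (i :: L))) := by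
      have e3 : D.coroot (i :: L) = D.coroot L + D.d i • D.rootY i := by
        rw [add_comm, Datum.coroot, List.map_cons, List.sum_cons]; rfl
      rw [← mul_assoc, Kt, K_mul, ← e3, (isRep D).k_f, D.pairing_coroot, List.map_cons,
        List.sum_cons, D.dot_self]
    rw [Half.word_cons, minus_θ_mul, map_mul, anti_mul, ih, e1, Half.rev_θ_mul, map_mul, minus_θ,
      smul_mul_smul_comm, mul_assoc, e2, mul_smul_comm, smul_smul, pv_mul, pv_mul, mul_assoc,
      Datum.halfNorm, pv_congr (a' := 0)
        (b' := -(D.halfNorm L + D.d i + (L.map (D.dot i)).sum)) ⟨0, by ring⟩ (by ring)]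

end QCG

theorem Homog.rho {D : Datum I X Y} {γ : X} {u : QCG D} (h : Homog D γ u) :
    Homog D γ (anti (QCG.rho D) u) := by
  induction h with
  | scalar c => rw [Algebra.algebraMap_eq_smul_one, map_smul, anti_one]; exact Homog.one.smul c
  | E i => rw [anti_rho_E]; exact (Homog.E i).piJt_mul i
  | F i => rw [anti_rho_F]; exact Homog.F i
  | K ν => rw [anti_rho_K]; exact Homog.K _
  | J ν => rw [anti_rho_J]; exact Homog.J _
  | mul _ _ h h' => rw [anti_mul, add_comm]; exact h'.mul h
  | add _ _ h h' => rw [map_add]; exact h.add h'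

namespace IsDotForm
variable {D} {B : Udot D →ₗ[Qvpi] Udot D →ₗ[Qvpi] Qvpi}
  (h : IsDotForm D (tau1Second D) (fun x y => Half.barForm D x y) B)
include h

theorem K_mul (l : X) (ν : Y) (u : QCG D) :
    oneFunctional B l (K D ν * u) = pv 0 (D.pairing ν l) * oneFunctional B l u := by
  rw [← h.oneFunctional_anti, anti_mul, anti_tau1Second_K, oneFunctional_mul_K,
    h.oneFunctional_anti]

theorem J_mul (l : X) (ν : Y) (u : QCG D) :
    oneFunctional B l (J D ν * u) = pv (D.pairing ν l) 0 * oneFunctional B l u := by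
  rw [← h.oneFunctional_anti, anti_mul, anti_tau1Second_J, oneFunctional_mul_J,
    h.oneFunctional_anti]

theorem anti_JK_minus (l : X) (x z : Half D) (μ ν : Y) :
    oneFunctional B l (anti (tau1Second D) (QCG.minus D x) * (J D μ * K D ν * QCG.minus D z)) =
      pv (D.pairing μ l) (D.pairing ν l) *
        Half.barForm D x (Half.adJ D (-μ) (Half.adK D (-ν) z)) := by
  rw [mul_assoc, K_mul_minus, ← mul_assoc (J D μ), J_mul_minus, ← mul_assoc, ← mul_assoc,
    oneFunctional_mul_K, oneFunctional_mul_J, h.oneFunctional_minus, ← mul_assoc, pv_mul,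
    zero_add, add_zero]

/-- K̃_i E_i is τ₁''(F_i) up to scalar and torus, so it adds a θ_i on the right-hand end of the
τ₁''-factor as θ_i x, and the form strips this letter again. The value differs from that of
`anti_minus_JKK` at the derivative of z only by 1/(π_i v_i - v_i⁻¹), so the two cancel in
`anti_F_mul`. -/
theorem anti_minus_KE (l : X) (i : I) (x z : Half D) :
    oneFunctional B l (anti (tau1Second D) (QCG.minus D x) * (Kt D i * E D i * QCG.minus D z)) =
      Ring.inverse (qd (D.d i)) * (pv (D.pairing (D.d i • D.rootY i) l)
        (D.pairing (D.d i • D.rootY i + D.d i • D.rootY i) l) * Half.barForm D x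
          (Half.adK D (-(D.d i • D.rootY i + D.d i • D.rootY i)) (Half.derivBar D i z))) := by
  rw [Kt_mul_E, smul_mul_assoc, mul_smul_comm, map_smul, smul_eq_mul, mul_assoc,
    ← mul_assoc (anti _ _) (anti _ _), ← anti_mul, ← minus_θ_mul, h.anti_JK_minus,
    Half.adJ_neg_tilde, Half.barForm_θ_mul, Half.derivBar_dil,
    (Half.barForm D x).map_smul, Half.barScalar, smul_eq_mul]
  have e : pv (D.d i) (3 * D.d i) * pv (D.d i) (D.d i) *
      pv 0 (D.pairing (-(D.d i • D.rootY i + D.d i • D.rootY i)) (D.rootX i)) = 1 := by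
    rw [pv_mul, pv_mul, ← pv_zero]
    refine pv_congr ⟨D.d i, by ring⟩ ?_
    rw [map_neg, map_add, LinearMap.neg_apply, LinearMap.add_apply, pairing_tilde, D.dot_self]
    ring
  set P := pv (D.pairing (D.d i • D.rootY i) l)
    (D.pairing (D.d i • D.rootY i + D.d i • D.rootY i) l)
  set S := Ring.inverse (qd (D.d i))
  set W := Half.barForm D x
          (Half.adK D (-(D.d i • D.rootY i + D.d i • D.rootY i)) (Half.derivBar D i z))
  linear_combination P * S * W * e

theorem anti_minus_JKK (l : X) (i : I) (x z : Half D) :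
    oneFunctional B l (anti (tau1Second D) (QCG.minus D x) *
      (Kt D i * (Jt D i * Kt D i * QCG.minus D z))) =
      pv (D.pairing (D.d i • D.rootY i) l)
        (D.pairing (D.d i • D.rootY i + D.d i • D.rootY i) l) * Half.barForm D x
          (Half.adK D (-(D.d i • D.rootY i + D.d i • D.rootY i)) z) := by
  have e : Kt D i * (Jt D i * Kt D i * QCG.minus D z) =
      J D (D.d i • D.rootY i) * K D (D.d i • D.rootY i + D.d i • D.rootY i) * QCG.minus D z := by
    rw [← mul_assoc, ← mul_assoc, Kt, Jt, ← J_comm_K, mul_assoc (J D _), QCG.K_mul]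
  rw [e, h.anti_JK_minus, Half.adJ_neg_tilde]

/-- A left factor τ₁''(F_i) may be carried round to the right, where it becomes τ₁(F_i) and shifts
the weight. On τ₁''(x⁻) y⁻ this is the adjunction on 𝐟 between right multiplication by θ_i and the
right derivation. -/
theorem anti_F_mul (l : X) (i : I) (w : QCG D) :
    oneFunctional B l (anti (tau1Second D) (F D i) * w) =
      oneFunctional B (l - D.rootX i) (w * anti (tau1 D) (F D i)) := by
  refine LinearMap.congr_fun
    (f := oneFunctional B l ∘ₗ LinearMap.mulLeft Qvpi (anti (tau1Second D) (F D i)))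
    (g := oneFunctional B (l - D.rootX i) ∘ₗ LinearMap.mulRight Qvpi (anti (tau1 D) (F D i)))
    (functional_ext D (exists_E_tau1Second D) l ?_ ?_ ?_ ?_ ?_) w
  · intro u ν
    change oneFunctional B l (_ * (u * _)) = _ * oneFunctional B l (_ * u)
    rw [← mul_assoc, oneFunctional_mul_K]
  · intro u ν
    change oneFunctional B l (_ * (u * _)) = _ * oneFunctional B l (_ * u)
    rw [← mul_assoc, oneFunctional_mul_J]
  · intro u ν
    change oneFunctional B _ (u * _ * _) = _ * oneFunctional B _ (u * _)
    -- The factor from moving K_ν across τ₁(F_i) makes up for the shift of the weight from l to l -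
    -- i'.
    have e : K D ν * anti (tau1 D) (F D i) =
        pv 0 (D.pairing ν (D.rootX i)) • (anti (tau1 D) (F D i) * K D ν) := by
      rw [anti_tau1_F, mul_smul_comm, ← mul_assoc, Kt, K_comm_K, mul_assoc, (isRep D).k_e,
        mul_smul_comm, smul_comm, smul_mul_assoc, mul_assoc]
    rw [mul_assoc, e, mul_smul_comm, map_smul, ← mul_assoc, oneFunctional_mul_K, smul_eq_mul,
      ← mul_assoc, pv_mul, map_sub, add_zero, add_sub_cancel]
  · intro u ν
    change oneFunctional B _ (u * _ * _) = _ * oneFunctional B _ (u * _)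
    have e : J D ν * anti (tau1 D) (F D i) =
        pv (D.pairing ν (D.rootX i)) 0 • (anti (tau1 D) (F D i) * J D ν) := by
      rw [anti_tau1_F, mul_smul_comm, ← mul_assoc, Kt, J_comm_K, mul_assoc, (isRep D).j_e,
        mul_smul_comm, smul_comm, smul_mul_assoc, mul_assoc]
    rw [mul_assoc, e, mul_smul_comm, map_smul, ← mul_assoc, oneFunctional_mul_J, smul_eq_mul,
      ← mul_assoc, pv_mul, map_sub, add_zero, add_sub_cancel]
  · intro x y
    change oneFunctional B l (_ * (_ * _)) = oneFunctional B _ (_ * _ * _)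
    -- The left side is β̄(x θ_i, y). On the right, commuting y⁻ with K̃_i E_i gives three terms;
    -- the two that depend on the weight cancel, and the third contains the right derivation of y.
    rw [← mul_assoc, ← anti_mul, ← minus_θ, ← map_mul, h.oneFunctional_minus, minus_θ,
      anti_tau1_F, mul_assoc, mul_smul_comm, mul_smul_comm, minus_mul_Kt_mul_E, mul_sub, map_smul,
      map_sub, mul_smul_comm, map_smul, mul_sub, map_sub, h.anti_minus_KE, h.anti_minus_JKK,
      h.oneFunctional_minus, Half.barForm_mul_θ, Half.rderivBar_apply, Half.deriv_dil,
      (Half.barForm D x).map_smul, Half.barScalar]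
    -- The factor v_i⁻¹ comes from τ₁(F_i) and the twist from exchanging deletion with dilation.
    -- Their product is the numerator π_i v_i of `barScalar`.
    have e : pv 0 (-D.d i) * Half.twistBar D i i = pv (D.d i) (D.d i) := by
      rw [Half.twistBar, D.pv_p, pv_mul, zero_add,
        pv_congr (b' := D.d i) ⟨0, sub_self _⟩ (by rw [D.dot_self]; ring)]
    simp only [smul_eq_mul]
    rw [← e]
    ring

/-- No new computation is needed: invariance of the functionals under τ₁'' turns the rule for F_i
into that for E_i. -/
theorem anti_E_mul (l : X) (i : I) (w : QCG D) :
    oneFunctional B l (anti (tau1Second D) (E D i) * w) =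
      oneFunctional B (l + D.rootX i) (w * anti (tau1 D) (E D i)) := by
  -- The factor K̃_i⁻¹ is inserted to cancel the K̃_i in τ₁(F_i) = v_i⁻¹ K̃_i E_i.
  have key := h.anti_F_mul (l + D.rootX i) i (anti (tau1Second D) (Ktinv D i * w))
  rw [← anti_mul, h.oneFunctional_anti, mul_assoc, Ktinv, h.K_mul, add_sub_cancel_right,
    ← h.oneFunctional_anti l, anti_mul, anti_tau1Second_anti, anti_tau1_F, map_smul, anti_mul,
    anti_Kt D (anti_tau1Second_K D), smul_mul_assoc, mul_assoc] at key
  change _ = oneFunctional B l (_ • (_ * (Kt D i * (Ktinv D i * w)))) at key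
  rw [Kt_mul_Ktinv_mul, map_smul, smul_eq_mul] at key
  have e : Ktinv D i * F D i = pv 0 (D.dot i i) • (F D i * Ktinv D i) := by
    rw [F_mul_Ktinv, smul_smul, pv_mul, add_neg_cancel, add_zero, pv_zero, one_smul]
  rw [anti_tau1_E, e, smul_smul, pv_mul, mul_smul_comm, map_smul, ← mul_assoc, Ktinv,
    oneFunctional_mul_K, smul_eq_mul, key, ← mul_assoc, pv_mul, D.dot_self,
    pv_congr (a' := 0) (b' := 0) ⟨0, by ring⟩ (by ring), pv_zero, one_mul]

/-- In terms of the form, right multiplication by u is adjoint to right multiplication by τ₁(u). The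
rule passes to products because both maps reverse the order and degrees add. -/
theorem anti_homog_mul {γ : X} {u : QCG D} (hu : Homog D γ u) : ∀ (l : X) (w : QCG D),
    oneFunctional B l (anti (tau1Second D) u * w) =
      oneFunctional B (l + γ) (w * anti (tau1 D) u) := by
  induction hu with
  | scalar c =>
    intro l w
    rw [Algebra.algebraMap_eq_smul_one, map_smul, map_smul, anti_one, anti_one, smul_mul_assoc,
      mul_smul_comm, one_mul, mul_one, add_zero]
  | E i => intro l w; exact h.anti_E_mul l i w
  | F i => intro l w; rw [h.anti_F_mul, sub_eq_add_neg]
  | K ν =>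
    intro l w
    rw [anti_tau1Second_K, anti_tau1_K, h.K_mul, add_zero, oneFunctional_mul_K]
  | J ν =>
    intro l w
    rw [anti_tau1Second_J, anti_tau1_J, h.J_mul, add_zero, oneFunctional_mul_J]
  | @mul γ γ' _ _ _ _ h1 h2 =>
    intro l w
    rw [anti_mul, anti_mul, mul_assoc, h2, mul_assoc, h1, add_assoc, add_comm γ', mul_assoc]
  | add _ _ h1 h2 =>
    intro l w
    rw [map_add, map_add, add_mul, mul_add, map_add, map_add, h1, h2]

/-- The letters of τ₁(x⁻) are carried back to the left one by one with `anti_F_mul`. Each step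
shifts the weight, which is harmless since the value does not depend on l, but the induction must
range over all l. -/
theorem minus_mul_tau1_minus (x : Half D) : ∀ (l : X) (z y : Half D),
    oneFunctional B l (anti (tau1Second D) (QCG.minus D z) * QCG.minus D y *
      anti (tau1 D) (QCG.minus D x)) = Half.barForm D (z * x) y := by
  induction x using Half.left_induction with
  | one => intro l z y; rw [map_one, anti_one, mul_one, mul_one, h.oneFunctional_minus]
  | smul c x hx =>
    intro l z y
    rw [map_smul, map_smul, mul_smul_comm, map_smul, hx, mul_smul_comm, map_smul,
      LinearMap.smul_apply]
  | add x x' hx hx' =>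
    intro l z y
    rw [map_add, map_add, mul_add, map_add, hx, hx', mul_add, map_add, LinearMap.add_apply]
  | θ_mul i x hx =>
    intro l z y
    have := h.anti_F_mul (l + D.rootX i) i (anti (tau1Second D) (QCG.minus D z) *
      QCG.minus D y * anti (tau1 D) (QCG.minus D x))
    rw [add_sub_cancel_right] at this
    rw [minus_θ_mul, anti_mul, ← mul_assoc, ← this, ← mul_assoc, ← mul_assoc, ← anti_mul,
      ← minus_θ, ← map_mul, hx, mul_assoc]

/-- On τ₁''(x⁻) y⁻ the map ρ gives (rev y)⁻ τ₁((rev x)⁻). Its value is β̄(rev x, rev y), and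
reversal is an isometry. -/
theorem oneFunctional_rho (l : X) (u : QCG D) :
    oneFunctional B (-l) (anti (rho D) u) = oneFunctional B l u := by
  refine LinearMap.congr_fun (f := oneFunctional B (-l) ∘ₗ anti (rho D))
    (functional_ext D (exists_E_tau1Second D) l ?_ ?_ (oneFunctional_mul_K B l)
      (oneFunctional_mul_J B l) ?_) u
  · intro u ν
    change oneFunctional B (-l) (anti (rho D) (u * K D ν)) =
      _ * oneFunctional B (-l) (anti (rho D) u)
    rw [anti_mul, anti_rho_K, h.K_mul, map_neg, map_neg, LinearMap.neg_apply, neg_neg]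
  · intro u ν
    change oneFunctional B (-l) (anti (rho D) (u * J D ν)) =
      _ * oneFunctional B (-l) (anti (rho D) u)
    rw [anti_mul, anti_rho_J, h.J_mul, map_neg, pv_pi_neg]
  · intro x y
    change oneFunctional B (-l) (anti (rho D) (_ * _)) = _
    have := h.minus_mul_tau1_minus (Half.rev D x) (-l) 1 (Half.rev D y)
    rw [map_one, anti_one, one_mul, one_mul, Half.barForm_rev] at this
    rw [anti_mul, anti_rho_minus, anti_rho_tau1Second, anti_rho_minus, this,
      h.oneFunctional_minus]

theorem apply_eq_zero_of_weight {x y : Udot D} {l m : X} (hlm : l ≠ m)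
    (hx : ∀ ν, K D ν • x = pv 0 (D.pairing ν l) • x)
    (hy : ∀ ν, K D ν • y = pv 0 (D.pairing ν m) • y) : B x y = 0 :=
  form_eq_zero_of_weight D (anti_tau1Second_K D) h.adjoint hlm hx hy

theorem rho_rho (x y : Udot D) : B (Udot.rho D x) (Udot.rho D y) = B x y := by
  induction x using Udot.homog_induction with
  | of l γ u hu =>
    induction y using Udot.homog_induction with
    | of m γ' w hw =>
      have hu' := hu.rho
      have hw' := hw.rho
      rw [Udot.rho_of, Udot.rho_of, ← anti_apply, ← anti_apply, hu'.oneMul_eq, hw'.oneMul_eq]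
      by_cases hlm : l = m
      · subst hlm
        by_cases hγ : γ = γ'
        · subst hγ
          -- For ρ(u) of degree γ one has 1_{-l} ρ(u) = ρ(u) 1_{-l-γ}. The right adjunction brings
          -- the base weight back to -l, where the functional is compatible with ρ.
          rw [h.of_of, h.of_of]
          have := h.anti_homog_mul hu' (-l - γ) (anti (rho D) w)
          rw [sub_add_cancel, ← anti_rho_tau1Second, ← anti_mul, h.oneFunctional_rho] at this
          exact this
        -- When the degrees differ, the images under ρ have different right weights and the original
        -- elements have different left weights.
        · rw [h.of_of_of_ne fun e => hγ (sub_right_injective e),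
            h.apply_eq_zero_of_weight (fun e => hγ (add_left_cancel e)) (fun ν => hu.K_smul ν l)
              (fun ν => hw.K_smul ν l)]
      · rw [h.of_of_of_ne hlm]
        refine h.apply_eq_zero_of_weight (l := -l) (m := -m) (fun e => hlm (neg_injective e))
          (fun ν => ?_) (fun ν => ?_)
        · rw [hu'.K_smul, sub_add_cancel]
        · rw [hw'.K_smul, sub_add_cancel]
    | add x y hx hy => rw [map_add, map_add, map_add, hx, hy]
  | add x y hx hy =>
    rw [map_add, map_add, map_add, LinearMap.add_apply, LinearMap.add_apply, hx, hy]

/-- On monomials of equal weight everything cancels except (rev x)⁻ τ₁((rev y)⁻), whose value is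
known from the right adjunction with first factor 1. Equality of weights is tested as being
permutations of each other. -/
theorem tau1Second_omega_mul_omega_symm (l : X) (x : Half D) : ∀ y : Half D,
    oneFunctional B l (anti (tau1Second D) (omega D (QCG.minus D x)) *
      (omega D).symm (QCG.minus D y)) = Half.barForm D x y := by
  induction x using Half.word_induction with
  | word L =>
    intro y
    induction y using Half.word_induction with
    | word M =>
      have key : ∀ x y, oneFunctional B l (QCG.minus D x * anti (tau1 D) (QCG.minus D y)) =
          Half.barForm D y x := by
        intro x y
        have := h.minus_mul_tau1_minus y l 1 x
        rwa [map_one, anti_one, one_mul, one_mul] at this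
      rw [tau1Second_omega_word, omega_symm_word, smul_mul_smul_comm, pv_mul, map_smul, mul_assoc,
        ← mul_assoc (K D _), QCG.K_mul]
      by_cases hLM : L.Perm M
      · rw [D.coroot_perm hLM, D.halfNorm_perm hLM, neg_add_cancel, add_neg_cancel,
          (isRep D).k_zero, one_mul, add_zero, pv_zero, one_smul, key, Half.barForm_rev,
          Half.barForm_symm]
      -- For different weights the torus factor survives, but moving it to the left only contributes
      -- scalars, and both sides vanish by orthogonality.
      · rw [Half.barForm_word_of_not_perm D hLM, ← mul_assoc, minus_mul_K, mul_assoc, h.K_mul,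
          Half.dil_rev_word, map_smul, smul_mul_assoc, map_smul, key, Half.barForm_rev,
          Half.barForm_word_of_not_perm D fun e => hLM e.symm, smul_zero, mul_zero, smul_zero]
    | smul c y hy => rw [map_smul, map_smul, mul_smul_comm, map_smul, hy, map_smul]
    | add y y' hy hy' => rw [map_add, map_add, mul_add, map_add, hy, hy', map_add]
  | smul c x hx =>
    intro y
    rw [map_smul, map_smul, map_smul, smul_mul_assoc, map_smul, hx, map_smul,
      LinearMap.smul_apply]
  | add x x' hx hx' =>
    intro y
    rw [map_add, map_add, map_add, add_mul, map_add, hx, hx', map_add, LinearMap.add_apply]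

theorem oneFunctional_omega_symm (l : X) (u : QCG D) :
    oneFunctional B (-l) ((omega D).symm u) = oneFunctional B l u := by
  refine LinearMap.congr_fun (f := oneFunctional B (-l) ∘ₗ (omega D).symm.toLinearMap)
    (functional_ext D (exists_E_tau1Second D) l ?_ ?_ (oneFunctional_mul_K B l)
      (oneFunctional_mul_J B l) ?_) u
  · intro u ν
    change oneFunctional B (-l) ((omega D).symm (u * K D ν)) =
      _ * oneFunctional B (-l) ((omega D).symm u)
    rw [map_mul, omega_symm_K, oneFunctional_mul_K, map_neg, map_neg, LinearMap.neg_apply, neg_neg]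
  · intro u ν
    change oneFunctional B (-l) ((omega D).symm (u * J D ν)) =
      _ * oneFunctional B (-l) ((omega D).symm u)
    rw [map_mul, omega_symm_J, oneFunctional_mul_J, map_neg, pv_pi_neg]
  · intro x y
    change oneFunctional B (-l) ((omega D).symm (_ * _)) = _
    rw [map_mul, ← anti_tau1Second_omega, h.tau1Second_omega_mul_omega_symm,
      h.oneFunctional_minus]

theorem omega_omegaInv (x y : Udot D) : B (Udot.omega D x) (Udot.omegaInv D y) = B x y := by
  induction x using Udot.induction with
  | of l u =>
    induction y using Udot.induction with
    | of m w =>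
      rw [Udot.omega_of, Udot.omegaInv_of]
      by_cases hlm : l = m
      · subst hlm
        rw [h.of_of, h.of_of, anti_tau1Second_omega, ← map_mul]
        exact h.oneFunctional_omega_symm l _
      · rw [h.of_of_of_ne hlm, h.of_of_of_ne fun e => hlm (neg_injective e)]
    | add x y hx hy => rw [map_add, map_add, map_add, hx, hy]
  | add x y hx hy =>
    rw [map_add, map_add, map_add, LinearMap.add_apply, LinearMap.add_apply, hx, hy]

end IsDotForm

end QuantumCovering

end

open QuantumCovering in
theorem mainTheorem10 {I X Y : Type*} [Finite I] [AddCommGroup X] [AddCommGroup Y]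
    [Module.Free ℤ X] [Module.Finite ℤ X] [Module.Free ℤ Y] [Module.Finite ℤ Y]
    (D : Datum I X Y) :
    (∃! B' : Udot D →ₗ[Qvpi] Udot D →ₗ[Qvpi] Qvpi,
      IsDotForm D (QCG.tau1Prime D)
        (fun x y => barR (Half.form D (Half.bar D x) (Half.bar D y))) B') ∧
    ∃ B B' : Udot D →ₗ[Qvpi] Udot D →ₗ[Qvpi] Qvpi,
      IsDotForm D (QCG.tau1 D) (fun x y => Half.form D x y) B ∧
      (∀ x y : Udot D, B' x y = dagR (barR
        (B (Udot.dagger D (Udot.bar D x)) (Udot.dagger D (Udot.bar D y))))) ∧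
      IsDotForm D (QCG.tau1Second D)
        (fun x y => barR (Half.form D (Half.bar D x) (Half.bar D y))) B' ∧
      ∀ x y : Udot D, B' (Udot.omega D x) (Udot.omegaInv D y) = B' x y ∧
        B' (Udot.rho D x) (Udot.rho D y) = B' x y := by
  refine ⟨existsUnique_dotForm_tau1Prime D, ?_⟩
  obtain ⟨B, hB⟩ := exists_dotForm_tau1 D
  have hB' := isDotForm_twistForm D hB
  exact ⟨B, twistForm D B, hB, fun _ _ => rfl, hB',
    fun x y => ⟨hB'.omega_omegaInv x y, hB'.rho_rho x y⟩⟩
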